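/- Let $\alpha,\beta,\gamma\in\mathbb C$ and consider the Hamiltonian system $$\frac{dx}{dt}=\frac{\partial H}{\partial y}=xy+\gamma,\qquad \frac{dy}{dt}=-\frac{\partial H}{\partial x}=\tfrac32x^2-\tfrac12y^2+4\alpha x+2\beta,$$ $$H=\tfrac12xy^2-\tfrac12x^3-2\alpha x^2-2\beta x+\gamma y .$$ Let $v$ be the corresponding rational vector field on $\mathbb P^2\supset\mathbb C^2\ni(x,y)$ and on the surfaces obtained from $\mathbb P^2$ by blowing up points. Blow up, successively, the following nine points, each of which is a point of the surface obtained by the preceding blow-ups (a point is given by its position in a pair of affine coordinates): - in $(\frac1x,\frac yx)$ the point $(0,1)$; in $(\frac1x,\,y-x)$ the point $(0,2\alpha)$; in $(\frac1x,\,(y-x-2\alpha)x)$ the point $(0,-(2\alpha^2-2\beta+\gamma))$; - in $(\frac1x,\frac yx)$ the point $(0,-1)$; in $(\frac1x,\,y+x)$ the point $(0,-2\alpha)$; in $(\frac1x,\,(y+x+2\alpha)x)$ the point $(0,2\alpha^2-2\beta-\gamma)$; - in $(\frac xy,\frac1y)$ the point $(0,0)$; in $(x,\frac1y)$ the point $(0,0)$;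 in $(xy,\frac1y)$ the point $(-2\gamma,0)$. Let $X$ be the resulting rational surface. Then: 1. $X$ is of type $E_6^{(1)}$: the polar divisor of the 2-form $dx\wedge dy$ on $X$ is the anticanonical divisor $3D_0+2D_1+D_2+2D_3+D_4+2D_5+D_6$, where $D_0,\dots,D_6$ are distinct smooth rational curves with $D_i^2=-2$, with $D_i\cdot D_j=1$ for $\{i,j\}=\{0,1\},\{1,2\},\{0,3\},\{3,4\},\{0,5\},\{5,6\}$, and with $D_i\cdot D_j=0$ for all other $i\ne j$. 2. Let $D=D_0+\dots+D_6$. Then $v\in H^0(X,\Theta_X(-\log D)(D))$, and $v$ has no accessible singularity on $D$ (at a smooth point of $D$ with local coordinates such that $D=\{x_1=0\}$ and $v=g_1\frac{\partial}{\partial x_1}+\frac{g_2}{x_1}\frac{\partial}{\partial x_2}$, the singularity is accessible if $g_2$ vanishes at the point). The phase space, i.e. the set of the points of $X$ at which $v$ is regular, is $X\setminus D$. 3. The extended phase space $(X\setminus D)\times\mathbb C$ is obtained by gluing four copies $U_j\times\mathbb C=\mathbb C^2\times\mathbb C\ni(x_j,y_j,t)$, $j=0,1,2,3$ (with $t$ the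 common time), via the birational transformations \begin{align*} 0)\ & x_0=x,\quad y_0=y,\\ 1)\ & x_1=\tfrac1x,\quad y_1=-\left((y-x-2\alpha)x+2\alpha^2-2\beta+\gamma\right)x,\\ 2)\ & x_2=\tfrac1x,\quad y_2=-\left((y+x+2\alpha)x-2\alpha^2+2\beta+\gamma\right)x,\\ 3)\ & x_3=-(xy+2\gamma)y,\quad y_3=\tfrac1y . \end{align*} That is, the four copies are mapped injectively into, and together cover, $(X\setminus D)\times\mathbb C$; a point of $U_j\times\mathbb C$ and a point $(x,y,t)$ of $U_0\times\mathbb C$ are identified exactly when they are related by the above formulas with non-vanishing denominator and have the same $t$; and $U_j\times\mathbb C$ and $U_k\times\mathbb C$ with $j\neq k$ meet only inside $U_0\times\mathbb C$. 4. Each transformation is birational and symplectic, $dx_j\wedge dy_j=dx\wedge dy$, and in the coordinates $(x_j,y_j)$ the system is the Hamiltonian system whose Hamiltonian is $H$ expressed in $(x_j,y_j)$, which is a polynomial in $x_j,y_j$. -/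

import Mathlib

/-!
# Surfaces as models of the function field `ℂ(x, y)`

A rational surface with function field `K = ℂ(x, y)` is described, in the classical language of
models of a function field, by the set of its local rings at closed points.  The points are
subalgebras of `K`; equality of local rings is the gluing of charts along the open sets on which
the birational coordinate changes are biregular.
-/

namespace Ince

/-- The field `K = ℂ(x, y)` of rational functions on the plane. -/
abbrev K : Type := FractionRing (MvPolynomial (Fin 2) ℂ)

/-- Local rings of points and of curves: subalgebras of `ℂ(x, y)`. -/
abbrev Pt : Type := Subalgebra ℂ K

noncomputable section

/-- The coordinate function `x`. -/
def x : K := algebraMap (MvPolynomial (Fin 2) ℂ) K (MvPolynomial.X 0)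

/-- The coordinate function `y`. -/
def y : K := algebraMap (MvPolynomial (Fin 2) ℂ) K (MvPolynomial.X 1)

/-- Constants in `ℂ(x, y)`. -/
def const (c : ℂ) : K := algebraMap ℂ K c

/-! ### Points, projective plane, blowing up -/

/-- Given multiplicative sets of admissible denominators, the subalgebra of all fractions
`φ p / φ q`, with `q` admissible. -/
def fractions {A : Type} [CommRing A] [Algebra ℂ A] (φ : A →ₐ[ℂ] K) (S : Submonoid A) : Pt where
  carrier := {f | ∃ p, ∃ q ∈ S, f = φ p / φ q}
  mul_mem' := by
    rintro _ _ ⟨p, q, hq, rfl⟩ ⟨p', q', hq', rfl⟩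
    exact ⟨p * p', q * q', S.mul_mem hq hq', by simp [div_mul_div_comm]⟩
  add_mem' := by
    rintro _ _ ⟨p, q, hq, rfl⟩ ⟨p', q', hq', rfl⟩
    by_cases h : φ q = 0
    · exact ⟨p', q', hq', by simp [h]⟩
    by_cases h' : φ q' = 0
    · exact ⟨p, q, hq, by simp [h']⟩
    · exact ⟨p * q' + q * p', q * q', S.mul_mem hq hq', by simp [div_add_div _ _ h h']⟩
  algebraMap_mem' c := ⟨algebraMap ℂ A c, 1, S.one_mem, by simp⟩

/-- The local ring at the point `(a, b)` of the affine plane with coordinates `u, v`: all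
`p(u, v) / q(u, v)` with polynomials `p, q` such that `q(a, b) ≠ 0`. -/
def pointAt (u v : K) (a b : ℂ) : Pt :=
  fractions (MvPolynomial.aeval ![u, v])
    ((nonZeroDivisors ℂ).comap (MvPolynomial.eval ![a, b]))

/-- All points of the affine plane with coordinates `u, v`. -/
def affineChart (u v : K) : Set Pt := {R | ∃ a b : ℂ, R = pointAt u v a b}

/-- The projective plane with affine coordinates `(x, y)`. -/
def projectivePlane : Set Pt :=
  affineChart x y ∪ affineChart (1 / x) (y / x) ∪ affineChart (x / y) (1 / y)

/-- `R` is local and `u, v` generate its maximal ideal (local coordinates centred at `R`). -/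
def IsLocalCoord {R : Pt} (u v : R) : Prop :=
  nonunits R = (Ideal.span {u, v} : Ideal R)

/-- The polynomials over `R` whose constant coefficient is a unit of `R`. -/
def unitConstantCoeff (R : Pt) : Submonoid (Polynomial R) where
  carrier := {q | IsUnit (q.coeff 0)}
  one_mem' := by simp
  mul_mem' := by
    intro p q hp hq
    have h : IsUnit (p.coeff 0 * q.coeff 0) := hp.mul hq
    rwa [← Polynomial.mul_coeff_zero] at h

/-- The point `u = v / u = 0` of the blow-up of the point `R`, where `u, v` are local coordinates
centred at `R`: the localization of `R[v / u]` at the ideal `(u, v / u)`. It is the point of the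
exceptional curve in the direction of the curve `v = 0`. -/
def quadraticTransform (R : Pt) (u v : R) : Pt :=
  fractions (A := Polynomial R)
    ((Polynomial.aeval ((v : K) / (u : K)) : Polynomial R →ₐ[R] K).restrictScalars ℂ)
    (unitConstantCoeff R)

/-- The blow-up of the surface `X` at its point `R`: the point `R` is replaced by the points of the
exceptional curve. -/
def blowUp (X : Set Pt) (R : Pt) : Set Pt :=
  {S | S ∈ X ∧ S ≠ R} ∪ {S | ∃ u v : R, IsLocalCoord u v ∧ S = quadraticTransform R u v}

/-- `Y` is obtained from `X` by successively blowing up the points of a list. -/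
inductive IteratedBlowUp : Set Pt → List Pt → Set Pt → Prop
  | nil (X : Set Pt) : IteratedBlowUp X [] X
  | cons {X Y : Set Pt} {R : Pt} {l : List Pt} (hR : R ∈ X)
      (h : IteratedBlowUp (blowUp X R) l Y) : IteratedBlowUp X (R :: l) Y

/-! ### Curves and intersection numbers

A curve on a surface is given by its local ring `V`, a discrete valuation ring of `ℂ(x, y)`.
The curve passes through the point `R` if and only if `R ≤ V`. -/

/-- `g` is a unit of the ring `A`. -/
def UnitIn (A : Pt) (g : K) : Prop := g ≠ 0 ∧ g ∈ A ∧ g⁻¹ ∈ A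

/-- `V` is the local ring of an irreducible curve on the surface `X`: it is a discrete valuation
ring of `K` whose centre on some point of `X` is a prime ideal smaller than the maximal ideal. -/
def IsCurve (X : Set Pt) (V : Pt) : Prop :=
  IsDiscreteValuationRing V ∧ (∀ f : K, f ∈ V ∨ f⁻¹ ∈ V) ∧
    ∃ R ∈ X, R ≤ V ∧ ∃ g : R, ¬ IsUnit g ∧ UnitIn V g

/-- `f` is a local equation at `R` of the curve `V`: it generates the ideal of the functions in `R`
that vanish on the curve (the unit ideal, if the curve does not pass through `R`). -/
def IsLocalEquation (R V : Pt) (f : R) : Prop :=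
  (R ≤ V → ∀ g : R, ¬ UnitIn V g ↔ f ∣ g) ∧ (¬ R ≤ V → IsUnit f)

/-- The local intersection number `dim_ℂ R / (f, g)`. -/
def localIntersection {R : Pt} (f g : R) : ℕ :=
  Module.finrank ℂ (R ⧸ (Ideal.span {f, g} : Ideal R))

/-- The intersection number of the curves `W` and `V` on `X` is `n`, also for `W = V`: the number
`n` is the degree of the restriction to `V` of the line bundle of `W`. A rational function `h` is
chosen such that the divisor `W - div h` does not contain `V`; at a point `R` of `V`, this
divisor has a local equation `f / h = a / b` with `a, b` in `R` not vanishing identically on `V`,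
and its order at `R` on `V` is the difference of the local intersection numbers of `V` with `a`
and with `b`. The degree is the sum of these orders. -/
def HasIntersectionNumber (X : Set Pt) (W V : Pt) (n : ℤ) : Prop :=
  ∃ (h : K) (e : Pt → ℤ),
    (∀ R ∈ X, R ≤ V → ∃ f p a b : R,
      IsLocalEquation R W f ∧ IsLocalEquation R V p ∧ UnitIn V a ∧ UnitIn V b ∧
      (f : K) * b = h * a ∧
      e R = (localIntersection p a : ℤ) - (localIntersection p b : ℤ)) ∧
    {R | R ∈ X ∧ R ≤ V ∧ e R ≠ 0}.Finite ∧
    n = ∑ᶠ R ∈ {R | R ∈ X ∧ R ≤ V}, e R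

/-- The curve `V` on `X` is smooth and rational (its function field is `ℂ(t)` for some `t`). -/
def IsSmoothRational (X : Set Pt) (V : Pt) : Prop :=
  (∀ R ∈ X, R ≤ V → ∃ f z : R, IsLocalEquation R V f ∧ IsLocalCoord f z) ∧
  ∃ t ∈ V, ∀ g ∈ V, ∃ p q : Polynomial ℂ, UnitIn V (Polynomial.aeval t q) ∧
    ¬ UnitIn V (g - Polynomial.aeval t p / Polynomial.aeval t q)

/-! ### Differential forms -/

/-- The rational 2-form `df ∧ dg`. -/
def dWedge (f g : K) : ExteriorAlgebra K (Ω[K⁄ℂ]) :=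
  ExteriorAlgebra.ι K (KaehlerDifferential.D ℂ K f) *
    ExteriorAlgebra.ι K (KaehlerDifferential.D ℂ K g)

/-- On the surface `X`, the rational 2-form `ω` has the divisor `- ∑ i, m i • D i`. -/
def HasPolarDivisor {ι : Type} [Fintype ι] (X : Set Pt) (ω : ExteriorAlgebra K (Ω[K⁄ℂ]))
    (D : ι → Pt) (m : ι → ℕ) : Prop :=
  ∀ R ∈ X, ∃ (z w : R) (f : ι → R) (ε : R), IsLocalCoord z w ∧
    (∀ i, IsLocalEquation R (D i) (f i)) ∧ IsUnit ε ∧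
    ((∏ i, f i ^ m i : R) : K) • ω = (ε : K) • dWedge z w

/-! ### Type `E₆⁽¹⁾` -/

/-- The generalized Cartan matrix of the affine type `E₆⁽¹⁾`: the node `0` is the centre, and the
three branches are `0 - 1 - 2`, `0 - 3 - 4`, `0 - 5 - 6`. -/
def affineE6 : Matrix (Fin 7) (Fin 7) ℤ :=
  !![ 2, -1,  0, -1,  0, -1,  0;
     -1,  2, -1,  0,  0,  0,  0;
      0, -1,  2,  0,  0,  0,  0;
     -1,  0,  0,  2, -1,  0,  0;
      0,  0,  0, -1,  2,  0,  0;
     -1,  0,  0,  0,  0,  2, -1;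
      0,  0,  0,  0,  0, -1,  2]

/-- The surface `X` is of type `E₆⁽¹⁾`, with anticanonical divisor
`3 D₀ + 2 D₁ + D₂ + 2 D₃ + D₄ + 2 D₅ + D₆` equal to the polar divisor of the 2-form `ω`: the `D i`
are distinct smooth rational curves whose intersection matrix is minus the Cartan matrix of
type `E₆⁽¹⁾`. -/
structure IsOfTypeE6 (X : Set Pt) (ω : ExteriorAlgebra K (Ω[K⁄ℂ])) (D : Fin 7 → Pt) : Prop where
  injective : Function.Injective D
  isCurve : ∀ i, IsCurve X (D i)
  smoothRational : ∀ i, IsSmoothRational X (D i)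
  intersection : ∀ i j, HasIntersectionNumber X (D i) (D j) (- affineE6 i j)
  anticanonical : HasPolarDivisor X ω D ![3, 2, 1, 2, 1, 2, 1]

/-! ### Vector fields -/

/-- A rational vector field on the plane can be prescribed by its components. -/
theorem exists_derivation (a b : K) : ∃ v : Derivation ℂ K K, v x = a ∧ v y = b := by
  let d : Derivation ℂ (MvPolynomial (Fin 2) ℂ) K := MvPolynomial.mkDerivation ℂ ![a, b]
  let M := nonZeroDivisors (MvPolynomial (Fin 2) ℂ)
  let m := KaehlerDifferential.map ℂ ℂ (MvPolynomial (Fin 2) ℂ) K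
  have : IsLocalizedModule M m :=
    KaehlerDifferential.isLocalizedModule_map ℂ (MvPolynomial (Fin 2) ℂ) K M
  have hu : ∀ s : M, IsUnit ((algebraMap (MvPolynomial (Fin 2) ℂ)
      (Module.End (MvPolynomial (Fin 2) ℂ) K)) s) := fun s =>
    IsLocalizedModule.map_units (S := M) (Algebra.linearMap (MvPolynomial (Fin 2) ℂ) K) s
  let L := IsLocalizedModule.lift M m d.liftKaehlerDifferential hu
  let L' : Ω[K⁄ℂ] →ₗ[K] K := L.extendScalarsOfIsLocalization M K
  have key : ∀ p, L' (KaehlerDifferential.D ℂ K (algebraMap _ K p)) = d p := by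
    intro p
    have h := IsLocalizedModule.lift_apply M m d.liftKaehlerDifferential hu
      (KaehlerDifferential.D ℂ _ p)
    rw [KaehlerDifferential.map_D, Derivation.liftKaehlerDifferential_comp_D] at h
    exact h
  refine ⟨L'.compDer (KaehlerDifferential.D ℂ K), ?_, ?_⟩
  · exact (key _).trans (by simp [d])
  · exact (key _).trans (by simp [d])

/-- The Hamiltonian vector field `dx/dt = ∂H/∂y`, `dy/dt = -∂H/∂x`, as a derivation of
`ℂ(x, y)`. -/
def hamiltonianField (H : MvPolynomial (Fin 2) ℂ) : Derivation ℂ K K :=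
  (exists_derivation (MvPolynomial.aeval ![x, y] (MvPolynomial.pderiv 1 H))
    (-MvPolynomial.aeval ![x, y] (MvPolynomial.pderiv 0 H))).choose

/-- The points of `X` at which the vector field `v` is regular. -/
def regularLocus (X : Set Pt) (v : Derivation ℂ K K) : Set Pt :=
  {R | R ∈ X ∧ ∀ g ∈ R, v g ∈ R}

/-- The vector field `v` on `X` is a section of `Θ(-log D)(D)`, where `D` is the reduced divisor
`∑ i, D i`: if `F` is a local equation of `D`, then `F v` is regular and tangent to all `D i`. -/
def HasLogPole {ι : Type} [Fintype ι] (X : Set Pt) (D : ι → Pt) (v : Derivation ℂ K K) : Prop :=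
  ∀ R ∈ X, ∃ f : ι → R, (∀ i, IsLocalEquation R (D i) (f i)) ∧
    (∀ g : R, ∃ h : R, ((∏ i, f i : R) : K) * v g = h) ∧
    ∀ i, ∃ h : R, ((∏ i, f i : R) : K) * v (f i) = f i * h

/-- The point `R`, a smooth point of the divisor `D`, is an accessible singularity of the vector
field `v`: the regular vector field `F v` vanishes at `R`, where `F` is a local equation of `D`.
(In coordinates with `D : x₁ = 0`, where `v = g₁ ∂/∂x₁ + (g₂ / x₁) ∂/∂x₂`, this says
that `g₂` vanishes at the point.) -/
def IsAccessible {ι : Type} [Fintype ι] (D : ι → Pt) (v : Derivation ℂ K K) (R : Pt) : Prop :=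
  (∃! i, R ≤ D i) ∧ ∀ f : ι → R, (∀ i, IsLocalEquation R (D i) (f i)) →
    ∀ g : R, ∃ h : R, ¬ IsUnit h ∧ ((∏ i, f i : R) : K) * v g = h

/-! ### The Ince-XXX system -/

/-- `H = x y² / 2 - x³ / 2 - 2 α x² - 2 β x + γ y`. -/
def hamiltonian (α β γ : ℂ) : MvPolynomial (Fin 2) ℂ :=
  MvPolynomial.C (1 / 2) * MvPolynomial.X 0 * MvPolynomial.X 1 ^ 2
    - MvPolynomial.C (1 / 2) * MvPolynomial.X 0 ^ 3
    - MvPolynomial.C (2 * α) * MvPolynomial.X 0 ^ 2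
    - MvPolynomial.C (2 * β) * MvPolynomial.X 0
    + MvPolynomial.C γ * MvPolynomial.X 1

/-- The nine centres of the blow-ups: three on each of three branches. -/
def centres (α β γ : ℂ) : List Pt :=
  [ pointAt (1 / x) (y / x) 0 1,
    pointAt (1 / x) (y - x) 0 (2 * α),
    pointAt (1 / x) ((y - x - const (2 * α)) * x) 0 (-(2 * α ^ 2 - 2 * β + γ)),
    pointAt (1 / x) (y / x) 0 (-1),
    pointAt (1 / x) (y + x) 0 (-(2 * α)),
    pointAt (1 / x) ((y + x + const (2 * α)) * x) 0 (2 * α ^ 2 - 2 * β - γ),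
    pointAt (x / y) (1 / y) 0 0,
    pointAt x (1 / y) 0 0,
    pointAt (x * y) (1 / y) (-(2 * γ)) 0 ]

/-- The transformations `(x, y) ↦ (x_j, y_j)`, `j = 0, 1, 2, 3`, over any field. -/
def transform {F : Type} [Field F] (α β γ : F) (x y : F) : Fin 4 → F × F :=
  ![ (x, y),
     (1 / x, -(((y - x - 2 * α) * x + 2 * α ^ 2 - 2 * β + γ) * x)),
     (1 / x, -(((y + x + 2 * α) * x - 2 * α ^ 2 + 2 * β + γ) * x)),
     (-((x * y + 2 * γ) * y), 1 / y) ]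

/-- The denominators of the transformations. -/
def denominator {F : Type} [Field F] (x y : F) : Fin 4 → F := ![1, x, x, y]

/-- The rational functions `(x_j, y_j)`. -/
def coord (α β γ : ℂ) (j : Fin 4) : K × K := transform (const α) (const β) (const γ) x y j

/-- The `j`-th copy `U_j × ℂ` of `ℂ² × ℂ`, with coordinates `(x_j, y_j, t)`, as a set of points
(together with the time). -/
def chart (α β γ : ℂ) (j : Fin 4) (p : ℂ × ℂ × ℂ) : Pt × ℂ :=
  (pointAt (coord α β γ j).1 (coord α β γ j).2 p.1 p.2.1, p.2.2)

end

end Ince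

namespace Ince

/-! A point is a local ring in `ℂ(x, y)`, and every point that occurs has the form `pointAt p q a b`
with generators `p, q` of the field. Such a ring has a residue map to `ℂ`, and the proof reads
everything off residues (`Val`). The ring `pointAt p q a b` lies in a local ring `T` as soon as `p`
and `q` have residues `a` and `b` in `T`; hence two points coincide when the coordinates of each
take the right values at the other (`pointAt_eq`). Conversely, a function with residue `0` in one
ring and with inverse in another one forbids an inclusion of the second in the first
(`Val.inv_notMem`). Curves are handled in the same way, with residue field `ℂ(t)` (`curveAt_eq`).
The intrinsic blow-up is turned into its two usual charts by `exceptional_pointAt`, so that the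
surface becomes an explicit list of points (`of_mem_surface`).

The three directions at infinity are instances of one computation. In the linear coordinates `(X, Y)
= (x, y - x), (x, y + x), (y, -x)`, which satisfy `dX ∧ dY = dx ∧ dy`, put `u = 1/X`, `r = (Y -
e₁)X`, `q = (r - e₂)X`. Then `H = κ q + l r (Y + e₁) + m Y³ + c Y² + e Y` with `κ ≠ 0`, and the
centres are `u = Y/X = 0`, then `Y = e₁`, then `r = e₂` on `u = 0`. Since `r = e₂ + u q` and `Y = e₁
+ u r`, `H` is a polynomial in `u` and `q`; since `dX ∧ dY = -du ∧ dq`, the pair `(u, q)` is, up to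
sign or order, a symplectic chart. This is the origin of the transformations in the theorem.

Every blow-up on a branch lowers the pole order of the 2-form by one: it is `3` on the line at
infinity and `2, 1, 0` on the three exceptional curves. So `D` consists of the line and the first
two exceptional curves of each branch. Along `D` the field has a simple pole in the tangential
direction, with coefficient `(3/2)(1 - c²)` on the line, `-2κ(c - e₁)` on the first and `-κ(c - e₂)`
on the second exceptional curve. Its zeros are centres, which have been blown up. At the points `N0,
N1, N2`, which these charts miss, the corresponding coefficients are `-3κ, -2κ, -κ`. This
nonvanishing rules out accessible singularities and regular points on `D` simultaneously
(`localForm_surface`).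

For the self-intersections, `u` vanishes to first order on the line and on the exceptional curves of
its branch. The divisor of `u` has degree zero on a component `V`, so `V · V` is minus the number of
points where `V` meets the other curves on which `u` vanishes. This gives `-2` for both inner and
outer components. On the line, `1/x` serves: other curves of its zero divisor are met only at the
first two branches, because at the third one `1/x = -1/Y` is a local equation of the line itself.

Outside `D` there remain the affine plane and the three third exceptional curves. A chart `U_j` with
`j ≠ 0` lies in the affine plane where its distinguished coordinate is nonzero, and its remaining
axis is one of these curves. Curves of different branches are disjoint since `y/x` takes different
values on them. -/

open Polynomial in
/-- The rational functions in one variable. -/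
abbrev RatFun : Type := FractionRing ℂ[X]

noncomputable section

/-! ### Places -/

section Place

variable {R : Pt} {L : Type} [Field L] [Algebra ℂ L] {ev : R →ₐ[ℂ] L}

/-- The function `f` belongs to the ring `R`, and its residue is `l`. -/
def Val (ev : R →ₐ[ℂ] L) (f : K) (l : L) : Prop := ∃ h : f ∈ R, ev ⟨f, h⟩ = l

/-- `R` is a local ring, and `ev` is its residue map. -/
def IsPlace (ev : R →ₐ[ℂ] L) : Prop := ∀ f : R, ev f ≠ 0 → (f : K)⁻¹ ∈ R

theorem Val.mem {f : K} {l : L} (h : Val ev f l) : f ∈ R := h.1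

theorem Val.of_mem {f : K} (h : f ∈ R) : Val ev f (ev ⟨f, h⟩) := ⟨h, rfl⟩

theorem Val.congr {f g : K} {l m : L} (h : Val ev f l) (hf : f = g) (hl : l = m) :
    Val ev g m := hf ▸ hl ▸ h

theorem Val.unique {f : K} {l m : L} (h : Val ev f l) (h' : Val ev f m) : l = m :=
  h.2.symm.trans h'.2

theorem Val.add {f g : K} {l m : L} (h : Val ev f l) (h' : Val ev g m) :
    Val ev (f + g) (l + m) := by
  obtain ⟨h, rfl⟩ := h
  obtain ⟨h', rfl⟩ := h'
  exact ⟨R.add_mem h h', map_add ev ⟨f, h⟩ ⟨g, h'⟩⟩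

theorem Val.mul {f g : K} {l m : L} (h : Val ev f l) (h' : Val ev g m) :
    Val ev (f * g) (l * m) := by
  obtain ⟨h, rfl⟩ := h
  obtain ⟨h', rfl⟩ := h'
  exact ⟨R.mul_mem h h', map_mul ev ⟨f, h⟩ ⟨g, h'⟩⟩

theorem Val.sub {f g : K} {l m : L} (h : Val ev f l) (h' : Val ev g m) :
    Val ev (f - g) (l - m) := by
  obtain ⟨h, rfl⟩ := h
  obtain ⟨h', rfl⟩ := h'
  exact ⟨R.sub_mem h h', map_sub ev ⟨f, h⟩ ⟨g, h'⟩⟩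

theorem Val.neg {f : K} {l : L} (h : Val ev f l) : Val ev (-f) (-l) := by
  obtain ⟨h, rfl⟩ := h
  exact ⟨R.neg_mem h, map_neg ev ⟨f, h⟩⟩

theorem Val.pow {f : K} {l : L} (h : Val ev f l) (n : ℕ) : Val ev (f ^ n) (l ^ n) := by
  obtain ⟨h, rfl⟩ := h
  exact ⟨R.pow_mem h n, map_pow ev ⟨f, h⟩ n⟩

theorem Val.const (c : ℂ) : Val ev (const c) (algebraMap ℂ L c) :=
  ⟨R.algebraMap_mem c, ev.commutes c⟩

theorem Val.one : Val ev 1 1 := ⟨R.one_mem, map_one ev⟩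

theorem Val.zero : Val ev 0 0 := ⟨R.zero_mem, map_zero ev⟩

theorem Val.ofNat (n : ℕ) [n.AtLeastTwo] : Val ev (OfNat.ofNat n) (OfNat.ofNat n) :=
  ⟨ofNat_mem R n, map_ofNat ev n⟩

theorem Val.ne_zero {f : K} {l : L} (h : Val ev f l) (hl : l ≠ 0) : f ≠ 0 := by
  rintro rfl
  exact hl (h.unique Val.zero)

theorem Val.inv (hev : IsPlace ev) {f : K} {l : L} (h : Val ev f l) (hl : l ≠ 0) :
    Val ev f⁻¹ l⁻¹ := by
  obtain ⟨hf, rfl⟩ := h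
  have hi : f⁻¹ ∈ R := hev ⟨f, hf⟩ hl
  have h0 : f ≠ 0 := Val.ne_zero ⟨hf, rfl⟩ hl
  refine ⟨hi, eq_inv_of_mul_eq_one_left ?_⟩
  exact ((Val.of_mem hi).mul (Val.of_mem hf)).unique (Val.one.congr (inv_mul_cancel₀ h0).symm rfl)

theorem Val.div (hev : IsPlace ev) {f g : K} {l m : L} (h : Val ev f l) (h' : Val ev g m)
    (hm : m ≠ 0) : Val ev (f / g) (l / m) := by
  simpa only [div_eq_mul_inv] using h.mul (h'.inv hev hm)

/-- Otherwise `f * f⁻¹ = 1` would have residue `0`. All statements that two points differ, or that a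
point is not on a curve, come down to this. -/
theorem Val.inv_notMem {f : K} (h : Val ev f 0) (hf : f ≠ 0) : f⁻¹ ∉ R := fun hi =>
  zero_ne_one (((h.mul (Val.of_mem hi)).congr (mul_inv_cancel₀ hf) (zero_mul _)).unique Val.one)

theorem Val.aeval {u v : K} {a b : L} (hu : Val ev u a) (hv : Val ev v b)
    (P : MvPolynomial (Fin 2) ℂ) :
    Val ev (MvPolynomial.aeval ![u, v] P) (MvPolynomial.aeval ![a, b] P) := by
  obtain ⟨hu, rfl⟩ := hu
  obtain ⟨hv, rfl⟩ := hv
  have h₁ : (R.val.comp (MvPolynomial.aeval ![⟨u, hu⟩, ⟨v, hv⟩])) =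
      MvPolynomial.aeval ![u, v] := by
    apply MvPolynomial.algHom_ext
    intro i
    fin_cases i <;> simp
  have h₂ : (ev.comp (MvPolynomial.aeval ![⟨u, hu⟩, ⟨v, hv⟩])) =
      MvPolynomial.aeval ![ev ⟨u, hu⟩, ev ⟨v, hv⟩] := by
    apply MvPolynomial.algHom_ext
    intro i
    fin_cases i <;> simp
  rw [← h₁, ← h₂]
  exact ⟨Subtype.property _, rfl⟩

theorem isUnit_iff {R : Pt} {f : R} : IsUnit f ↔ f ≠ 0 ∧ (f : K)⁻¹ ∈ R := by
  constructor
  · rintro ⟨g, rfl⟩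
    refine ⟨g.ne_zero, ?_⟩
    have h : ((g : R) : K) * ((g⁻¹ : Rˣ) : R) = 1 := by
      exact_mod_cast congrArg Subtype.val g.mul_inv
    rw [inv_eq_of_mul_eq_one_right h]
    exact Subtype.property _
  · rintro ⟨h0, h⟩
    refine IsUnit.of_mul_eq_one ⟨_, h⟩ (Subtype.ext ?_)
    exact mul_inv_cancel₀ fun h' => h0 (Subtype.ext h')

theorem IsPlace.isUnit_iff (hev : IsPlace ev) {f : R} : IsUnit f ↔ ev f ≠ 0 := by
  constructor
  · intro h
    exact (h.map ev).ne_zero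
  · intro h
    exact Ince.isUnit_iff.2 ⟨fun h' => h (by rw [h', map_zero]), hev f h⟩

theorem IsPlace.unitIn_iff (hev : IsPlace ev) {f : K} :
    UnitIn R f ↔ ∃ l, l ≠ 0 ∧ Val ev f l := by
  constructor
  · rintro ⟨h0, h, hi⟩
    exact ⟨_, fun hl => Val.inv_notMem ⟨h, hl⟩ h0 hi, Val.of_mem h⟩
  · rintro ⟨l, hl, h⟩
    exact ⟨h.ne_zero hl, h.mem, (h.inv hev hl).mem⟩

/-- Functions of different residues separate points. -/
theorem eq_of_val {R' : Pt} {ev : R →ₐ[ℂ] ℂ} {ev' : R' →ₐ[ℂ] ℂ} (hev : IsPlace ev')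
    (h : R = R') {f : K} {a b : ℂ} (hf : Val ev f a) (hf' : Val ev' f b) : a = b := by
  subst h
  by_contra hab
  have h₁ : Val ev' (f - Ince.const a) (b - a) := hf'.sub (Val.const a)
  have h₂ : Val ev (f - Ince.const a) 0 := (hf.sub (Val.const a)).congr rfl (by simp)
  have hb : b - a ≠ 0 := sub_ne_zero.2 (Ne.symm hab)
  exact h₂.inv_notMem (h₁.ne_zero hb) (h₁.inv hev hb).mem

/-- A place with prescribed residues on a ring of fractions. -/
theorem exists_place {A : Type} [CommRing A] [Algebra ℂ A] (φ : A →ₐ[ℂ] K)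
    (hφ : Function.Injective φ) (θ : A →ₐ[ℂ] L) (S : Submonoid A) (hS : ∀ q, q ∈ S ↔ θ q ≠ 0) :
    ∃ ev : fractions φ S →ₐ[ℂ] L, IsPlace ev ∧ ∀ a, Val ev (φ a) (θ a) := by
  have h0 : ∀ q ∈ S, φ q ≠ 0 := by
    intro q hq h
    rw [← map_zero φ] at h
    exact (hS q).1 hq (by rw [hφ h, map_zero])
  have hrep : ∀ f : fractions φ S, ∃ p, ∃ q ∈ S, (f : K) = φ p / φ q := fun f => f.2
  choose n d hd hnd using hrep
  -- The chosen numerators and denominators are arbitrary; `key` says that any other representation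
  -- gives the same residue, so each ring axiom can be checked on a convenient one.
  have key : ∀ (f : fractions φ S) (p : A), ∀ q ∈ S, (f : K) = φ p / φ q →
      θ (n f) / θ (d f) = θ p / θ q := by
    intro f p q hq h
    rw [hnd f, div_eq_div_iff (h0 _ (hd f)) (h0 q hq), ← map_mul, ← map_mul] at h
    rw [div_eq_div_iff ((hS _).1 (hd f)) ((hS q).1 hq), ← map_mul, ← map_mul, hφ h]
  have hmk : ∀ a : A, φ a ∈ fractions φ S := fun a => ⟨a, 1, S.one_mem, by simp⟩
  let ev : fractions φ S →ₐ[ℂ] L :=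
    { toFun := fun f => θ (n f) / θ (d f)
      map_one' := by rw [key 1 1 1 S.one_mem (by simp)]; simp
      map_zero' := by rw [key 0 0 1 S.one_mem (by simp)]; simp
      map_mul' := by
        intro f g
        rw [key (f * g) (n f * n g) (d f * d g) (S.mul_mem (hd f) (hd g))
          (by rw [MulMemClass.coe_mul, hnd f, hnd g, map_mul, map_mul, div_mul_div_comm]),
          map_mul, map_mul, div_mul_div_comm]
      map_add' := by
        intro f g
        rw [key (f + g) (n f * d g + d f * n g) (d f * d g) (S.mul_mem (hd f) (hd g))
          (by rw [AddMemClass.coe_add, hnd f, hnd g, div_add_div _ _ (h0 _ (hd f)) (h0 _ (hd g))]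
              simp only [map_mul, map_add]),
          div_add_div _ _ ((hS _).1 (hd f)) ((hS _).1 (hd g))]
        simp only [map_mul, map_add]
      commutes' := by
        intro c
        rw [key (algebraMap ℂ _ c) (algebraMap ℂ A c) 1 S.one_mem (by simp)]
        simp }
  refine ⟨ev, ?_, fun a => ⟨hmk a, ?_⟩⟩
  · intro f hf
    have hf' : θ (n f) ≠ 0 := (div_ne_zero_iff.1 hf).1
    exact ⟨d f, n f, (hS _).2 hf', by rw [hnd f, inv_div]⟩
  · change θ (n _) / θ (d _) = _
    rw [key ⟨φ a, hmk a⟩ a 1 S.one_mem (by simp)]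
    simp

theorem fractions_le {A : Type} [CommRing A] [Algebra ℂ A] {φ : A →ₐ[ℂ] K} {S : Submonoid A}
    {T : Pt} (h : ∀ a, φ a ∈ T) (hS : ∀ q ∈ S, (φ q)⁻¹ ∈ T) : fractions φ S ≤ T := by
  rintro _ ⟨p, q, hq, rfl⟩
  rw [div_eq_mul_inv]
  exact T.mul_mem (h p) (hS q hq)

end Place

/-! ### Coordinates -/

/-- The functions `u, v` generate the field of rational functions. -/
def Gen (u v : K) : Prop := IntermediateField.adjoin ℂ {u, v} = ⊤

theorem Gen.of_mem {u v u' v' : K} (h : Gen u v)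
    (hu : u ∈ IntermediateField.adjoin ℂ {u', v'})
    (hv : v ∈ IntermediateField.adjoin ℂ {u', v'}) : Gen u' v' := by
  rw [Gen, eq_top_iff, ← h, IntermediateField.adjoin_le_iff]
  rintro _ (rfl | rfl)
  exacts [hu, hv]

theorem Gen.exists_eq_div {u v : K} (h : Gen u v) (f : K) : ∃ P Q : MvPolynomial (Fin 2) ℂ,
    f = MvPolynomial.aeval ![u, v] P / MvPolynomial.aeval ![u, v] Q := by
  have hf : f ∈ IntermediateField.adjoin ℂ {u, v} := by rw [h]; trivial
  have hr : ({u, v} : Set K) = Set.range ![u, v] := by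
    rw [Matrix.range_cons_cons_empty]
  rw [hr] at hf
  exact (IntermediateField.mem_adjoin_range_iff ℂ _ f).1 hf

theorem gen_x_y : Gen x y := by
  rw [Gen, eq_top_iff]
  intro f _
  have hx : x ∈ IntermediateField.adjoin ℂ {x, y} := IntermediateField.subset_adjoin ℂ _ (by simp)
  have hy : y ∈ IntermediateField.adjoin ℂ {x, y} := IntermediateField.subset_adjoin ℂ _ (by simp)
  have key : ∀ P : MvPolynomial (Fin 2) ℂ,
      algebraMap _ K P ∈ IntermediateField.adjoin ℂ {x, y} := by
    intro P
    induction P using MvPolynomial.induction_on with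
    | C c => exact IntermediateField.algebraMap_mem _ c
    | add p q hp hq => rw [map_add]; exact add_mem hp hq
    | mul_X p i hp =>
      rw [map_mul]
      refine mul_mem hp ?_
      fin_cases i
      exacts [hx, hy]
  obtain ⟨P, Q, rfl⟩ := IsLocalization.exists_mk'_eq (nonZeroDivisors (MvPolynomial (Fin 2) ℂ)) f
  rw [IsFractionRing.mk'_eq_div]
  exact div_mem (key _) (key _)

/-- The field has transcendence degree two and is algebraic over `ℂ[u, v]`, so the two elements `u,
v` must form a transcendence basis. -/
theorem Gen.injective {u v : K} (h : Gen u v) : Function.Injective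
    (MvPolynomial.aeval ![u, v] : MvPolynomial (Fin 2) ℂ →ₐ[ℂ] K) := by
  have : Algebra.IsAlgebraic (MvPolynomial (Fin 2) ℂ) K := IsLocalization.isAlgebraic K
    (nonZeroDivisors (MvPolynomial (Fin 2) ℂ))
  have hb : IsTranscendenceBasis ℂ ((algebraMap (MvPolynomial (Fin 2) ℂ) K) ∘
      (MvPolynomial.X : Fin 2 → MvPolynomial (Fin 2) ℂ)) :=
    (IsTranscendenceBasis.mvPolynomial (Fin 2) ℂ).algebraMap_comp
  have halg : Algebra.IsAlgebraic (Algebra.adjoin ℂ (Set.range ![u, v])) K := by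
    refine ⟨fun f => ?_⟩
    obtain ⟨P, Q, rfl⟩ := h.exists_eq_div f
    have hm : ∀ P : MvPolynomial (Fin 2) ℂ, IsAlgebraic (Algebra.adjoin ℂ (Set.range ![u, v]))
        (MvPolynomial.aeval ![u, v] P) := by
      intro P
      have : MvPolynomial.aeval ![u, v] P ∈ Algebra.adjoin ℂ (Set.range ![u, v]) := by
        rw [Algebra.adjoin_range_eq_range_aeval]
        exact ⟨P, rfl⟩
      exact isAlgebraic_algebraMap
        (⟨_, this⟩ : Algebra.adjoin ℂ (Set.range ![u, v]))
    rw [div_eq_mul_inv]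
    exact (hm P).mul (hm Q).inv
  have := Algebra.IsAlgebraic.isTranscendenceBasis_of_le_trdeg_of_finite ℂ ![u, v]
    hb.cardinalMk_eq_trdeg.le
  exact this.1

theorem Gen.swap {u v : K} (h : Gen u v) : Gen v u := by rwa [Gen, Set.pair_comm]

theorem Gen.ne_zero {u v : K} (h : Gen u v) : u ≠ 0 := by
  intro h0
  have := h.injective (a₁ := MvPolynomial.X 0) (a₂ := 0) (by simpa using h0)
  exact MvPolynomial.X_ne_zero _ this

theorem Gen.sub_ne_zero {u v : K} (h : Gen u v) (c : ℂ) : u - const c ≠ 0 := by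
  intro h0
  have := h.injective (a₁ := MvPolynomial.X 0 - MvPolynomial.C c) (a₂ := 0) (by
    rw [map_sub, MvPolynomial.aeval_X, MvPolynomial.aeval_C, map_zero]
    exact h0)
  -- At `(c + 1, 0)` the polynomial takes the value `1`.
  have h1 := congrArg (MvPolynomial.eval ![c + 1, 0]) this
  simp at h1

/-- Together with `Gen.div'`, this covers the two charts of the blow-up of the point `u = 0, v = c`.
-/
theorem Gen.div {u v : K} (h : Gen u v) (c : ℂ) : Gen u ((v - const c) / u) := by
  have h0 := h.ne_zero
  have hu : u ∈ IntermediateField.adjoin ℂ {u, (v - const c) / u} :=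
    IntermediateField.subset_adjoin ℂ _ (by simp)
  have hw : (v - const c) / u ∈ IntermediateField.adjoin ℂ {u, (v - const c) / u} :=
    IntermediateField.subset_adjoin ℂ _ (by simp)
  refine h.of_mem hu ?_
  have := add_mem (mul_mem hw hu) (IntermediateField.algebraMap_mem _ c)
  rwa [div_mul_cancel₀ _ h0, ← const, sub_add_cancel] at this

theorem Gen.div' {u v : K} (h : Gen u v) (c : ℂ) : Gen (u / (v - const c)) (v - const c) := by
  have h0 := h.swap.sub_ne_zero c
  set w := v - const c
  have hu : u / w ∈ IntermediateField.adjoin ℂ {u / w, w} :=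
    IntermediateField.subset_adjoin ℂ _ (by simp)
  have hw : w ∈ IntermediateField.adjoin ℂ {u / w, w} :=
    IntermediateField.subset_adjoin ℂ _ (by simp)
  refine h.of_mem ?_ ?_
  · have := mul_mem hu hw
    rwa [div_mul_cancel₀ _ h0] at this
  · have := add_mem hw (IntermediateField.algebraMap_mem _ c)
    rwa [← const, sub_add_cancel] at this

/-! ### Points of an affine plane -/

theorem exists_place_pointAt {u v : K} (h : Gen u v) (a b : ℂ) :
    ∃ ev : pointAt u v a b →ₐ[ℂ] ℂ, IsPlace ev ∧ Val ev u a ∧ Val ev v b := by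
  obtain ⟨ev, hev, hval⟩ := exists_place _ h.injective
    (MvPolynomial.aeval ![a, b] : MvPolynomial (Fin 2) ℂ →ₐ[ℂ] ℂ)
    ((nonZeroDivisors ℂ).comap (MvPolynomial.eval ![a, b])) (fun q => by
      rw [Submonoid.mem_comap, mem_nonZeroDivisors_iff_ne_zero, MvPolynomial.aeval_eq_eval])
  refine ⟨ev, hev, ?_, ?_⟩
  · exact (hval (MvPolynomial.X 0)).congr (by simp) (by simp)
  · exact (hval (MvPolynomial.X 1)).congr (by simp) (by simp)

/-- The residue in `T` of a denominator is its value at `(a, b)`, which is nonzero; so all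
denominators are invertible in `T`. -/
theorem pointAt_le {T : Pt} {L : Type} [Field L] [Algebra ℂ L] {ev : T →ₐ[ℂ] L}
    (hev : IsPlace ev) {u v : K} {a b : ℂ} (hu : Val ev u (algebraMap ℂ L a))
    (hv : Val ev v (algebraMap ℂ L b)) : pointAt u v a b ≤ T := by
  refine fractions_le (fun P => (hu.aeval hv P).mem) fun q hq => ((hu.aeval hv q).inv hev ?_).mem
  rw [Submonoid.mem_comap, mem_nonZeroDivisors_iff_ne_zero] at hq
  have : MvPolynomial.aeval ![algebraMap ℂ L a, algebraMap ℂ L b] q =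
      algebraMap ℂ L (MvPolynomial.eval ![a, b] q) := by
    rw [← MvPolynomial.aeval_eq_eval, ← MvPolynomial.aeval_algebraMap_apply]
    congr 2
    ext i
    fin_cases i <;> rfl
  rw [this]
  simpa using hq

/-- If a denominator had residue `q(0, t) = 0` with `t` transcendental, then `q` would vanish
identically on the axis, in particular at `(0, b)`. This puts all the points `(0, b)` on the curve
`u = 0` at once. -/
theorem pointAt_le_of_transcendental {T : Pt} {L : Type} [Field L] [Algebra ℂ L] {ev : T →ₐ[ℂ] L}
    (hev : IsPlace ev) {u v : K} {b : ℂ} {t : L} (hu : Val ev u 0) (hv : Val ev v t)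
    (ht : Transcendental ℂ t) : pointAt u v 0 b ≤ T := by
  refine fractions_le (fun P => (hu.aeval hv P).mem) fun q hq => ((hu.aeval hv q).inv hev ?_).mem
  rw [Submonoid.mem_comap, mem_nonZeroDivisors_iff_ne_zero] at hq
  intro h0
  refine hq ?_
  have h₁ : MvPolynomial.aeval ![(0 : L), t] =
      (Polynomial.aeval t).comp (MvPolynomial.aeval ![(0 : Polynomial ℂ), Polynomial.X]) := by
    apply MvPolynomial.algHom_ext
    intro i
    fin_cases i <;> simp
  have h₂ : MvPolynomial.aeval ![(0 : ℂ), b] =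
      (Polynomial.aeval b).comp (MvPolynomial.aeval ![(0 : Polynomial ℂ), Polynomial.X]) := by
    apply MvPolynomial.algHom_ext
    intro i
    fin_cases i <;> simp
  rw [h₁, AlgHom.comp_apply] at h0
  have h3 := (transcendental_iff.1 ht) _ h0
  change MvPolynomial.eval ![0, b] q = 0
  rw [← MvPolynomial.aeval_eq_eval, h₂]
  simp [h3]

/-! ### Ideals of points and of coordinate axes in the polynomial ring -/

/-- Restriction of polynomials to the axis where the first variable vanishes. -/
def axis : MvPolynomial (Fin 2) ℂ →ₐ[ℂ] Polynomial ℂ := MvPolynomial.aeval ![0, Polynomial.X]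

/-- Modulo the first variable, a polynomial equals its restriction to the axis. -/
theorem X_dvd_of_axis {P : MvPolynomial (Fin 2) ℂ} (h : axis P = 0) : MvPolynomial.X 0 ∣ P := by
  let I : Ideal (MvPolynomial (Fin 2) ℂ) := Ideal.span {MvPolynomial.X 0}
  have h₁ : Ideal.Quotient.mkₐ ℂ I =
      ((Ideal.Quotient.mkₐ ℂ I).comp (Polynomial.aeval (MvPolynomial.X 1))).comp axis := by
    apply MvPolynomial.algHom_ext
    intro i
    fin_cases i
    · simpa [axis] using Ideal.Quotient.eq_zero_iff_mem.2 (Ideal.mem_span_singleton_self _)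
    · simp [axis]
  have h₂ : Ideal.Quotient.mkₐ ℂ I P = 0 := by
    rw [h₁, AlgHom.comp_apply, h, map_zero]
  exact Ideal.mem_span_singleton.1 (Ideal.Quotient.eq_zero_iff_mem.1 h₂)

theorem mem_span_of_eval {P : MvPolynomial (Fin 2) ℂ} {a b : ℂ}
    (h : MvPolynomial.eval ![a, b] P = 0) : ∃ A B, P =
      A * (MvPolynomial.X 0 - MvPolynomial.C a) + B * (MvPolynomial.X 1 - MvPolynomial.C b) := by
  let I : Ideal (MvPolynomial (Fin 2) ℂ) :=
    Ideal.span {MvPolynomial.X 0 - MvPolynomial.C a, MvPolynomial.X 1 - MvPolynomial.C b}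
  have h₁ : Ideal.Quotient.mkₐ ℂ I =
      (Algebra.ofId ℂ _).comp (MvPolynomial.aeval ![a, b]) := by
    apply MvPolynomial.algHom_ext
    intro i
    fin_cases i
    · have := (Ideal.Quotient.mk_eq_mk_iff_sub_mem (I := I) (MvPolynomial.X 0)
        (MvPolynomial.C a)).2 (Ideal.subset_span (by simp))
      simp only [AlgHom.comp_apply, MvPolynomial.aeval_X]
      exact this
    · have := (Ideal.Quotient.mk_eq_mk_iff_sub_mem (I := I) (MvPolynomial.X 1)
        (MvPolynomial.C b)).2 (Ideal.subset_span (by simp))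
      simp only [AlgHom.comp_apply, MvPolynomial.aeval_X]
      exact this
  have h₂ : Ideal.Quotient.mkₐ ℂ I P = 0 := by
    rw [h₁, AlgHom.comp_apply, MvPolynomial.aeval_eq_eval]
    rw [h, map_zero]
  obtain ⟨A, B, h⟩ := Ideal.mem_span_pair.1 (Ideal.Quotient.eq_zero_iff_mem.1 h₂)
  exact ⟨A, B, h.symm⟩

/-- The variable generates the kernel of `axis`, whose target is a domain; hence it is prime. -/
theorem irreducible_X_zero : Irreducible (MvPolynomial.X 0 : MvPolynomial (Fin 2) ℂ) := by
  have hX : axis (MvPolynomial.X 0) = 0 := by simp [axis]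
  refine Prime.irreducible ⟨MvPolynomial.X_ne_zero _, fun h => (h.map axis).ne_zero hX, ?_⟩
  rintro P Q ⟨A, hA⟩
  have h : axis P * axis Q = 0 := by rw [← map_mul, hA, map_mul, hX, zero_mul]
  exact (mul_eq_zero.1 h).imp X_dvd_of_axis X_dvd_of_axis

theorem exists_eq_X_pow_mul {P : MvPolynomial (Fin 2) ℂ} (h : P ≠ 0) :
    ∃ n Q, axis Q ≠ 0 ∧ P = MvPolynomial.X 0 ^ n * Q := by
  obtain ⟨n, Q, hQ, h⟩ := WfDvdMonoid.max_power_factor h irreducible_X_zero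
  exact ⟨n, Q, fun h0 => hQ (X_dvd_of_axis h0), h⟩

/-! ### Local coordinates at a point -/

/-- The numerator of `f` vanishes at `(a, b)` and so lies in the ideal of this point. This makes the
maximal ideal explicit. -/
theorem exists_eq_add_of_val {u v : K} {a b : ℂ} {ev : pointAt u v a b →ₐ[ℂ] ℂ}
    (hev : IsPlace ev) (hu : Val ev u a) (hv : Val ev v b) {f : K} (hf : Val ev f 0) :
    ∃ A ∈ pointAt u v a b, ∃ B ∈ pointAt u v a b,
      f = A * (u - const a) + B * (v - const b) := by
  obtain ⟨hf', h0⟩ := hf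
  obtain ⟨P, Q, hQ, rfl⟩ := id hf'
  have hQ' : MvPolynomial.aeval ![a, b] Q ≠ 0 := by
    rw [Submonoid.mem_comap, mem_nonZeroDivisors_iff_ne_zero] at hQ
    exact hQ
  have hP := hu.aeval hv P
  have hq := (hu.aeval hv Q).inv hev hQ'
  have h1 := (hP.mul hq).congr (div_eq_mul_inv _ _).symm rfl
  have h2 := h1.unique ⟨hf', h0⟩
  have h3 : MvPolynomial.eval ![a, b] P = 0 :=
    (mul_eq_zero.1 h2).resolve_right (inv_ne_zero hQ')
  obtain ⟨A, B, rfl⟩ := mem_span_of_eval h3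
  refine ⟨_, mul_mem hq.mem (hu.aeval hv A).mem, _, mul_mem hq.mem (hu.aeval hv B).mem, ?_⟩
  simp [const]
  ring

theorem isLocalCoord_iff {R : Pt} {ev : R →ₐ[ℂ] ℂ} (hev : IsPlace ev) (z w : R) :
    IsLocalCoord z w ↔ ev z = 0 ∧ ev w = 0 ∧ ∀ f : R, ev f = 0 → ∃ A B, f = A * z + B * w := by
  have hn : nonunits R = {f | ev f = 0} := by
    ext f
    rw [mem_nonunits_iff, hev.isUnit_iff, not_not]
    rfl
  rw [IsLocalCoord, hn]
  constructor
  · intro h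
    have hm : ∀ f, ev f = 0 ↔ f ∈ (Ideal.span {z, w} : Ideal R) := fun f => by
      rw [← SetLike.mem_coe, ← h]; rfl
    refine ⟨(hm z).2 (Ideal.subset_span (by simp)), (hm w).2 (Ideal.subset_span (by simp)), ?_⟩
    intro f hf
    obtain ⟨A, B, h⟩ := Ideal.mem_span_pair.1 ((hm f).1 hf)
    exact ⟨A, B, h.symm⟩
  · rintro ⟨hz, hw, h⟩
    ext f
    rw [SetLike.mem_coe, Ideal.mem_span_pair]
    constructor
    · intro hf
      obtain ⟨A, B, h⟩ := h f hf
      exact ⟨A, B, h.symm⟩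
    · rintro ⟨A, B, rfl⟩
      simp [hz, hw]

theorem isLocalCoord_pointAt {u v : K} (h : Gen u v) {a b : ℂ} {z w : pointAt u v a b}
    (hz : (z : K) = u - const a) (hw : (w : K) = v - const b) : IsLocalCoord z w := by
  obtain ⟨ev, hev, hu, hv⟩ := exists_place_pointAt h a b
  have hz' : ev z = 0 := by
    have := (hu.sub (Val.const a)).congr hz.symm rfl
    simpa using this.2
  have hw' : ev w = 0 := by
    have := (hv.sub (Val.const b)).congr hw.symm rfl
    simpa using this.2
  refine (isLocalCoord_iff hev z w).2 ⟨hz', hw', fun f hf => ?_⟩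
  obtain ⟨A, hA, B, hB, h⟩ := exists_eq_add_of_val hev hu hv (f := f) ⟨f.2, hf⟩
  exact ⟨⟨A, hA⟩, ⟨B, hB⟩, Subtype.ext (by rw [h, ← hz, ← hw]; rfl)⟩

theorem IsLocalCoord.swap {R : Pt} {z w : R} (h : IsLocalCoord z w) : IsLocalCoord w z := by
  rwa [IsLocalCoord, Set.pair_comm]

theorem localIntersection_of_isUnit {R : Pt} {f g : R} (h : IsUnit g) :
    localIntersection f g = 0 := by
  have : (Ideal.span {f, g} : Ideal R) = ⊤ :=
    Ideal.eq_top_of_isUnit_mem _ (Ideal.subset_span (by simp)) h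
  have : Subsingleton (R ⧸ (Ideal.span {f, g} : Ideal R)) := Ideal.Quotient.subsingleton_iff.2 this
  exact Module.finrank_zero_of_subsingleton

/-- Local coordinates generate the maximal ideal, which is the kernel of the residue map onto `ℂ`.
-/
theorem localIntersection_of_isLocalCoord {R : Pt} {ev : R →ₐ[ℂ] ℂ} (hev : IsPlace ev) {f g : R}
    (h : IsLocalCoord f g) : localIntersection f g = 1 := by
  obtain ⟨hf, hg, h⟩ := (isLocalCoord_iff hev f g).1 h
  have hs : Function.Surjective ev := fun c => ⟨algebraMap ℂ R c, ev.commutes c⟩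
  have : (Ideal.span {f, g} : Ideal R) = RingHom.ker ev := by
    ext r
    rw [Ideal.mem_span_pair, RingHom.mem_ker]
    constructor
    · rintro ⟨A, B, rfl⟩
      simp [hf, hg]
    · intro hr
      obtain ⟨A, B, h⟩ := h r hr
      exact ⟨A, B, h.symm⟩
  rw [localIntersection, this,
    (Ideal.quotientKerAlgEquivOfSurjective hs).toLinearEquiv.finrank_eq, Module.finrank_self]

/-! ### Curves -/

/-- The local ring of the curve `u = 0` in the affine plane with coordinates `u, v`. -/
def curveAt (u v : K) : Pt :=
  fractions (MvPolynomial.aeval ![u, v]) ((nonZeroDivisors (Polynomial ℂ)).comap axis)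

/-- The variable of the field of rational functions. -/
def ratVar : RatFun := algebraMap (Polynomial ℂ) RatFun Polynomial.X

theorem aeval_ratVar (p : Polynomial ℂ) :
    Polynomial.aeval ratVar p = algebraMap (Polynomial ℂ) RatFun p := by
  rw [ratVar, Polynomial.aeval_algebraMap_apply, Polynomial.aeval_X_left_apply]

theorem transcendental_ratVar : Transcendental ℂ ratVar := by
  rw [transcendental_iff]
  intro p hp
  rw [aeval_ratVar] at hp
  exact (map_eq_zero_iff _ (IsFractionRing.injective (Polynomial ℂ) RatFun)).1 hp

theorem aeval_axis {L : Type} [Field L] [Algebra ℂ L] (t : L) (P : MvPolynomial (Fin 2) ℂ) :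
    MvPolynomial.aeval ![0, t] P = Polynomial.aeval t (axis P) := by
  have h₁ : MvPolynomial.aeval ![(0 : L), t] = (Polynomial.aeval t).comp axis := by
    apply MvPolynomial.algHom_ext
    intro i
    fin_cases i <;> simp [axis]
  rw [h₁, AlgHom.comp_apply]

theorem mem_comap_axis {q : MvPolynomial (Fin 2) ℂ} :
    q ∈ (nonZeroDivisors (Polynomial ℂ)).comap axis ↔ axis q ≠ 0 := by
  rw [Submonoid.mem_comap, mem_nonZeroDivisors_iff_ne_zero]

theorem exists_place_curveAt {u v : K} (h : Gen u v) :
    ∃ ev : curveAt u v →ₐ[ℂ] RatFun, IsPlace ev ∧ Val ev u 0 ∧ Val ev v ratVar := by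
  obtain ⟨ev, hev, hval⟩ := exists_place _ h.injective
    (MvPolynomial.aeval ![0, ratVar] : MvPolynomial (Fin 2) ℂ →ₐ[ℂ] RatFun)
    ((nonZeroDivisors (Polynomial ℂ)).comap axis) (fun q => by
      rw [mem_comap_axis, aeval_axis, aeval_ratVar, ne_eq, ne_eq,
        map_eq_zero_iff _ (IsFractionRing.injective (Polynomial ℂ) RatFun)])
  refine ⟨ev, hev, ?_, ?_⟩
  · exact (hval (MvPolynomial.X 0)).congr (by simp) (by simp)
  · exact (hval (MvPolynomial.X 1)).congr (by simp) (by simp)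

theorem curveAt_le {T : Pt} {L : Type} [Field L] [Algebra ℂ L] {ev : T →ₐ[ℂ] L}
    (hev : IsPlace ev) {u v : K} {t : L} (hu : Val ev u 0) (hv : Val ev v t)
    (ht : Transcendental ℂ t) : curveAt u v ≤ T := by
  refine fractions_le (fun P => (hu.aeval hv P).mem) fun q hq => ((hu.aeval hv q).inv hev ?_).mem
  rw [mem_comap_axis] at hq
  rw [aeval_axis]
  exact fun h0 => hq (transcendental_iff.1 ht _ h0)

/-- The order along the curve `u = 0`: the powers of the first variable are split off from numerator
and denominator, and what is left does not vanish identically on the axis. -/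
theorem exists_eq_zpow_mul {u v : K} (h : Gen u v) {f : K} (hf : f ≠ 0) :
    ∃ (n : ℤ) (g : K), UnitIn (curveAt u v) g ∧ f = u ^ n * g := by
  have hu := h.ne_zero
  obtain ⟨ev, hev, hu', hv'⟩ := exists_place_curveAt h
  obtain ⟨P, Q, rfl⟩ := h.exists_eq_div f
  have hP : P ≠ 0 := by rintro rfl; simp at hf
  have hQ : Q ≠ 0 := by rintro rfl; simp at hf
  obtain ⟨m, P', hP', rfl⟩ := exists_eq_X_pow_mul hP
  obtain ⟨n, Q', hQ', rfl⟩ := exists_eq_X_pow_mul hQ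
  have hne : ∀ P, axis P ≠ 0 → MvPolynomial.aeval ![0, ratVar] P ≠ 0 := by
    intro P hP h0
    rw [aeval_axis] at h0
    exact hP (transcendental_iff.1 transcendental_ratVar _ h0)
  refine ⟨m - n, MvPolynomial.aeval ![u, v] P' / MvPolynomial.aeval ![u, v] Q', ?_, ?_⟩
  · exact hev.unitIn_iff.2 ⟨_, div_ne_zero (hne _ hP') (hne _ hQ'),
      (hu'.aeval hv' P').div hev (hu'.aeval hv' Q') (hne _ hQ')⟩
  · rw [zpow_sub₀ hu]
    simp
    rw [mul_div_mul_comm]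

/-- A valuation ring is maximal: an element of `T` of negative order would bring an inverse power of
`u` into `T`, although `u` has residue `0` there. The lemma identifies a curve seen in different
charts. -/
theorem curveAt_eq {u v : K} (h : Gen u v) {T : Pt} {L : Type} [Field L] [Algebra ℂ L]
    {ev : T →ₐ[ℂ] L} (hev : IsPlace ev) {t : L} (hu : Val ev u 0) (hv : Val ev v t)
    (ht : Transcendental ℂ t) : curveAt u v = T := by
  have hle := curveAt_le hev hu hv ht
  obtain ⟨ev', hev', hu', hv'⟩ := exists_place_curveAt h
  refine le_antisymm hle fun f hf => ?_
  rcases eq_or_ne f 0 with rfl | h0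
  · exact zero_mem _
  obtain ⟨n, g, hg, rfl⟩ := exists_eq_zpow_mul h h0
  rcases lt_or_ge n 0 with hn | hn
  · obtain ⟨k, rfl⟩ := Int.exists_eq_neg_ofNat hn.le
    exfalso
    have hk : k ≠ 0 := by rintro rfl; simp at hn
    refine Val.inv_notMem ((hu.pow k).congr rfl (zero_pow hk)) (pow_ne_zero k h.ne_zero) ?_
    have : u ^ (-(k : ℤ)) * g * g⁻¹ ∈ T := mul_mem hf (hle hg.2.2)
    rwa [mul_inv_cancel_right₀ hg.1, zpow_neg, zpow_natCast] at this
  · obtain ⟨k, rfl⟩ := Int.eq_ofNat_of_zero_le hn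
    rw [zpow_natCast]
    exact mul_mem (hu'.pow k).mem hg.2.1

theorem pointAt_le_curveAt {u v : K} (h : Gen u v) (b : ℂ) :
    pointAt u v 0 b ≤ curveAt u v := by
  obtain ⟨ev', hev', hu', hv'⟩ := exists_place_curveAt h
  exact pointAt_le_of_transcendental hev' hu' hv' transcendental_ratVar

theorem isLocalEquation_of_not_le {R V : Pt} (h : ¬ R ≤ V) {f : R} (hf : IsUnit f) :
    IsLocalEquation R V f := ⟨fun h' => absurd h' h, fun _ => hf⟩

/-- A fraction that is not a unit along the curve has a numerator vanishing on the axis, hence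
divisible by the first variable; its denominator stays invertible at the point. -/
theorem isLocalEquation_curveAt {u v : K} (h : Gen u v) (b : ℂ) {f : pointAt u v 0 b}
    (hf : (f : K) = u) : IsLocalEquation (pointAt u v 0 b) (curveAt u v) f := by
  have hle := pointAt_le_curveAt h b
  refine ⟨fun _ g => ?_, fun h => absurd hle h⟩
  obtain ⟨ev', hev', hu', hv'⟩ := exists_place_curveAt h
  obtain ⟨ev, hev, hu, hv⟩ := exists_place_pointAt h 0 b
  rw [hev'.unitIn_iff]
  constructor
  · intro hg
    obtain ⟨g, P, Q, hQ, rfl⟩ := g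
    have hQ' : MvPolynomial.aeval ![0, b] Q ≠ 0 := by
      rw [Submonoid.mem_comap, mem_nonZeroDivisors_iff_ne_zero] at hQ
      exact hQ
    have hax : axis Q ≠ 0 := by
      intro h0
      rw [aeval_axis, h0, map_zero] at hQ'
      exact hQ' rfl
    have hne : ∀ P, axis P ≠ 0 → MvPolynomial.aeval ![0, ratVar] P ≠ 0 := by
      intro P hP h0
      rw [aeval_axis] at h0
      exact hP (transcendental_iff.1 transcendental_ratVar _ h0)
    have hP : axis P = 0 := by
      by_contra h0
      exact hg ⟨_, div_ne_zero (hne _ h0) (hne _ hax),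
        (hu'.aeval hv' P).div hev' (hu'.aeval hv' Q) (hne _ hax)⟩
    obtain ⟨P', rfl⟩ := X_dvd_of_axis hP
    refine ⟨⟨_, ((hu.aeval hv P').div hev (hu.aeval hv Q) hQ').mem⟩, Subtype.ext ?_⟩
    simp [hf, mul_div_assoc]
  · rintro ⟨g, rfl⟩ ⟨l, hl, hval⟩
    refine hl (hval.unique ?_)
    exact (hu'.mul (Val.of_mem (hle g.2))).congr (congrArg (· * (g : K)) hf.symm) (zero_mul _)

theorem isDiscreteValuationRing_curveAt {u v : K} (h : Gen u v) :
    IsDiscreteValuationRing (curveAt u v) := by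
  obtain ⟨ev, hev, hu, hv⟩ := exists_place_curveAt h
  have hu0 : (⟨u, hu.mem⟩ : curveAt u v) ≠ 0 := fun h0 => h.ne_zero (congrArg Subtype.val h0)
  have hnu : ¬ IsUnit (⟨u, hu.mem⟩ : curveAt u v) := fun hun => hev.isUnit_iff.1 hun hu.2
  have hfac : ∀ f : curveAt u v, f ≠ 0 → ∃ (n : ℕ) (g : curveAt u v), IsUnit g ∧
      ⟨u, hu.mem⟩ ^ n * g = f := by
    rintro ⟨f, hf⟩ hf0
    obtain ⟨n, g, hg, rfl⟩ := exists_eq_zpow_mul h (f := f) fun h0 => hf0 (Subtype.ext h0)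
    rcases lt_or_ge n 0 with hn | hn
    · obtain ⟨k, rfl⟩ := Int.exists_eq_neg_ofNat hn.le
      exfalso
      have hk : k ≠ 0 := by rintro rfl; simp at hn
      refine Val.inv_notMem ((hu.pow k).congr rfl (zero_pow hk)) (pow_ne_zero k h.ne_zero) ?_
      have := mul_mem hf hg.2.2
      rwa [mul_inv_cancel_right₀ hg.1, zpow_neg, zpow_natCast] at this
    · obtain ⟨k, rfl⟩ := Int.eq_ofNat_of_zero_le hn
      refine ⟨k, ⟨g, hg.2.1⟩, isUnit_iff.2 ⟨fun h0 => hg.1 (congrArg Subtype.val h0), hg.2.2⟩,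
        Subtype.ext ?_⟩
      exact congrArg (· * g) (zpow_natCast u k).symm
  refine IsDiscreteValuationRing.ofHasUnitMulPowIrreducibleFactorization
    ⟨⟨u, hu.mem⟩, ⟨hnu, ?_⟩, ?_⟩
  · intro a b hab
    -- If neither factor were a unit, both would be divisible by `u`, and cancelling one `u` in `u =
    -- a * b` would make `u` a unit.
    by_contra! hcon
    have ha : ev a = 0 := by
      by_contra h0
      exact hcon.1 (hev.isUnit_iff.2 h0)
    have hb : ev b = 0 := by
      by_contra h0
      exact hcon.2 (hev.isUnit_iff.2 h0)
    have ha0 : a ≠ 0 := by rintro rfl; exact hu0 (by rw [hab, zero_mul])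
    have hb0 : b ≠ 0 := by rintro rfl; exact hu0 (by rw [hab, mul_zero])
    obtain ⟨m, g, hg, rfl⟩ := hfac a ha0
    obtain ⟨n, k, hk, rfl⟩ := hfac b hb0
    have hm : m ≠ 0 := by
      rintro rfl
      exact hev.isUnit_iff.1 hg (by simpa using ha)
    have hn : n ≠ 0 := by
      rintro rfl
      exact hev.isUnit_iff.1 hk (by simpa using hb)
    obtain ⟨m, rfl⟩ := Nat.exists_eq_succ_of_ne_zero hm
    obtain ⟨n, rfl⟩ := Nat.exists_eq_succ_of_ne_zero hn
    refine hnu (IsUnit.of_mul_eq_one (⟨u, hu.mem⟩ ^ (m + n) * g * k)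
      (mul_left_cancel₀ hu0 ?_))
    rw [mul_one]
    conv_rhs => rw [hab]
    simp only [Nat.succ_eq_add_one, pow_add, pow_one]
    ring
  · intro f hf
    obtain ⟨n, g, hg, h⟩ := hfac f hf
    obtain ⟨g, rfl⟩ := hg
    exact ⟨n, ⟨g, h⟩⟩

theorem isCurve_curveAt {u v : K} (h : Gen u v) (b : ℂ) {X : Set Pt}
    (hX : pointAt u v 0 b ∈ X) : IsCurve X (curveAt u v) := by
  refine ⟨isDiscreteValuationRing_curveAt h, fun f => ?_, _, hX, pointAt_le_curveAt h b, ?_⟩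
  · obtain ⟨ev, hev, hu, hv⟩ := exists_place_curveAt h
    rcases eq_or_ne f 0 with rfl | h0
    · exact Or.inl (zero_mem _)
    obtain ⟨n, g, hg, rfl⟩ := exists_eq_zpow_mul h h0
    rcases lt_or_ge n 0 with hn | hn
    · obtain ⟨k, rfl⟩ := Int.exists_eq_neg_ofNat hn.le
      refine Or.inr ?_
      rw [mul_inv, zpow_neg, inv_inv, zpow_natCast]
      exact mul_mem (hu.pow k).mem hg.2.2
    · obtain ⟨k, rfl⟩ := Int.eq_ofNat_of_zero_le hn
      rw [zpow_natCast]
      exact Or.inl (mul_mem (hu.pow k).mem hg.2.1)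
  · obtain ⟨ev, hev, hu, hv⟩ := exists_place_pointAt h 0 b
    obtain ⟨ev', hev', hu', hv'⟩ := exists_place_curveAt h
    have h₁ : Val ev (v - const b) 0 := (hv.sub (Val.const b)).congr rfl (by simp)
    -- The function `v - b` vanishes at the point but not on the curve, where `v` has a
    -- transcendental residue.
    refine ⟨⟨_, h₁.mem⟩, fun hun => hev.isUnit_iff.1 hun h₁.2, hev'.unitIn_iff.2
      ⟨_, fun h0 => ?_, hv'.sub (Val.const b)⟩⟩
    refine transcendental_ratVar ?_
    rw [_root_.sub_eq_zero.1 h0]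
    exact isAlgebraic_algebraMap b

/-- The residue field is `ℂ(t)`, generated by the residue of `v`: a function differs from a quotient
of polynomials in `v` by something of residue `0`. -/
theorem exists_residue_eq {u v : K} (h : Gen u v) : ∃ t ∈ curveAt u v, ∀ g ∈ curveAt u v,
    ∃ p q : Polynomial ℂ, UnitIn (curveAt u v) (Polynomial.aeval t q) ∧
      ¬ UnitIn (curveAt u v) (g - Polynomial.aeval t p / Polynomial.aeval t q) := by
  obtain ⟨ev, hev, hu, hv⟩ := exists_place_curveAt h
  have hval : ∀ p : Polynomial ℂ, Val ev (Polynomial.aeval v p)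
      (algebraMap (Polynomial ℂ) RatFun p) := by
    intro p
    obtain ⟨hm, hv⟩ := hv
    rw [← aeval_ratVar, ← hv, Polynomial.aeval_algHom_apply]
    have this : (Polynomial.aeval v p : K) =
        (Polynomial.aeval (⟨v, hm⟩ : curveAt u v) p : curveAt u v) :=
      Polynomial.aeval_algHom_apply (curveAt u v).val (⟨v, hm⟩ : curveAt u v) p
    rw [this]
    exact Val.of_mem (Subtype.property _)
  refine ⟨v, hv.mem, fun g hg => ?_⟩
  obtain ⟨p, q, hq, hpq⟩ := IsFractionRing.div_surjective (A := Polynomial ℂ) (ev ⟨g, hg⟩)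
  have hq' : algebraMap (Polynomial ℂ) RatFun q ≠ 0 :=
    IsFractionRing.to_map_ne_zero_of_mem_nonZeroDivisors hq
  refine ⟨p, q, hev.unitIn_iff.2 ⟨_, hq', hval q⟩, ?_⟩
  rw [hev.unitIn_iff]
  rintro ⟨l, hl, h⟩
  refine hl (h.unique ?_)
  refine ((Val.of_mem hg).sub ((hval p).div hev (hval q) hq')).congr rfl ?_
  rw [hpq, sub_self]

/-! ### Blowing up a point -/

/-- The points of the exceptional curve of the blow-up of `R`. -/
def exceptional (R : Pt) : Set Pt :=
  {S | ∃ u v : R, IsLocalCoord u v ∧ S = quadraticTransform R u v}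

/-- A place centred at a point of the plane extends the residue map of this point. -/
theorem Val.dominate {u v : K} {a b : ℂ} {ev : pointAt u v a b →ₐ[ℂ] ℂ}
    (hev : IsPlace ev) (hu : Val ev u a) (hv : Val ev v b) {T : Pt} {ev' : T →ₐ[ℂ] ℂ}
    (hev' : IsPlace ev') (hu' : Val ev' u a) (hv' : Val ev' v b) {f : K} {c : ℂ}
    (hf : Val ev f c) : Val ev' f c := by
  have hle : pointAt u v a b ≤ T := pointAt_le hev' hu' hv'
  obtain ⟨A, hA, B, hB, h⟩ := exists_eq_add_of_val hev hu hv
    ((hf.sub (Val.const c)).congr rfl (by simp))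
  have h₁ : Val ev' (f - Ince.const c) 0 := by
    rw [h]
    exact (((Val.of_mem (hle hA)).mul (hu'.sub (Val.const a))).add
      ((Val.of_mem (hle hB)).mul (hv'.sub (Val.const b)))).congr rfl (by simp)
  exact (h₁.add (Val.const c)).congr (by ring) (by simp)

/-! ### Quadratic transforms as points of affine planes -/

section Quadratic

variable {R : Pt} {ev : R →ₐ[ℂ] ℂ} {z w : R}

theorem mem_quadraticTransform {A B C D : R} (hA : IsUnit A) :
    (C + D * ((w : K) / z)) / (A + B * ((w : K) / z)) ∈ quadraticTransform R z w := by
  refine ⟨Polynomial.C C + Polynomial.C D * Polynomial.X,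
    Polynomial.C A + Polynomial.C B * Polynomial.X, ?_, ?_⟩
  · change IsUnit _
    simpa using hA
  · simp

/-- Since `w / z` has residue `0`, a polynomial in it has the residue of its constant coefficient,
so the admissible denominators are exactly those with nonzero residue. This gives one inclusion. For
the other one, the residue map restricts to a place of the quadratic transform, and `pointAt_le`
applies to `p, q`. -/
theorem quadraticTransform_eq (hev : IsPlace ev) {p q : K} {a b : ℂ}
    {ev' : pointAt p q a b →ₐ[ℂ] ℂ} (hev' : IsPlace ev') (hp : Val ev' p a) (hq : Val ev' q b)
    (hdom : ∀ f c, Val ev f c → Val ev' f c) (hw : Val ev' ((w : K) / z) 0)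
    (hp' : p ∈ quadraticTransform R z w) (hq' : q ∈ quadraticTransform R z w) :
    quadraticTransform R z w = pointAt p q a b := by
  have hmem : ∀ P : Polynomial R, Polynomial.aeval ((w : K) / z) P ∈ pointAt p q a b := by
    intro P
    rw [Polynomial.aeval_eq_sum_range]
    refine sum_mem fun i _ => ?_
    rw [Algebra.smul_def]
    exact mul_mem (hdom _ _ (Val.of_mem (P.coeff i).2)).mem (pow_mem hw.mem i)
  have hval : ∀ P : Polynomial R, Val ev' (Polynomial.aeval ((w : K) / z) P) (ev (P.coeff 0)) := by
    intro P
    have h := P.divX_mul_X_add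
    refine (((Val.of_mem (hmem P.divX)).mul hw).add
      (hdom _ _ (Val.of_mem (P.coeff 0).2))).congr ?_ (by simp)
    conv_rhs => rw [← h]
    simp
  have hle : quadraticTransform R z w ≤ pointAt p q a b :=
    fractions_le hmem fun P hP => ((hval P).inv hev' (hev.isUnit_iff.1 hP)).mem
  refine le_antisymm hle ?_
  let ev'' : quadraticTransform R z w →ₐ[ℂ] ℂ := ev'.comp (Subalgebra.inclusion hle)
  have hev'' : IsPlace ev'' := by
    rintro ⟨_, P, Q, hQ, rfl⟩ hf
    refine ⟨Q, P, ?_, inv_div _ _⟩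
    have h := ((hval P).div hev' (hval Q) (hev.isUnit_iff.1 hQ))
    refine hev.isUnit_iff.2 fun h0 => hf ?_
    rw [h0, zero_div] at h
    exact h.2
  exact pointAt_le hev'' ⟨hp', hp.2⟩ ⟨hq', hq.2⟩

end Quadratic

/-- With `V = v - e`, arbitrary local coordinates are `z = A u + B V` and `w = C u + D V` with
residues satisfying `a d - b c ≠ 0`. The quadratic transform depends only on the direction of `w =
0`: it is the point `V / u = -c / d` if `d ≠ 0`, and the point `u / V = 0` of the other chart if `d
= 0`. -/
theorem exceptional_pointAt {u v : K} (h : Gen u v) (e : ℂ) (S : Pt) :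
    S ∈ exceptional (pointAt u v 0 e) ↔
      S = pointAt (u / (v - const e)) (v - const e) 0 0 ∨
        ∃ c, S = pointAt u ((v - const e) / u) 0 c := by
  obtain ⟨ev, hev, hu, hv⟩ := exists_place_pointAt h 0 e
  have hu0 := h.ne_zero
  have hV0 := h.swap.sub_ne_zero e
  have hV : Val ev (v - const e) 0 := (hv.sub (Val.const e)).congr rfl (by simp)
  set V := v - const e with hVdef
  have hfin : ∀ c : ℂ, ∃ ev' : pointAt u (V / u) 0 c →ₐ[ℂ] ℂ, IsPlace ev' ∧ Val ev' u 0 ∧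
      Val ev' (V / u) c ∧ ∀ f c, Val ev f c → Val ev' f c := by
    intro c
    obtain ⟨ev', hev', hu', hw'⟩ := exists_place_pointAt (h.div e) 0 c
    have hv' : Val ev' v e := ((hu'.mul hw').add (Val.const e)).congr
      (by rw [mul_div_cancel₀ _ hu0]; ring) (by simp)
    exact ⟨ev', hev', hu', hw', fun f c hf => Val.dominate hev hu hv hev' hu' hv' hf⟩
  obtain ⟨evi, hevi, hzi, hVi⟩ := exists_place_pointAt (h.div' e) 0 0
  have hui : Val evi u 0 := (hzi.mul hVi).congr (div_mul_cancel₀ _ hV0) (by simp)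
  have hvi : Val evi v e := (hVi.add (Val.const e)).congr (by ring) (by simp)
  have hdomi : ∀ f c, Val ev f c → Val evi f c :=
      fun f c hf => Val.dominate hev hu hv hevi hui hvi hf
  constructor
  · rintro ⟨z, w, hzw, rfl⟩
    obtain ⟨hz, hw, hspan⟩ := (isLocalCoord_iff hev z w).1 hzw
    obtain ⟨A, hA, B, hB, hzeq⟩ := exists_eq_add_of_val hev hu hv (f := z) ⟨z.2, hz⟩
    obtain ⟨C, hC, D, hD, hweq⟩ := exists_eq_add_of_val hev hu hv (f := w) ⟨w.2, hw⟩
    obtain ⟨A', B', hueq⟩ := hspan ⟨u, hu.mem⟩ hu.2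
    obtain ⟨C', D', hVeq⟩ := hspan ⟨V, hV.mem⟩ hV.2
    replace hueq : u = A' * z + B' * w := congrArg Subtype.val hueq
    replace hVeq : V = C' * z + D' * w := congrArg Subtype.val hVeq
    have hc0 : const 0 = 0 := map_zero _
    rw [hc0, sub_zero, ← hVdef] at hzeq hweq
    have vA := Val.of_mem (ev := ev) hA
    have vB := Val.of_mem (ev := ev) hB
    have vC := Val.of_mem (ev := ev) hC
    have vD := Val.of_mem (ev := ev) hD
    have vA' := Val.of_mem (ev := ev) A'.2
    have vB' := Val.of_mem (ev := ev) B'.2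
    have vC' := Val.of_mem (ev := ev) C'.2
    have vD' := Val.of_mem (ev := ev) D'.2
    -- Independence of `u` and `V` to first order: dividing the relation by `u` and taking residues
    -- at the point `V / u = c` of the blow-up gives `a + b c = 0` for every `c`.
    have hind : ∀ (r s : K) (a b : ℂ), Val ev r a → Val ev s b → r * u + s * V = 0 →
        a = 0 ∧ b = 0 := by
      intro r s a b hr hs h0
      have hc : ∀ c : ℂ, a + b * c = 0 := by
        intro c
        obtain ⟨ev', hev', hu', hw', hdom⟩ := hfin c
        refine ((hdom _ _ hr).add ((hdom _ _ hs).mul hw')).unique (Val.zero.congr ?_ rfl)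
        field_simp
        linear_combination -h0
      have h1 := hc 0
      have h2 := hc 1
      simp at h1
      simp [h1] at h2
      exact ⟨h1, h2⟩
    set a := ev ⟨A, hA⟩
    set b := ev ⟨B, hB⟩
    set c := ev ⟨C, hC⟩
    set d := ev ⟨D, hD⟩
    set a' := ev ⟨A', A'.2⟩
    set b' := ev ⟨B', B'.2⟩
    set c' := ev ⟨C', C'.2⟩
    set d' := ev ⟨D', D'.2⟩
    obtain ⟨h₁, h₂⟩ := hind _ _ _ _ (((vA'.mul vA).add (vB'.mul vC)).sub Val.one)
      ((vA'.mul vB).add (vB'.mul vD)) (by rw [hzeq, hweq] at hueq; linear_combination -hueq)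
    obtain ⟨h₃, h₄⟩ := hind _ _ _ _ ((vC'.mul vA).add (vD'.mul vC))
      (((vC'.mul vB).add (vD'.mul vD)).sub Val.one)
      (by rw [hzeq, hweq] at hVeq; linear_combination -hVeq)
    -- The residue matrices of the two coordinate changes are inverse to each other.
    have hdet : a * d - b * c ≠ 0 := by
      intro h0
      have : (a' * d' - b' * c') * (a * d - b * c) = 1 := by
        linear_combination (c' * b + d' * d) * h₁ + h₄ - (c' * a + d' * c) * h₂
      rw [h0, mul_zero] at this
      exact zero_ne_one this
    have hz0 : (z : K) ≠ 0 := by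
      intro hz0
      obtain ⟨h5, h6⟩ := hind _ _ _ _ vA vB (by rw [← hzeq, hz0])
      exact hdet (by rw [h5, h6]; ring)
    have ha' : a' * (a * d - b * c) = d := by linear_combination d * h₁ - c * h₂
    have hc' : c' * (a * d - b * c) = -c := by linear_combination d * h₃ - c * h₄
    by_cases hd : d = 0
    · left
      have hb : b ≠ 0 := fun hb => hdet (by rw [hb, hd]; ring)
      have hc : c ≠ 0 := fun hc => hdet (by rw [hc, hd]; ring)
      have hc'0 : c' ≠ 0 := by
        rintro h0
        rw [h0, zero_mul, eq_comm, neg_eq_zero] at hc'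
        exact hc hc'
      refine quadraticTransform_eq hev hevi hzi hVi hdomi ?_ ?_ ?_
      · refine (((hdomi _ _ vC).mul hzi).add (hdomi _ _ vD)).div hevi
          (((hdomi _ _ vA).mul hzi).add (hdomi _ _ vB)) (by simpa using hb) |>.congr ?_ ?_
        · have hdz : u / (v - const e) * V = u := div_mul_cancel₀ _ hV0
          rw [hzeq, hweq, ← mul_div_mul_right _ _ hV0]
          congr 1
          · linear_combination C * hdz
          · linear_combination A * hdz
        · rw [hd]; simp
      · have := mem_quadraticTransform (z := z) (w := w) (A := C') (B := D') (C := A') (D := B')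
          (hev.isUnit_iff.2 hc'0)
        rw [← mul_div_mul_right _ _ hz0] at this
        convert this using 2
        · refine hueq.trans ?_
          rw [add_mul, mul_assoc, div_mul_cancel₀ _ hz0]
        · refine hVeq.trans ?_
          rw [add_mul, mul_assoc, div_mul_cancel₀ _ hz0]
      · have := mem_quadraticTransform (z := z) (w := w) (A := 1) (B := 0) (C := ⟨V, hV.mem⟩)
          (D := 0) isUnit_one
        simpa using this
    · right
      refine ⟨-c / d, ?_⟩
      obtain ⟨ev', hev', hu', hw', hdom⟩ := hfin (-c / d)
      have ha'0 : a' ≠ 0 := by rintro h0; rw [h0, zero_mul] at ha'; exact hd ha'.symm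
      refine quadraticTransform_eq hev hev' hu' hw' hdom ?_ ?_ ?_
      · refine (((hdom _ _ vC).add ((hdom _ _ vD).mul hw')).div hev'
          ((hdom _ _ vA).add ((hdom _ _ vB).mul hw')) ?_).congr ?_ ?_
        · intro h0
          apply hdet
          field_simp at h0
          linear_combination h0
        · rw [hzeq, hweq, ← mul_div_mul_right _ _ hu0]
          congr 1 <;> field_simp
        · field_simp
          simp
      · have := mem_quadraticTransform (z := z) (w := w) (A := 1) (B := 0) (C := ⟨u, hu.mem⟩)
          (D := 0) isUnit_one
        simpa using this
      · have := mem_quadraticTransform (z := z) (w := w) (A := A') (B := B') (C := C') (D := D')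
          (hev.isUnit_iff.2 ha'0)
        rw [← mul_div_mul_right _ _ hz0] at this
        convert this using 2
        · refine hVeq.trans ?_
          rw [add_mul, mul_assoc, div_mul_cancel₀ _ hz0]
        · refine hueq.trans ?_
          rw [add_mul, mul_assoc, div_mul_cancel₀ _ hz0]
  · have hcoord : IsLocalCoord (⟨u, hu.mem⟩ : pointAt u v 0 e) ⟨V, hV.mem⟩ :=
      isLocalCoord_pointAt h (by simp [const]) rfl
    rintro (rfl | ⟨c, rfl⟩)
    · refine ⟨⟨V, hV.mem⟩, ⟨u, hu.mem⟩, hcoord.swap, ?_⟩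
      refine (quadraticTransform_eq hev hevi hzi hVi hdomi hzi ?_ ?_).symm
      · have := mem_quadraticTransform (z := ⟨V, hV.mem⟩) (w := ⟨u, hu.mem⟩) (A := 1) (B := 0)
          (C := 0) (D := 1) isUnit_one
        simpa using this
      · have := mem_quadraticTransform (z := ⟨V, hV.mem⟩) (w := ⟨u, hu.mem⟩) (A := 1) (B := 0)
          (C := ⟨V, hV.mem⟩) (D := 0) isUnit_one
        simpa using this
    · obtain ⟨ev', hev', hu', hw', hdom⟩ := hfin c
      have hc : V - const c * u ∈ pointAt u v 0 e :=
        (hV.sub ((Val.const c).mul hu)).mem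
      have hdiv : (V - const c * u) / u = V / u - const c := by field_simp
      -- The line `V = c u` has the prescribed direction.
      refine ⟨⟨u, hu.mem⟩, ⟨V - const c * u, hc⟩, ?_, ?_⟩
      · obtain ⟨h₁, h₂, h₃⟩ := (isLocalCoord_iff hev _ _).1 hcoord
        refine (isLocalCoord_iff hev _ _).2 ⟨h₁, ?_, fun f hf => ?_⟩
        · exact ((hV.sub ((Val.const c).mul hu)).congr rfl (by simp) : Val ev _ 0).2
        · obtain ⟨A, B, rfl⟩ := h₃ f hf
          refine ⟨A + B * algebraMap ℂ _ c, B, Subtype.ext ?_⟩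
          change (A : K) * u + B * V = (A + B * const c) * u + B * (V - const c * u)
          ring
      · refine (quadraticTransform_eq hev hev' hu' hw' hdom ?_ ?_ ?_).symm
        · exact (hw'.sub (Val.const c)).congr hdiv.symm (by simp)
        · have := mem_quadraticTransform (z := ⟨u, hu.mem⟩) (w := ⟨V - const c * u, hc⟩) (A := 1)
            (B := 0) (C := ⟨u, hu.mem⟩) (D := 0) isUnit_one
          simpa using this
        · have := mem_quadraticTransform (z := ⟨u, hu.mem⟩) (w := ⟨V - const c * u, hc⟩) (A := 1)
            (B := 0) (C := algebraMap ℂ _ c) (D := 1) isUnit_one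
          have h2 : V / u = const c + (V - const c * u) / u := by rw [hdiv]; ring
          rw [h2]
          simpa [const] using this

/-- The hypotheses are needed only for the two rings themselves; quantifying over all places turns
them into mere computations of values. -/
theorem pointAt_eq {u v u' v' : K} (h : Gen u v) (h' : Gen u' v') {a b a' b' : ℂ}
    (h₁ : ∀ (T : Pt) (ev : T →ₐ[ℂ] ℂ), IsPlace ev → Val ev u a → Val ev v b →
      Val ev u' a' ∧ Val ev v' b')
    (h₂ : ∀ (T : Pt) (ev : T →ₐ[ℂ] ℂ), IsPlace ev → Val ev u' a' → Val ev v' b' →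
      Val ev u a ∧ Val ev v b) : pointAt u v a b = pointAt u' v' a' b' := by
  obtain ⟨ev, hev, hu, hv⟩ := exists_place_pointAt h a b
  obtain ⟨ev', hev', hu', hv'⟩ := exists_place_pointAt h' a' b'
  have h₃ := h₁ _ ev hev hu hv
  have h₄ := h₂ _ ev' hev' hu' hv'
  exact le_antisymm (pointAt_le hev' h₄.1 h₄.2) (pointAt_le hev h₃.1 h₃.2)

theorem ne_of_inv_mem {R R' : Pt} {L : Type} [Field L] [Algebra ℂ L] {ev : R →ₐ[ℂ] L} {f : K}
    (h : Val ev f 0) (hf : f ≠ 0) (h' : f⁻¹ ∈ R') : R ≠ R' := by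
  rintro rfl
  exact h.inv_notMem hf h'

theorem not_le_of_inv_mem {R V : Pt} {L : Type} [Field L] [Algebra ℂ L] {ev : V →ₐ[ℂ] L} {f : K}
    (h : Val ev f 0) (hf : f ≠ 0) (h' : f⁻¹ ∈ R) : ¬ R ≤ V :=
  fun hle => h.inv_notMem hf (hle h')

/-! ### The three branches -/

/-- Linear coordinates `X, Y` adapted to one of the three directions at infinity, in which the
Hamiltonian is `κ X² (Y - e₁) + X (l (Y² - e₁²) - κ e₂) + m Y³ + c Y² + e Y`. -/
structure Branch where
  X : K
  Y : K
  κ : ℂ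
  e₁ : ℂ
  e₂ : ℂ
  l : ℂ
  m : ℂ
  c : ℂ
  e : ℂ

namespace Branch

variable (g : Branch)

/-- The coordinate after two blow-ups. -/
def r : K := (g.Y - const g.e₁) * g.X

/-- The coordinate after three blow-ups. -/
def q : K := (g.r - const g.e₂) * g.X

/-- The first centre. -/
def C0 : Pt := pointAt (1 / g.X) (g.Y / g.X) 0 0

/-- The points of the first exceptional curve that are not on the line at infinity. -/
def F1 (c : ℂ) : Pt := pointAt (1 / g.X) g.Y 0 c

/-- The points of the second exceptional curve that are not on the first one. -/
def F2 (c : ℂ) : Pt := pointAt (1 / g.X) g.r 0 c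

/-- The points of the third exceptional curve that are not on the second one. -/
def F3 (c : ℂ) : Pt := pointAt (1 / g.X) g.q 0 c

/-- The intersection of the line at infinity and the first exceptional curve. -/
def N0 : Pt := pointAt (1 / g.Y) (g.Y / g.X) 0 0

/-- The intersection of the first and the second exceptional curve. -/
def N1 : Pt := pointAt (1 / g.X / (g.Y - const g.e₁)) (g.Y - const g.e₁) 0 0

/-- The intersection of the second and the third exceptional curve. -/
def N2 : Pt := pointAt (1 / g.X / (g.r - const g.e₂)) (g.r - const g.e₂) 0 0

/-- The line at infinity. -/
def D0 : Pt := curveAt (1 / g.X) (g.Y / g.X)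

/-- The first exceptional curve. -/
def D1 : Pt := curveAt (1 / g.X) g.Y

/-- The second exceptional curve. -/
def D2 : Pt := curveAt (1 / g.X) g.r

variable {g}

theorem X_ne (h : Gen g.X g.Y) : g.X ≠ 0 := h.ne_zero

theorem Y_ne (h : Gen g.X g.Y) : g.Y ≠ 0 := h.swap.ne_zero

theorem Y_sub_ne (h : Gen g.X g.Y) : g.Y - const g.e₁ ≠ 0 := h.swap.sub_ne_zero _

theorem gen_uw (h : Gen g.X g.Y) : Gen (1 / g.X) (g.Y / g.X) := by
  have hX := X_ne h
  have h₁ : 1 / g.X ∈ IntermediateField.adjoin ℂ {1 / g.X, g.Y / g.X} :=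
    IntermediateField.subset_adjoin ℂ _ (by simp)
  have h₂ : g.Y / g.X ∈ IntermediateField.adjoin ℂ {1 / g.X, g.Y / g.X} :=
    IntermediateField.subset_adjoin ℂ _ (by simp)
  refine h.of_mem ?_ ?_
  · simpa using inv_mem h₁
  · have := div_mem h₂ h₁
    rwa [show g.Y / g.X / (1 / g.X) = g.Y by field_simp] at this

theorem gen_uY (h : Gen g.X g.Y) : Gen (1 / g.X) g.Y := by
  have := (gen_uw h).div 0
  rwa [show (g.Y / g.X - const 0) / (1 / g.X) = g.Y by
    have := X_ne h; simp only [const, map_zero]; field_simp; ring] at this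

theorem r_eq : (g.Y - const g.e₁) / (1 / g.X) = g.r := by
  rw [div_div_eq_mul_div, div_one, r]

theorem q_eq : (g.r - const g.e₂) / (1 / g.X) = g.q := by
  rw [div_div_eq_mul_div, div_one, q]

theorem gen_ur (h : Gen g.X g.Y) : Gen (1 / g.X) g.r := by
  have := (gen_uY h).div g.e₁
  rwa [r_eq] at this

theorem r_sub_ne (h : Gen g.X g.Y) : g.r - const g.e₂ ≠ 0 := (gen_ur h).swap.sub_ne_zero _

theorem gen_uq (h : Gen g.X g.Y) : Gen (1 / g.X) g.q := by
  have := (gen_ur h).div g.e₂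
  rwa [q_eq] at this

theorem div_w (h : Gen g.X g.Y) : 1 / g.X / (g.Y / g.X - const 0) = 1 / g.Y := by
  have := X_ne h
  have := Y_ne h
  simp only [const, map_zero, sub_zero]
  field_simp

theorem gen_N0 (h : Gen g.X g.Y) : Gen (1 / g.Y) (g.Y / g.X) := by
  have := (gen_uw h).div' 0
  rwa [div_w h, const, map_zero, sub_zero] at this

theorem gen_N1 (h : Gen g.X g.Y) : Gen (1 / g.X / (g.Y - const g.e₁)) (g.Y - const g.e₁) :=
    (gen_uY h).div' _

theorem gen_N2 (h : Gen g.X g.Y) : Gen (1 / g.X / (g.r - const g.e₂)) (g.r - const g.e₂) :=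
    (gen_ur h).div' _

/-! #### The exceptional curves -/

theorem exceptional_C0 (h : Gen g.X g.Y) (S : Pt) :
    S ∈ exceptional g.C0 ↔ S = g.N0 ∨ ∃ c, S = g.F1 c := by
  have := X_ne h
  rw [C0, exceptional_pointAt (gen_uw h), div_w h,
    show (g.Y / g.X - const 0) / (1 / g.X) = g.Y by simp only [const, map_zero]; field_simp; ring,
    show g.Y / g.X - const 0 = g.Y / g.X by simp [const]]
  rfl

theorem exceptional_C1 (h : Gen g.X g.Y) (S : Pt) :
    S ∈ exceptional (g.F1 g.e₁) ↔ S = g.N1 ∨ ∃ c, S = g.F2 c := by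
  rw [F1, exceptional_pointAt (gen_uY h), r_eq]
  rfl

theorem exceptional_C2 (h : Gen g.X g.Y) (S : Pt) :
    S ∈ exceptional (g.F2 g.e₂) ↔ S = g.N2 ∨ ∃ c, S = g.F3 c := by
  rw [F2, exceptional_pointAt (gen_ur h), q_eq]
  rfl

/-! #### Residues -/

section Residues

variable {R : Pt} {L : Type} [Field L] [Algebra ℂ L] {ev : R →ₐ[ℂ] L}

theorem val_w (hu : Val ev (1 / g.X) 0) {l : L} (hY : Val ev g.Y l) : Val ev (g.Y / g.X) 0 :=
  (hY.mul hu).congr (by rw [mul_one_div]) (mul_zero _)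

theorem val_Y (h : Gen g.X g.Y) (hu : Val ev (1 / g.X) 0) {l : L} (hr : Val ev g.r l) :
    Val ev g.Y (algebraMap ℂ L g.e₁) :=
  ((hr.mul hu).add (Val.const g.e₁)).congr
    (by have := X_ne h; rw [r]; field_simp; ring) (by simp)

theorem val_r (h : Gen g.X g.Y) (hu : Val ev (1 / g.X) 0) {l : L} (hq : Val ev g.q l) :
    Val ev g.r (algebraMap ℂ L g.e₂) :=
  ((hq.mul hu).add (Val.const g.e₂)).congr
    (by have := X_ne h; rw [q]; field_simp; ring) (by simp)

end Residues

theorem place_C0 (h : Gen g.X g.Y) : ∃ ev : g.C0 →ₐ[ℂ] ℂ, IsPlace ev ∧ Val ev (1 / g.X) 0 ∧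
    Val ev (g.Y / g.X) 0 :=
  exists_place_pointAt (gen_uw h) 0 0

theorem place_F1 (h : Gen g.X g.Y) (c : ℂ) :
    ∃ ev : g.F1 c →ₐ[ℂ] ℂ, IsPlace ev ∧ Val ev (1 / g.X) 0 ∧
    Val ev (g.Y / g.X) 0 ∧ Val ev g.Y c := by
  obtain ⟨ev, hev, hu, hY⟩ := exists_place_pointAt (gen_uY h) 0 c
  exact ⟨ev, hev, hu, val_w hu hY, hY⟩

theorem place_F2 (h : Gen g.X g.Y) (c : ℂ) :
    ∃ ev : g.F2 c →ₐ[ℂ] ℂ, IsPlace ev ∧ Val ev (1 / g.X) 0 ∧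
    Val ev (g.Y / g.X) 0 ∧ Val ev g.Y g.e₁ ∧ Val ev g.r c := by
  obtain ⟨ev, hev, hu, hr⟩ := exists_place_pointAt (gen_ur h) 0 c
  have hY := val_Y h hu hr
  exact ⟨ev, hev, hu, val_w hu hY, hY, hr⟩

theorem place_F3 (h : Gen g.X g.Y) (c : ℂ) :
    ∃ ev : g.F3 c →ₐ[ℂ] ℂ, IsPlace ev ∧ Val ev (1 / g.X) 0 ∧
    Val ev (g.Y / g.X) 0 ∧ Val ev g.Y g.e₁ ∧ Val ev g.r g.e₂ ∧ Val ev g.q c := by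
  obtain ⟨ev, hev, hu, hq⟩ := exists_place_pointAt (gen_uq h) 0 c
  have hr := val_r h hu hq
  have hY := val_Y h hu hr
  exact ⟨ev, hev, hu, val_w hu hY, hY, hr, hq⟩

theorem place_N0 (h : Gen g.X g.Y) : ∃ ev : g.N0 →ₐ[ℂ] ℂ, IsPlace ev ∧ Val ev (1 / g.X) 0 ∧
    Val ev (g.Y / g.X) 0 ∧ Val ev (1 / g.Y) 0 := by
  obtain ⟨ev, hev, hp, hw⟩ := exists_place_pointAt (gen_N0 h) 0 0
  exact ⟨ev, hev, (hp.mul hw).congr (by have := Y_ne h; field_simp) (zero_mul _), hw, hp⟩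

theorem place_N1 (h : Gen g.X g.Y) : ∃ ev : g.N1 →ₐ[ℂ] ℂ, IsPlace ev ∧ Val ev (1 / g.X) 0 ∧
    Val ev (g.Y / g.X) 0 ∧ Val ev g.Y g.e₁ ∧ Val ev (1 / g.X / (g.Y - const g.e₁)) 0 ∧
    Val ev (g.Y - const g.e₁) 0 := by
  obtain ⟨ev, hev, hp, hq⟩ := exists_place_pointAt (gen_N1 h) 0 0
  have hu : Val ev (1 / g.X) 0 :=
    (hp.mul hq).congr (div_mul_cancel₀ _ (Y_sub_ne h)) (zero_mul _)
  have hY : Val ev g.Y g.e₁ := (hq.add (Val.const g.e₁)).congr (by ring) (by simp)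
  exact ⟨ev, hev, hu, val_w hu hY, hY, hp, hq⟩

theorem place_N2 (h : Gen g.X g.Y) : ∃ ev : g.N2 →ₐ[ℂ] ℂ, IsPlace ev ∧ Val ev (1 / g.X) 0 ∧
    Val ev (g.Y / g.X) 0 ∧ Val ev g.Y g.e₁ ∧ Val ev g.r g.e₂ ∧
    Val ev (1 / g.X / (g.r - const g.e₂)) 0 ∧ Val ev (g.r - const g.e₂) 0 := by
  obtain ⟨ev, hev, hp, hq⟩ := exists_place_pointAt (gen_N2 h) 0 0
  have hu : Val ev (1 / g.X) 0 :=
    (hp.mul hq).congr (div_mul_cancel₀ _ (r_sub_ne h)) (zero_mul _)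
  have hr : Val ev g.r g.e₂ := (hq.add (Val.const g.e₂)).congr (by ring) (by simp)
  have hY := val_Y h hu hr
  exact ⟨ev, hev, hu, val_w hu hY, hY, hr, hp, hq⟩

theorem place_D0 (h : Gen g.X g.Y) : ∃ ev : g.D0 →ₐ[ℂ] RatFun, IsPlace ev ∧ Val ev (1 / g.X) 0 ∧
    Val ev (g.Y / g.X) ratVar ∧ Val ev (1 / g.Y) 0 := by
  obtain ⟨ev, hev, hu, hw⟩ := exists_place_curveAt (gen_uw h)
  have h0 : ratVar ≠ 0 := fun h0 => transcendental_ratVar (h0 ▸ isAlgebraic_zero)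
  refine ⟨ev, hev, hu, hw, (hu.div hev hw h0).congr ?_ (zero_div _)⟩
  have := X_ne h
  field_simp

theorem place_D1 (h : Gen g.X g.Y) : ∃ ev : g.D1 →ₐ[ℂ] RatFun, IsPlace ev ∧ Val ev (1 / g.X) 0 ∧
    Val ev (g.Y / g.X) 0 ∧ Val ev g.Y ratVar ∧ Val ev (1 / g.X / (g.Y - const g.e₁)) 0 := by
  obtain ⟨ev, hev, hu, hY⟩ := exists_place_curveAt (gen_uY h)
  have h0 : ratVar - algebraMap ℂ RatFun g.e₁ ≠ 0 := fun h0 => transcendental_ratVar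
    (_root_.sub_eq_zero.1 h0 ▸ isAlgebraic_algebraMap _)
  exact ⟨ev, hev, hu, val_w hu hY, hY,
    (hu.div hev (hY.sub (Val.const g.e₁)) h0).congr rfl (zero_div _)⟩

theorem place_D2 (h : Gen g.X g.Y) : ∃ ev : g.D2 →ₐ[ℂ] RatFun, IsPlace ev ∧ Val ev (1 / g.X) 0 ∧
    Val ev (g.Y / g.X) 0 ∧ Val ev (g.Y - const g.e₁) 0 ∧ Val ev g.r ratVar ∧
    Val ev (1 / g.X / (g.r - const g.e₂)) 0 := by
  obtain ⟨ev, hev, hu, hr⟩ := exists_place_curveAt (gen_ur h)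
  have h0 : ratVar - algebraMap ℂ RatFun g.e₂ ≠ 0 := fun h0 => transcendental_ratVar
    (_root_.sub_eq_zero.1 h0 ▸ isAlgebraic_algebraMap _)
  have hY := val_Y h hu hr
  exact ⟨ev, hev, hu, val_w hu hY, (hY.sub (Val.const g.e₁)).congr rfl (sub_self _), hr,
    (hu.div hev (hr.sub (Val.const g.e₂)) h0).congr rfl (zero_div _)⟩

/-! #### Incidence of points and curves -/

theorem transcendental_inv : Transcendental ℂ (ratVar⁻¹) := fun h =>
  transcendental_ratVar (inv_inv ratVar ▸ h.inv)

theorem transcendental_sub (c : ℂ) : Transcendental ℂ (ratVar - algebraMap ℂ RatFun c) := fun h =>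
  transcendental_ratVar (by simpa using h.add (isAlgebraic_algebraMap c))

/-- Each component needs to be a coordinate axis in the chart of every crossing point on it; this
and the next four lemmas provide these descriptions. -/
theorem D0_eq_N0 (h : Gen g.X g.Y) : curveAt (1 / g.Y) (g.Y / g.X) = g.D0 := by
  obtain ⟨ev, hev, hu, hw, hp⟩ := place_D0 h
  exact curveAt_eq (gen_N0 h) hev hp hw transcendental_ratVar

theorem D1_eq_N0 (h : Gen g.X g.Y) : curveAt (g.Y / g.X) (1 / g.Y) = g.D1 := by
  obtain ⟨ev, hev, hu, hw, hY, -⟩ := place_D1 h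
  have h0 : ratVar ≠ 0 := fun h0 => transcendental_ratVar (h0 ▸ isAlgebraic_zero)
  exact curveAt_eq (gen_N0 h).swap hev hw ((hY.inv hev h0).congr (one_div _).symm rfl)
    transcendental_inv

theorem D1_eq_N1 (h : Gen g.X g.Y) : curveAt (1 / g.X / (g.Y - const g.e₁)) (g.Y - const g.e₁) =
    g.D1 := by
  obtain ⟨ev, hev, hu, hw, hY, hp⟩ := place_D1 h
  exact curveAt_eq (gen_N1 h) hev hp (hY.sub (Val.const _)) (transcendental_sub _)

theorem D2_eq_N1 (h : Gen g.X g.Y) : curveAt (g.Y - const g.e₁) (1 / g.X / (g.Y - const g.e₁)) =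
    g.D2 := by
  obtain ⟨ev, hev, hu, hw, hY, hr, hp⟩ := place_D2 h
  have h0 : ratVar ≠ 0 := fun h0 => transcendental_ratVar (h0 ▸ isAlgebraic_zero)
  have := X_ne h
  have := Y_sub_ne h
  exact curveAt_eq (gen_N1 h).swap hev hY
    ((hr.inv hev h0).congr (by rw [r, div_div, one_div, mul_comm]) rfl) transcendental_inv

theorem D2_eq_N2 (h : Gen g.X g.Y) : curveAt (1 / g.X / (g.r - const g.e₂)) (g.r - const g.e₂) =
    g.D2 := by
  obtain ⟨ev, hev, hu, hw, hY, hr, hp⟩ := place_D2 h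
  exact curveAt_eq (gen_N2 h) hev hp (hr.sub (Val.const _)) (transcendental_sub _)

/-- In this and the following criteria, a function vanishing on the curve has its inverse regular at
the point; here it is `1 / Y`. -/
theorem not_le_D0_of_Y (h : Gen g.X g.Y) {R : Pt} (hR : g.Y ∈ R) : ¬ R ≤ g.D0 := by
  obtain ⟨ev, hev, hu, hw, hp⟩ := place_D0 h
  exact not_le_of_inv_mem hp (one_div_ne_zero (Y_ne h)) (by simpa using hR)

theorem not_le_D1_of_r (h : Gen g.X g.Y) {R : Pt} (hR : g.r ∈ R) : ¬ R ≤ g.D1 := by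
  obtain ⟨ev, hev, hu, hw, hY, hp⟩ := place_D1 h
  refine not_le_of_inv_mem hp (div_ne_zero (one_div_ne_zero (X_ne h)) (Y_sub_ne h)) ?_
  rwa [inv_div, r_eq]

theorem not_le_D2_of_q (h : Gen g.X g.Y) {R : Pt} (hR : g.q ∈ R) : ¬ R ≤ g.D2 := by
  obtain ⟨ev, hev, hu, hw, hY, hr, hp⟩ := place_D2 h
  refine not_le_of_inv_mem hp (div_ne_zero (one_div_ne_zero (X_ne h)) (r_sub_ne h)) ?_
  rwa [inv_div, q_eq]

theorem not_le_D2_of_Y (h : Gen g.X g.Y) {R : Pt} (hR : (g.Y - const g.e₁)⁻¹ ∈ R) : ¬ R ≤ g.D2 := by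
  obtain ⟨ev, hev, hu, hw, hY, hr, hp⟩ := place_D2 h
  exact not_le_of_inv_mem hY (Y_sub_ne h) hR

theorem not_le_of_w (h : Gen g.X g.Y) {R : Pt} (hR : (g.Y / g.X)⁻¹ ∈ R) :
    ¬ R ≤ g.D1 ∧ ¬ R ≤ g.D2 := by
  have h0 := div_ne_zero (Y_ne h) (X_ne h)
  obtain ⟨ev, hev, hu, hw, -⟩ := place_D1 h
  obtain ⟨ev', hev', hu', hw', -⟩ := place_D2 h
  exact ⟨not_le_of_inv_mem hw h0 hR, not_le_of_inv_mem hw' h0 hR⟩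

theorem not_le_of_X (h : Gen g.X g.Y) {R : Pt} (hR : g.X ∈ R) :
    ¬ R ≤ g.D0 ∧ ¬ R ≤ g.D1 ∧ ¬ R ≤ g.D2 := by
  have h0 := one_div_ne_zero (X_ne h)
  have hR' : (1 / g.X)⁻¹ ∈ R := by simpa using hR
  obtain ⟨ev, hev, hu, -⟩ := place_D0 h
  obtain ⟨ev', hev', hu', -⟩ := place_D1 h
  obtain ⟨ev'', hev'', hu'', -⟩ := place_D2 h
  exact ⟨not_le_of_inv_mem hu h0 hR', not_le_of_inv_mem hu' h0 hR', not_le_of_inv_mem hu'' h0 hR'⟩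

/-! #### The points over the first centre -/

/-- The point `R` lies over the first centre of the branch. -/
def Over (g : Branch) (R : Pt) : Prop :=
  ∃ ev : R →ₐ[ℂ] ℂ, IsPlace ev ∧ Val ev (1 / g.X) 0 ∧ Val ev (g.Y / g.X) 0

/-- The points of the surface over the first centre of the branch. -/
def points (g : Branch) : Set Pt :=
  {S | S = g.N0 ∨ S = g.N1 ∨ S = g.N2 ∨ (∃ c, c ≠ g.e₁ ∧ S = g.F1 c) ∨
    (∃ c, c ≠ g.e₂ ∧ S = g.F2 c) ∨ ∃ c, S = g.F3 c}

theorem over_C0 (h : Gen g.X g.Y) : g.Over g.C0 := place_C0 h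

theorem over_F1 (h : Gen g.X g.Y) (c : ℂ) : g.Over (g.F1 c) := by
  obtain ⟨ev, hev, hu, hw, -⟩ := place_F1 h c
  exact ⟨ev, hev, hu, hw⟩

theorem over_F2 (h : Gen g.X g.Y) (c : ℂ) : g.Over (g.F2 c) := by
  obtain ⟨ev, hev, hu, hw, -⟩ := place_F2 h c
  exact ⟨ev, hev, hu, hw⟩

theorem over_of_mem_points (h : Gen g.X g.Y) {S : Pt} (hS : S ∈ g.points) : g.Over S := by
  rcases hS with rfl | rfl | rfl | ⟨c, -, rfl⟩ | ⟨c, -, rfl⟩ | ⟨c, rfl⟩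
  · obtain ⟨ev, hev, hu, hw, -⟩ := place_N0 h
    exact ⟨ev, hev, hu, hw⟩
  · obtain ⟨ev, hev, hu, hw, -⟩ := place_N1 h
    exact ⟨ev, hev, hu, hw⟩
  · obtain ⟨ev, hev, hu, hw, -⟩ := place_N2 h
    exact ⟨ev, hev, hu, hw⟩
  · exact over_F1 h c
  · exact over_F2 h c
  · obtain ⟨ev, hev, hu, hw, -⟩ := place_F3 h c
    exact ⟨ev, hev, hu, hw⟩

/-- The surface obtained from `Z` by blowing up the three centres of the branch. -/
def blowUp₃ (g : Branch) (Z : Set Pt) : Set Pt :=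
  blowUp (blowUp (blowUp Z g.C0) (g.F1 g.e₁)) (g.F2 g.e₂)

theorem mem_blowUp {Z : Set Pt} {R S : Pt} :
    S ∈ blowUp Z R ↔ (S ∈ Z ∧ S ≠ R) ∨ S ∈ exceptional R := Iff.rfl

theorem C1_mem (h : Gen g.X g.Y) (Z : Set Pt) : g.F1 g.e₁ ∈ blowUp Z g.C0 :=
  mem_blowUp.2 (Or.inr ((exceptional_C0 h _).2 (Or.inr ⟨_, rfl⟩)))

theorem C2_mem (h : Gen g.X g.Y) (Z : Set Pt) : g.F2 g.e₂ ∈ blowUp (blowUp Z g.C0) (g.F1 g.e₁) :=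
  mem_blowUp.2 (Or.inr ((exceptional_C1 h _).2 (Or.inr ⟨_, rfl⟩)))

theorem of_mem_blowUp₃ (h : Gen g.X g.Y) {Z : Set Pt} {S : Pt} (hS : S ∈ g.blowUp₃ Z) :
    (S ∈ Z ∧ S ≠ g.C0) ∨ S ∈ g.points := by
  rw [blowUp₃, mem_blowUp, mem_blowUp, mem_blowUp, exceptional_C0 h, exceptional_C1 h,
    exceptional_C2 h] at hS
  rcases hS with ⟨⟨hS | hS, h₁⟩ | hS, h₂⟩ | hS
  · exact Or.inl hS
  · rcases hS with rfl | ⟨c, rfl⟩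
    · exact Or.inr (Or.inl rfl)
    · exact Or.inr (Or.inr (Or.inr (Or.inr (Or.inl ⟨c, fun hc => h₁ (by rw [hc]), rfl⟩))))
  · rcases hS with rfl | ⟨c, rfl⟩
    · exact Or.inr (Or.inr (Or.inl rfl))
    · exact Or.inr (Or.inr (Or.inr (Or.inr (Or.inr (Or.inl
        ⟨c, fun hc => h₂ (by rw [hc]), rfl⟩)))))
  · rcases hS with rfl | ⟨c, rfl⟩
    · exact Or.inr (Or.inr (Or.inr (Or.inl rfl)))
    · exact Or.inr (Or.inr (Or.inr (Or.inr (Or.inr (Or.inr ⟨c, rfl⟩)))))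

/-- All three centres lie over the first one, so points elsewhere are untouched. -/
theorem mem_blowUp₃_of_not_over (h : Gen g.X g.Y) {Z : Set Pt} {S : Pt} (hS : S ∈ Z) (hg : ¬ g.Over
    S) :
    S ∈ g.blowUp₃ Z := by
  refine Or.inl ⟨Or.inl ⟨Or.inl ⟨hS, ?_⟩, ?_⟩, ?_⟩
  · rintro rfl; exact hg (over_C0 h)
  · rintro rfl; exact hg (over_F1 h _)
  · rintro rfl; exact hg (over_F2 h _)

theorem mem_blowUp₃_of_mem_points (h : Gen g.X g.Y) {Z : Set Pt} {S : Pt} (hS : S ∈ g.points) :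
    S ∈ g.blowUp₃ Z := by
  rw [blowUp₃, mem_blowUp, mem_blowUp, mem_blowUp, exceptional_C0 h, exceptional_C1 h,
    exceptional_C2 h]
  obtain ⟨ev₁, hev₁, hu₁, hw₁, hY₁⟩ := place_F1 h g.e₁
  obtain ⟨ev₂, hev₂, hu₂, hw₂, hY₂, hr₂⟩ := place_F2 h g.e₂
  -- The point `F1 c` lies on `D1`, whereas `F2 e₂` does not, because `r` is regular there.
  have hF : ∀ c, g.F1 c ≠ g.F2 g.e₂ := by
    intro c
    obtain ⟨ev, hev, hu, hw, hY, hp⟩ := place_D1 h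
    intro he
    refine not_le_D1_of_r h hr₂.mem ?_
    rw [← he]
    exact pointAt_le_of_transcendental hev hu hY transcendental_ratVar
  rcases hS with rfl | rfl | rfl | ⟨c, hc, rfl⟩ | ⟨c, hc, rfl⟩ | ⟨c, rfl⟩
  · obtain ⟨ev, hev, hu, hw, hp⟩ := place_N0 h
    have h0 := one_div_ne_zero (Y_ne h)
    refine Or.inl ⟨Or.inl ⟨Or.inr (Or.inl rfl), ?_⟩, ?_⟩
    · exact ne_of_inv_mem hp h0 (by simpa using hY₁.mem)
    · exact ne_of_inv_mem hp h0 (by simpa using hY₂.mem)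
  · obtain ⟨ev, hev, hu, hw, hY, hp, hq⟩ := place_N1 h
    refine Or.inl ⟨Or.inr (Or.inl rfl), ?_⟩
    refine ne_of_inv_mem hp (div_ne_zero (one_div_ne_zero (X_ne h)) (Y_sub_ne h)) ?_
    rw [inv_div, r_eq]
    exact hr₂.mem
  · exact Or.inr (Or.inl rfl)
  · obtain ⟨ev, hev, hu, hw, hY⟩ := place_F1 h c
    refine Or.inl ⟨Or.inl ⟨Or.inr (Or.inr ⟨c, rfl⟩), fun he => hc ?_⟩, hF c⟩
    exact eq_of_val hev₁ he hY hY₁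
  · obtain ⟨ev, hev, hu, hw, hY, hr⟩ := place_F2 h c
    refine Or.inl ⟨Or.inr (Or.inr ⟨c, rfl⟩), fun he => hc ?_⟩
    exact eq_of_val hev₂ he hr hr₂
  · exact Or.inr (Or.inr ⟨c, rfl⟩)

end Branch

/-! ### Calculus -/

/-- The factor is the Jacobian determinant; the squares vanish and the mixed products are opposite.
-/
theorem dWedge_eq {f g p q a b c d : K}
    (hf : KaehlerDifferential.D ℂ K f =
      a • KaehlerDifferential.D ℂ K p + b • KaehlerDifferential.D ℂ K q)
    (hg : KaehlerDifferential.D ℂ K g =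
      c • KaehlerDifferential.D ℂ K p + d • KaehlerDifferential.D ℂ K q) :
    dWedge f g = (a * d - b * c) • dWedge p q := by
  have h : ExteriorAlgebra.ι K (KaehlerDifferential.D ℂ K q) *
      ExteriorAlgebra.ι K (KaehlerDifferential.D ℂ K p) = - dWedge p q :=
    eq_neg_of_add_eq_zero_left (ExteriorAlgebra.ι_add_mul_swap _ _)
  rw [dWedge, hf, hg]
  simp only [map_add, map_smul, add_mul, mul_add, smul_mul_smul_comm, ExteriorAlgebra.ι_sq_zero, h]
  rw [← dWedge, smul_zero, smul_zero, zero_add, add_zero, smul_neg, neg_add_eq_sub, ← sub_smul]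

theorem D_const (c : ℂ) : KaehlerDifferential.D ℂ K (const c) = 0 :=
  (KaehlerDifferential.D ℂ K).map_algebraMap c

theorem derivation_const (v : Derivation ℂ K K) (c : ℂ) : v (const c) = 0 := v.map_algebraMap c

theorem derivation_one_div (v : Derivation ℂ K K) (f : K) : v (1 / f) = -(v f) / f ^ 2 := by
  rw [one_div, Derivation.leibniz_inv, smul_eq_mul, inv_pow, neg_mul, inv_mul_eq_div, ← neg_div]

theorem derivation_div (v : Derivation ℂ K K) (f g : K) :
    v (f / g) = (g * v f - f * v g) / g ^ 2 := by
  rw [Derivation.leibniz_div, smul_eq_mul, smul_eq_mul, smul_eq_mul, inv_pow, inv_mul_eq_div]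

theorem derivation_mul (v : Derivation ℂ K K) (f g : K) : v (f * g) = f * v g + g * v f := by
  rw [Derivation.leibniz, smul_eq_mul, smul_eq_mul]

theorem dWedge_one_div (f g : K) : dWedge (1 / f) g = (-(1 / f) ^ 2) • dWedge f g := by
  rw [dWedge_eq (p := f) (q := g) (a := -(1 / f) ^ 2) (b := 0) (c := 0) (d := 1)]
  · simp
  · rw [one_div, Derivation.leibniz_inv]; simp
  · simp

/-- Passing to the chart of a blow-up divides the 2-form of the coordinates by `f`; along a branch
this is the drop of the pole order by one. -/
theorem dWedge_div (f g : K) (c : ℂ) :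
    dWedge f ((g - const c) / f) = (1 / f) • dWedge f g := by
  rcases eq_or_ne f 0 with rfl | hf
  · simp [dWedge]
  rw [dWedge_eq (p := f) (q := g) (a := 1) (b := 0) (c := -(g - const c) / f ^ 2) (d := 1 / f)]
  · simp
  · simp
  · rw [Derivation.leibniz_div, map_sub, D_const, sub_zero, smul_sub, smul_smul, smul_smul,
      sub_eq_neg_add, ← neg_smul]
    congr 2 <;> field_simp

theorem dWedge_div' (f g : K) (c : ℂ) (h : g - const c ≠ 0) :
    dWedge (f / (g - const c)) (g - const c) = (1 / (g - const c)) • dWedge f g := by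
  rw [dWedge_eq (p := f) (q := g) (a := 1 / (g - const c)) (b := -f / (g - const c) ^ 2)
    (c := 0) (d := 1)]
  · simp
  · rw [Derivation.leibniz_div, map_sub, D_const, sub_zero, smul_sub, smul_smul, smul_smul,
      sub_eq_add_neg, ← neg_smul]
    congr 2 <;> field_simp
  · simp [D_const]

theorem dWedge_swap (f g : K) : dWedge g f = -dWedge f g :=
  eq_neg_of_add_eq_zero_left (ExteriorAlgebra.ι_add_mul_swap _ _)

theorem dWedge_sub_const (f g : K) (a b : ℂ) :
    dWedge (f - const a) (g - const b) = dWedge f g := by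
  simp [dWedge, D_const]

/-- A derivation is regular at a point if it maps local coordinates to regular functions. -/
theorem derivation_mem {p q : K} (h : Gen p q) {a b : ℂ} (v : Derivation ℂ K K)
    (hp : v p ∈ pointAt p q a b) (hq : v q ∈ pointAt p q a b) {f : K}
    (hf : f ∈ pointAt p q a b) : v f ∈ pointAt p q a b := by
  obtain ⟨ev, hev, hp', hq'⟩ := exists_place_pointAt h a b
  have hpol : ∀ P : MvPolynomial (Fin 2) ℂ,
      v (MvPolynomial.aeval ![p, q] P) ∈ pointAt p q a b := by
    intro P
    induction P using MvPolynomial.induction_on with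
    | C c =>
      rw [MvPolynomial.aeval_C, Derivation.map_algebraMap]
      exact zero_mem _
    | add P Q hP hQ =>
      rw [map_add, map_add]
      exact add_mem hP hQ
    | mul_X P i hP =>
      rw [map_mul, MvPolynomial.aeval_X, derivation_mul]
      fin_cases i
      · exact add_mem (mul_mem (hp'.aeval hq' P).mem hp) (mul_mem hp'.mem hP)
      · exact add_mem (mul_mem (hp'.aeval hq' P).mem hq) (mul_mem hq'.mem hP)
  obtain ⟨P, Q, hQ, rfl⟩ := hf
  have hQ' : MvPolynomial.aeval ![a, b] Q ≠ 0 := by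
    rw [Submonoid.mem_comap, mem_nonZeroDivisors_iff_ne_zero] at hQ
    exact hQ
  have hi := ((hp'.aeval hq' Q).inv hev hQ').mem
  change v (MvPolynomial.aeval ![p, q] P / MvPolynomial.aeval ![p, q] Q) ∈ _
  rw [derivation_div, div_eq_mul_inv, ← inv_pow]
  exact mul_mem (sub_mem (mul_mem (hp'.aeval hq' Q).mem (hpol P))
    (mul_mem (hp'.aeval hq' P).mem (hpol Q))) (pow_mem hi 2)

/-! ### The local form of the form, the vector field and the divisor at a point -/

/-- The local properties of the surface, of the 2-form `ω` and of the vector field `v` at the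
point `R`. -/
structure LocalForm {ι : Type} [Fintype ι] (D : ι → Pt) (m : ι → ℕ)
    (ω : ExteriorAlgebra K (Ω[K⁄ℂ])) (v : Derivation ℂ K K) (R : Pt) : Prop where
  polar : ∃ (z w : R) (f : ι → R) (ε : R), IsLocalCoord z w ∧
    (∀ i, IsLocalEquation R (D i) (f i)) ∧ IsUnit ε ∧
    ((∏ i, f i ^ m i : R) : K) • ω = (ε : K) • dWedge z w
  logPole : ∃ f : ι → R, (∀ i, IsLocalEquation R (D i) (f i)) ∧
    (∀ g : R, ∃ h : R, ((∏ i, f i : R) : K) * v g = h) ∧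
    ∀ i, ∃ h : R, ((∏ i, f i : R) : K) * v (f i) = f i * h
  not_accessible : ¬ IsAccessible D v R
  regular_iff : (∀ g ∈ R, v g ∈ R) ↔ ∀ i, ¬ R ≤ D i
  smooth : ∀ i, R ≤ D i → ∃ f z : R, IsLocalEquation R (D i) f ∧ IsLocalCoord f z

section LocalForm

variable {ι : Type} [Fintype ι] {D : ι → Pt} {m : ι → ℕ}
  {ω : ExteriorAlgebra K (Ω[K⁄ℂ])} {v : Derivation ℂ K K} {p q : K} {a b ε : ℂ}

theorem exists_polar (h : Gen p q) {f : ι → pointAt p q a b}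
    (hf : ∀ i, IsLocalEquation (pointAt p q a b) (D i) (f i)) (hε : ε ≠ 0)
    (hω : ((∏ i, f i ^ m i : pointAt p q a b) : K) • ω = const ε • dWedge p q) :
    ∃ (z w : pointAt p q a b) (f : ι → pointAt p q a b) (ε : pointAt p q a b), IsLocalCoord z w ∧
      (∀ i, IsLocalEquation (pointAt p q a b) (D i) (f i)) ∧ IsUnit ε ∧
      ((∏ i, f i ^ m i : pointAt p q a b) : K) • ω = (ε : K) • dWedge z w := by
  obtain ⟨ev, hev, hp, hq⟩ := exists_place_pointAt h a b
  refine ⟨⟨_, (hp.sub (Val.const a)).mem⟩, ⟨_, (hq.sub (Val.const b)).mem⟩, f,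
    algebraMap ℂ _ ε, isLocalCoord_pointAt h rfl rfl, hf, ?_, ?_⟩
  · exact (IsUnit.mk0 ε hε).map _
  · rw [hω, dWedge_sub_const]
    rfl

theorem localForm_off (h : Gen p q) (hD : ∀ i, ¬ pointAt p q a b ≤ D i) (hε : ε ≠ 0)
    (hω : ω = const ε • dWedge p q) (hp : v p ∈ pointAt p q a b) (hq : v q ∈ pointAt p q a b) :
    LocalForm D m ω v (pointAt p q a b) where
  polar := exists_polar (f := fun _ => 1) h
    (fun i => isLocalEquation_of_not_le (hD i) isUnit_one) hε (by simpa using hω)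
  logPole := by
    refine ⟨fun _ => 1, fun i => isLocalEquation_of_not_le (hD i) isUnit_one, fun g => ?_,
      fun i => ⟨0, ?_⟩⟩
    · exact ⟨⟨v g, derivation_mem h v hp hq g.2⟩, by simp⟩
    · simp
  not_accessible := fun ⟨⟨i, hi, _⟩, _⟩ => hD i hi
  regular_iff := ⟨fun _ => hD, fun _ _ => derivation_mem h v hp hq⟩
  smooth i hi := absurd hi (hD i)

/-- Here `p` is a local equation of `D`. The nonzero residue `l` of `p * v q` serves twice: tested
on the coordinate `q`, it contradicts both an accessible singularity and the regularity of `v`. -/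
theorem localForm_smooth [DecidableEq ι] (h : Gen p q) {i : ι} (hi : D i = curveAt p q)
    (hD : ∀ k, k ≠ i → ¬ pointAt p q 0 b ≤ D k) (hε : ε ≠ 0)
    (hω : (p ^ m i) • ω = const ε • dWedge p q) (hp : v p ∈ pointAt p q 0 b)
    {ev : pointAt p q 0 b →ₐ[ℂ] ℂ} (hev : IsPlace ev) (hp' : Val ev p 0) (hq' : Val ev q b)
    {l : ℂ} (hl : l ≠ 0) (hq : Val ev (p * v q) l) : LocalForm D m ω v (pointAt p q 0 b) := by
  let P : pointAt p q 0 b := ⟨p, hp'.mem⟩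
  let f : ι → pointAt p q 0 b := fun k => if k = i then P else 1
  have hPi : IsLocalEquation (pointAt p q 0 b) (D i) P := by
    rw [hi]
    exact isLocalEquation_curveAt h b rfl
  have hf : ∀ k, IsLocalEquation (pointAt p q 0 b) (D k) (f k) := by
    intro k
    by_cases hk : k = i
    · simp only [f, if_pos hk]
      rwa [hk]
    · simp only [f, if_neg hk]
      exact isLocalEquation_of_not_le (hD k hk) isUnit_one
  have hprod : ∏ k, f k = P := by simp [f]
  have hle : pointAt p q 0 b ≤ D i := by
    rw [hi]
    exact pointAt_le_curveAt h b
  have hmem : ∀ g ∈ pointAt p q 0 b, p * v g ∈ pointAt p q 0 b := fun g hg =>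
    derivation_mem h (p • v) (mul_mem hp'.mem hp) hq.mem hg
  have hcoord : IsLocalCoord P ⟨_, (hq'.sub (Val.const b)).mem⟩ :=
    isLocalCoord_pointAt h (by simp [P, const]) rfl
  refine ⟨exists_polar h hf hε ?_, ⟨f, hf, ?_, ?_⟩, ?_, ?_, ?_⟩
  · simpa [f, ite_pow] using hω
  · rw [hprod]
    exact fun g => ⟨⟨_, hmem g g.2⟩, rfl⟩
  · rw [hprod]
    intro k
    by_cases hk : k = i
    · simp only [f, if_pos hk]
      exact ⟨⟨_, hp⟩, rfl⟩
    · simp only [f, if_neg hk]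
      exact ⟨0, by simp⟩
  · rintro ⟨-, hacc⟩
    obtain ⟨k, hk, hk'⟩ := hacc f hf ⟨q, hq'.mem⟩
    rw [hprod] at hk'
    refine hk (hev.isUnit_iff.2 ?_)
    have := hq.unique ((Val.of_mem k.2).congr hk'.symm rfl)
    exact fun h0 => hl (this.trans h0)
  · refine ⟨fun hreg => ?_, fun hno => absurd hle (hno i)⟩
    exfalso
    exact hl (hq.unique ((hp'.mul (Val.of_mem (hreg q hq'.mem))).congr rfl (zero_mul _)))
  · intro k hk
    by_cases hki : k = i
    · subst hki
      exact ⟨P, _, hPi, hcoord⟩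
    · exact absurd hk (hD k hki)

/-- Here `p * q` is a local equation of `D`; the pole shows in `p * v q`, while regularity of `q * v
p` and `p * v q` gives tangency to both components. -/
theorem localForm_cross [DecidableEq ι] (h : Gen p q) {i j : ι} (hij : i ≠ j)
    (hi : D i = curveAt p q) (hj : D j = curveAt q p)
    (hD : ∀ k, k ≠ i → k ≠ j → ¬ pointAt p q 0 0 ≤ D k) (hε : ε ≠ 0)
    (hω : (p ^ m i * q ^ m j) • ω = const ε • dWedge p q) (hp : q * v p ∈ pointAt p q 0 0)
    {ev : pointAt p q 0 0 →ₐ[ℂ] ℂ} (hp' : Val ev p 0) (hq' : Val ev q 0)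
    {l : ℂ} (hl : l ≠ 0) (hq : Val ev (p * v q) l) : LocalForm D m ω v (pointAt p q 0 0) := by
  let P : pointAt p q 0 0 := ⟨p, hp'.mem⟩
  let Q : pointAt p q 0 0 := ⟨q, hq'.mem⟩
  let f : ι → pointAt p q 0 0 := fun k => (if k = i then P else 1) * (if k = j then Q else 1)
  have hswap : pointAt p q 0 0 = pointAt q p 0 0 :=
    pointAt_eq h h.swap (fun _ _ _ h₁ h₂ => ⟨h₂, h₁⟩) (fun _ _ _ h₁ h₂ => ⟨h₂, h₁⟩)
  have hPi : IsLocalEquation (pointAt p q 0 0) (D i) P := by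
    rw [hi]
    exact isLocalEquation_curveAt h 0 rfl
  have hQj : IsLocalEquation (pointAt p q 0 0) (D j) Q := by
    rw [hj]
    -- The element `Q` belongs to a ring that is equal to `pointAt q p 0 0` but not syntactically
    -- so; generalizing the ring allows the transport.
    have : ∀ (R : Pt) (f : R), R = pointAt q p 0 0 → (f : K) = q →
        IsLocalEquation R (curveAt q p) f := by
      rintro R f rfl hf
      exact isLocalEquation_curveAt h.swap 0 hf
    exact this _ _ hswap rfl
  have hf : ∀ k, IsLocalEquation (pointAt p q 0 0) (D k) (f k) := by
    intro k
    by_cases hk : k = i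
    · subst hk
      simpa [f, hij] using hPi
    · by_cases hk' : k = j
      · subst hk'
        simpa [f, hij.symm] using hQj
      · simpa [f, hk, hk'] using isLocalEquation_of_not_le (hD k hk hk') isUnit_one
  have hprod : ∏ k, f k = P * Q := by
    simp only [f, Finset.prod_mul_distrib, Finset.prod_ite_eq', Finset.mem_univ, if_true]
  have hcoe : ((P * Q : pointAt p q 0 0) : K) = p * q := rfl
  have hle : pointAt p q 0 0 ≤ D i := by
    rw [hi]
    exact pointAt_le_curveAt h 0
  have hle' : pointAt p q 0 0 ≤ D j := by
    rw [hj, hswap]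
    exact pointAt_le_curveAt h.swap 0
  have hp₂ : p * q * v p ∈ pointAt p q 0 0 := by
    rw [mul_assoc]
    exact mul_mem hp'.mem hp
  have hq₂ : p * q * v q ∈ pointAt p q 0 0 := by
    rw [mul_comm p q, mul_assoc]
    exact mul_mem hq'.mem hq.mem
  have hmem : ∀ g ∈ pointAt p q 0 0, p * q * v g ∈ pointAt p q 0 0 := fun g hg =>
    derivation_mem h ((p * q) • v) hp₂ hq₂ hg
  have hcoord : IsLocalCoord P Q := isLocalCoord_pointAt h (by simp [P, const])
    (by simp [Q, const])
  refine ⟨exists_polar h hf hε ?_, ⟨f, hf, ?_, ?_⟩, ?_, ?_, ?_⟩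
  · simp only [f, mul_pow, ite_pow, one_pow, Finset.prod_mul_distrib, Finset.prod_ite_eq',
      Finset.mem_univ, if_true]
    exact hω
  · rw [hprod, hcoe]
    exact fun g => ⟨⟨_, hmem g g.2⟩, rfl⟩
  · rw [hprod, hcoe]
    intro k
    by_cases hk : k = i
    · subst hk
      refine ⟨⟨_, hp⟩, ?_⟩
      simp [f, hij, P]
      ring
    · by_cases hk' : k = j
      · subst hk'
        refine ⟨⟨_, hq.mem⟩, ?_⟩
        simp [f, hij.symm, Q]
        ring
      · exact ⟨0, by simp [f, hk, hk']⟩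
  · rintro ⟨⟨k, -, hk⟩, -⟩
    exact hij ((hk i hle).trans (hk j hle').symm)
  · refine ⟨fun hreg => ?_, fun hno => absurd hle (hno i)⟩
    exact absurd (hq.unique ((hp'.mul (Val.of_mem (hreg q hq'.mem))).congr rfl (zero_mul _))) hl
  · intro k hk
    by_cases hki : k = i
    · subst hki
      exact ⟨P, _, hPi, hcoord⟩
    · by_cases hkj : k = j
      · subst hkj
        exact ⟨Q, _, hQj, hcoord.swap⟩
      · exact absurd hk (hD k hki hkj)

end LocalForm

/-! ### The vector field in the coordinates of a branch -/

section Identities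

variable {F : Type} [Field F] {X Y κ e₁ e₂ l m c e A B : F}

/-- Throughout, `A` and `B` stand for `∂H/∂Y` and `-∂H/∂X` of the branch Hamiltonian. The right-hand
sides are written in functions regular at the point in question, so that residues can be taken term
by term. -/
theorem field_u (hX : X ≠ 0)
    (hA : A = κ * X ^ 2 + 2 * l * X * Y + 3 * m * Y ^ 2 + 2 * c * Y + e) :
    -A / X ^ 2 = -(κ + 1 / X * (2 * l * Y + 1 / X * (3 * m * Y ^ 2 + 2 * c * Y + e))) := by
  subst hA
  field_simp
  ring

theorem field_Y (hX : X ≠ 0)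
    (hB : B = -(2 * κ * X * (Y - e₁) + l * (Y ^ 2 - e₁ ^ 2) - κ * e₂)) :
    1 / X * B = -(2 * κ * (Y - e₁) + 1 / X * (l * (Y ^ 2 - e₁ ^ 2) - κ * e₂)) := by
  subst hB
  field_simp
  ring

theorem field_N0 (hX : X ≠ 0) (hY : Y ≠ 0)
    (hA : A = κ * X ^ 2 + 2 * l * X * Y + 3 * m * Y ^ 2 + 2 * c * Y + e)
    (hB : B = -(2 * κ * X * (Y - e₁) + l * (Y ^ 2 - e₁ ^ 2) - κ * e₂)) :
    1 / Y * ((X * B - Y * A) / X ^ 2) =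
      -(2 * κ * (1 - e₁ * (1 / Y)) + l * (Y / X) - (l * e₁ ^ 2 + κ * e₂) * (1 / Y) ^ 2 * (Y / X)) -
        (κ + 2 * l * (Y / X) + 3 * m * (Y / X) ^ 2 + 2 * c * (Y / X) * (1 / X) +
          e * (1 / X) ^ 2) := by
  subst hA hB
  field_simp
  ring

theorem field_N0' (hX : X ≠ 0) (hY : Y ≠ 0)
    (hB : B = -(2 * κ * X * (Y - e₁) + l * (Y ^ 2 - e₁ ^ 2) - κ * e₂)) :
    Y / X * (-B / Y ^ 2) =
      2 * κ * (1 - e₁ * (1 / Y)) + l * (Y / X) - (l * e₁ ^ 2 + κ * e₂) * (1 / Y) ^ 2 * (Y / X) := by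
  subst hB
  field_simp
  ring

theorem field_N1 (hX : X ≠ 0) (hY : Y - e₁ ≠ 0)
    (hB : B = -(2 * κ * X * (Y - e₁) + l * (Y ^ 2 - e₁ ^ 2) - κ * e₂)) :
    1 / X / (Y - e₁) * B =
      -(2 * κ + 1 / X / (Y - e₁) * (l * (Y ^ 2 - e₁ ^ 2) - κ * e₂)) := by
  subst hB
  field_simp
  ring

theorem field_N1' (hX : X ≠ 0) (hY : Y - e₁ ≠ 0)
    (hA : A = κ * X ^ 2 + 2 * l * X * Y + 3 * m * Y ^ 2 + 2 * c * Y + e)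
    (hB : B = -(2 * κ * X * (Y - e₁) + l * (Y ^ 2 - e₁ ^ 2) - κ * e₂)) :
    (Y - e₁) * (((Y - e₁) * (-A / X ^ 2) - 1 / X * B) / (Y - e₁) ^ 2) =
      κ - 1 / X * (2 * l * Y + 1 / X * (3 * m * Y ^ 2 + 2 * c * Y + e)) + l * (1 / X) * (Y + e₁) -
        κ * e₂ * (1 / X / (Y - e₁)) := by
  subst hA hB
  field_simp
  ring

/-- The leading terms of the derivative of `r` combine to `-κ X r`, and the term `κ e₂ X` completes
them to `-κ X (r - e₂)`: this is why the third centre is `r = e₂`. The terms with `l` and `X`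
collapse to `l r² / X`. -/
theorem field_r (hX : X ≠ 0)
    (hA : A = κ * X ^ 2 + 2 * l * X * Y + 3 * m * Y ^ 2 + 2 * c * Y + e)
    (hB : B = -(2 * κ * X * (Y - e₁) + l * (Y ^ 2 - e₁ ^ 2) - κ * e₂))
    {r : F} (hr : r = (Y - e₁) * X) :
    1 / X * ((Y - e₁) * A + X * B) =
      -κ * (r - e₂) + 1 / X * (1 / X * (l * r ^ 2 + r * (3 * m * Y ^ 2 + 2 * c * Y + e))) := by
  subst hA hB hr
  field_simp
  ring

theorem field_N2 (hX : X ≠ 0)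
    (hA : A = κ * X ^ 2 + 2 * l * X * Y + 3 * m * Y ^ 2 + 2 * c * Y + e)
    (hB : B = -(2 * κ * X * (Y - e₁) + l * (Y ^ 2 - e₁ ^ 2) - κ * e₂))
    {r : F} (hr : r = (Y - e₁) * X) (h0 : r - e₂ ≠ 0) :
    1 / X / (r - e₂) * ((Y - e₁) * A + X * B) =
      -κ + 1 / X / (r - e₂) * (1 / X * (l * r ^ 2 + r * (3 * m * Y ^ 2 + 2 * c * Y + e))) := by
  have h := field_r hX hA hB hr
  rw [div_mul_eq_mul_div, h, add_div, mul_div_assoc (-κ), div_self h0]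
  ring

theorem field_N2' (hX : X ≠ 0)
    (hA : A = κ * X ^ 2 + 2 * l * X * Y + 3 * m * Y ^ 2 + 2 * c * Y + e)
    (hB : B = -(2 * κ * X * (Y - e₁) + l * (Y ^ 2 - e₁ ^ 2) - κ * e₂))
    {r : F} (hr : r = (Y - e₁) * X) (h0 : r - e₂ ≠ 0) :
    ((r - e₂) * (-A / X ^ 2) - 1 / X * ((Y - e₁) * A + X * B)) / (r - e₂) ^ 2 =
      -(1 / X / (r - e₂) * (2 * l * Y + 1 / X * (3 * m * Y ^ 2 + 2 * c * Y + e))) -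
        (1 / X / (r - e₂)) ^ 2 * (l * r ^ 2 + r * (3 * m * Y ^ 2 + 2 * c * Y + e)) := by
  rw [field_r hX hA hB hr, field_u hX hA, div_eq_iff (pow_ne_zero 2 h0)]
  generalize 3 * m * Y ^ 2 + 2 * c * Y + e = G
  field_simp
  ring

/-- The polar terms `κ X² (r - e₂)` and `-κ X² (r - e₂)` cancel, so the field is regular along the
third exceptional curve. -/
theorem field_q (hX : X ≠ 0)
    (hA : A = κ * X ^ 2 + 2 * l * X * Y + 3 * m * Y ^ 2 + 2 * c * Y + e)
    (hB : B = -(2 * κ * X * (Y - e₁) + l * (Y ^ 2 - e₁ ^ 2) - κ * e₂))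
    {r q : F} (hr : r = (Y - e₁) * X) (hq : q = (r - e₂) * X) :
    (r - e₂) * A + X * ((Y - e₁) * A + X * B) =
      l * r ^ 2 + r * (3 * m * Y ^ 2 + 2 * c * Y + e) +
        q * (2 * l * Y + 1 / X * (3 * m * Y ^ 2 + 2 * c * Y + e)) := by
  subst hA hB hr hq
  field_simp
  ring

end Identities

theorem Val.two {R : Pt} {L : Type} [Field L] [Algebra ℂ L] {ev : R →ₐ[ℂ] L} : Val ev 2 2 :=
  Val.ofNat 2

theorem Val.three {R : Pt} {L : Type} [Field L] [Algebra ℂ L] {ev : R →ₐ[ℂ] L} : Val ev 3 3 :=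
  Val.ofNat 3

namespace Branch

/-- The 2-form `ω` and the vector field `v` have the standard shape in the coordinates of the
branch. -/
structure Adapted (g : Branch) (ω : ExteriorAlgebra K (Ω[K⁄ℂ])) (v : Derivation ℂ K K) :
    Prop where
  gen : Gen g.X g.Y
  κ_ne : g.κ ≠ 0
  wedge : dWedge g.X g.Y = ω
  field_X : v g.X = const g.κ * g.X ^ 2 + 2 * const g.l * g.X * g.Y + 3 * const g.m * g.Y ^ 2 +
    2 * const g.c * g.Y + const g.e
  field_Y : v g.Y = -(2 * const g.κ * g.X * (g.Y - const g.e₁) +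
    const g.l * (g.Y ^ 2 - const g.e₁ ^ 2) - const g.κ * const g.e₂)

variable {g : Branch} {ω : ExteriorAlgebra K (Ω[K⁄ℂ])} {v : Derivation ℂ K K}

theorem wedge_uY (hg : g.Adapted ω v) : dWedge (1 / g.X) g.Y = (-(1 / g.X) ^ 2) • ω := by
  rw [dWedge_one_div, hg.wedge]

theorem wedge_uw (hg : g.Adapted ω v) :
    dWedge (1 / g.X) (g.Y / g.X) = (-(1 / g.X) ^ 3) • ω := by
  have hX := X_ne hg.gen
  have h := dWedge_div (1 / g.X) (g.Y / g.X) 0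
  rw [show (g.Y / g.X - const 0) / (1 / g.X) = g.Y by
    simp only [const, map_zero]; field_simp; ring, wedge_uY hg] at h
  have h' := congrArg ((1 / g.X) • ·) h
  simp only [smul_smul] at h'
  rw [show 1 / g.X * (1 / (1 / g.X)) = 1 by field_simp, one_smul] at h'
  rw [← h']
  congr 1
  ring

theorem wedge_ur (hg : g.Adapted ω v) : dWedge (1 / g.X) g.r = (-(1 / g.X)) • ω := by
  have hX := X_ne hg.gen
  rw [← r_eq, dWedge_div, wedge_uY hg, smul_smul]
  congr 1
  field_simp

theorem wedge_uq (hg : g.Adapted ω v) : dWedge (1 / g.X) g.q = (-1 : K) • ω := by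
  have hX := X_ne hg.gen
  rw [← q_eq, dWedge_div, wedge_ur hg, smul_smul]
  congr 1
  field_simp

theorem wedge_N0 (hg : g.Adapted ω v) :
    dWedge (1 / g.Y) (g.Y / g.X) = (-((1 / g.Y) ^ 3 * (g.Y / g.X) ^ 2)) • ω := by
  have hX := X_ne hg.gen
  have hY := Y_ne hg.gen
  have h := dWedge_div' (1 / g.X) (g.Y / g.X) 0 ((gen_uw hg.gen).swap.sub_ne_zero 0)
  rw [div_w hg.gen, wedge_uw hg, smul_smul,
    show g.Y / g.X - const 0 = g.Y / g.X by simp [const]] at h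
  rw [h]
  congr 1
  field_simp

theorem wedge_N1 (hg : g.Adapted ω v) :
    dWedge (1 / g.X / (g.Y - const g.e₁)) (g.Y - const g.e₁) =
      (-((1 / g.X / (g.Y - const g.e₁)) ^ 2 * (g.Y - const g.e₁) ^ 1)) • ω := by
  have hX := X_ne hg.gen
  have hY := Y_sub_ne hg.gen
  rw [dWedge_div' _ _ _ hY, wedge_uY hg, smul_smul]
  congr 1
  field_simp

theorem wedge_N2 (hg : g.Adapted ω v) :
    dWedge (1 / g.X / (g.r - const g.e₂)) (g.r - const g.e₂) =
      (-((1 / g.X / (g.r - const g.e₂)) ^ 1)) • ω := by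
  have hX := X_ne hg.gen
  have hr := r_sub_ne hg.gen
  rw [dWedge_div' _ _ _ hr, wedge_ur hg, smul_smul]
  congr 1
  field_simp

theorem smul_eq_of_wedge {a : K} {ω η : ExteriorAlgebra K (Ω[K⁄ℂ])} (h : η = (-a) • ω) :
    a • ω = const (-1) • η := by
  rw [h, smul_smul, const, map_neg, map_one, neg_one_mul, neg_neg]

theorem field_u (hg : g.Adapted ω v) : v (1 / g.X) = -(const g.κ + 1 / g.X * (2 * const g.l * g.Y +
    1 / g.X * (3 * const g.m * g.Y ^ 2 + 2 * const g.c * g.Y + const g.e))) := by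
  rw [derivation_one_div, Ince.field_u (X_ne hg.gen) hg.field_X]

theorem field_r (g : Branch) (v : Derivation ℂ K K) :
    v g.r = (g.Y - const g.e₁) * v g.X + g.X * v g.Y := by
  rw [r, derivation_mul, map_sub, derivation_const, sub_zero]

theorem field_q (hg : g.Adapted ω v) : v g.q = const g.l * g.r ^ 2 +
    g.r * (3 * const g.m * g.Y ^ 2 + 2 * const g.c * g.Y + const g.e) +
    g.q * (2 * const g.l * g.Y +
      1 / g.X * (3 * const g.m * g.Y ^ 2 + 2 * const g.c * g.Y + const g.e)) := by
  have h := Ince.field_q (X_ne hg.gen) hg.field_X hg.field_Y (r := g.r) (q := g.q) rfl rfl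
  rw [← h, q, derivation_mul, map_sub, derivation_const, sub_zero, field_r g v]

theorem val_G {R : Pt} {ev : R →ₐ[ℂ] ℂ} {y : ℂ} (hY : Val ev g.Y y) :
    Val ev (3 * const g.m * g.Y ^ 2 + 2 * const g.c * g.Y + const g.e)
      (3 * g.m * y ^ 2 + 2 * g.c * y + g.e) :=
  (((Val.three.mul (Val.const g.m)).mul (hY.pow 2)).add
    ((Val.two.mul (Val.const g.c)).mul hY)).add (Val.const g.e)

theorem val_T {R : Pt} {ev : R →ₐ[ℂ] ℂ} {y : ℂ} (hu : Val ev (1 / g.X) 0) (hY : Val ev g.Y y) :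
    Val ev (2 * const g.l * g.Y +
      1 / g.X * (3 * const g.m * g.Y ^ 2 + 2 * const g.c * g.Y + const g.e)) (2 * g.l * y) :=
  (((Val.two.mul (Val.const g.l)).mul hY).add (hu.mul (val_G hY))).congr rfl (by simp)

theorem field_u_mem (hg : g.Adapted ω v) {R : Pt} {ev : R →ₐ[ℂ] ℂ} {y : ℂ}
    (hu : Val ev (1 / g.X) 0) (hY : Val ev g.Y y) : v (1 / g.X) ∈ R := by
  rw [field_u hg]
  exact ((Val.const g.κ).add (hu.mul (val_T hu hY))).neg.mem

/-! ### Local forms at the points of a branch -/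

section LocalForm

variable {ι : Type} [Fintype ι] {D : ι → Pt} {m : ι → ℕ} {i₀ i₁ i₂ : ι}

theorem localForm_N0 [DecidableEq ι] (hg : g.Adapted ω v) (h₀ : D i₀ = g.D0) (h₁ : D i₁ = g.D1)
    (hne : i₀ ≠ i₁) (hm₀ : m i₀ = 3) (hm₁ : m i₁ = 2)
    (hD : ∀ k, k ≠ i₀ → k ≠ i₁ → ¬ g.N0 ≤ D k) : LocalForm D m ω v g.N0 := by
  have hX := X_ne hg.gen
  have hY := Y_ne hg.gen
  obtain ⟨ev, hev, hu, hw, hp⟩ := place_N0 hg.gen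
  have hS := ((Val.const (ev := ev) g.l).mul ((Val.const g.e₁).pow 2)).add
    ((Val.const g.κ).mul (Val.const g.e₂))
  have hE := ((((Val.two (ev := ev)).mul (Val.const g.κ)).mul (Val.one.sub ((Val.const g.e₁).mul
      hp))).add
    ((Val.const g.l).mul hw)).sub ((hS.mul (hp.pow 2)).mul hw)
  -- The residue `-3κ` consists of `-2κ` from the derivative of `Y` and `-κ` from that of `X`.
  refine localForm_cross (ε := -1) (gen_N0 hg.gen) hne (h₀.trans (D0_eq_N0 hg.gen).symm)
    (h₁.trans (D1_eq_N0 hg.gen).symm) hD (by norm_num) ?_ ?_ hp hw (l := -3 * g.κ)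
    (mul_ne_zero (by norm_num) hg.κ_ne) ?_
  · rw [hm₀, hm₁]
    exact smul_eq_of_wedge (wedge_N0 hg)
  · rw [derivation_one_div, field_N0' hX hY hg.field_Y]
    exact hE.mem
  · rw [derivation_div]
    refine (hE.neg.sub (((((Val.const g.κ).add ((Val.two.mul (Val.const g.l)).mul hw)).add
      ((Val.three.mul (Val.const g.m)).mul (hw.pow 2))).add
      (((Val.two.mul (Val.const g.c)).mul hw).mul hu)).add ((Val.const g.e).mul (hu.pow 2)))).congr
      (field_N0 hX hY hg.field_X hg.field_Y).symm ?_
    simp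
    ring

theorem localForm_N1 [DecidableEq ι] (hg : g.Adapted ω v) (h₁ : D i₁ = g.D1) (h₂ : D i₂ = g.D2)
    (hne : i₁ ≠ i₂) (hm₁ : m i₁ = 2) (hm₂ : m i₂ = 1)
    (hD : ∀ k, k ≠ i₁ → k ≠ i₂ → ¬ g.N1 ≤ D k) : LocalForm D m ω v g.N1 := by
  have hX := X_ne hg.gen
  have hY0 := Y_sub_ne hg.gen
  obtain ⟨ev, hev, hu, hw, hY, hp, hq⟩ := place_N1 hg.gen
  refine localForm_cross (ε := -1) (gen_N1 hg.gen) hne (h₁.trans (D1_eq_N1 hg.gen).symm)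
    (h₂.trans (D2_eq_N1 hg.gen).symm) hD (by norm_num) ?_ ?_ hp hq (l := -2 * g.κ)
    (mul_ne_zero (by norm_num) hg.κ_ne) ?_
  · rw [hm₁, hm₂]
    exact smul_eq_of_wedge (wedge_N1 hg)
  · rw [derivation_div, derivation_one_div, map_sub, derivation_const, sub_zero,
      field_N1' hX hY0 hg.field_X hg.field_Y]
    exact ((((Val.const g.κ).sub (hu.mul (val_T hu hY))).add
      (((Val.const g.l).mul hu).mul (hY.add (Val.const g.e₁)))).sub
      (((Val.const g.κ).mul (Val.const g.e₂)).mul hp)).mem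
  · rw [map_sub, derivation_const, sub_zero]
    refine ((Val.two.mul (Val.const g.κ)).add (hp.mul (((Val.const g.l).mul
      ((hY.pow 2).sub ((Val.const g.e₁).pow 2))).sub
      ((Val.const g.κ).mul (Val.const g.e₂))))).neg.congr (field_N1 hX hY0 hg.field_Y).symm ?_
    simp

theorem localForm_N2 [DecidableEq ι] (hg : g.Adapted ω v) (h₂ : D i₂ = g.D2) (hm₂ : m i₂ = 1)
    (hD : ∀ k, k ≠ i₂ → ¬ g.N2 ≤ D k) : LocalForm D m ω v g.N2 := by
  have hX := X_ne hg.gen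
  have hr0 := r_sub_ne hg.gen
  obtain ⟨ev, hev, hu, hw, hY, hr, hp, hq⟩ := place_N2 hg.gen
  have hH := ((Val.const g.l).mul (hr.pow 2)).add (hr.mul (val_G hY))
  refine localForm_smooth (ε := -1) (gen_N2 hg.gen) (h₂.trans (D2_eq_N2 hg.gen).symm) hD
    (by norm_num) ?_ ?_ hev hp hq (l := -g.κ) (neg_ne_zero.2 hg.κ_ne) ?_
  · rw [hm₂]
    exact smul_eq_of_wedge (wedge_N2 hg)
  · rw [derivation_div, derivation_one_div, map_sub, derivation_const, sub_zero, field_r,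
      field_N2' hX hg.field_X hg.field_Y (r := g.r) rfl hr0]
    exact ((hp.mul (val_T hu hY)).neg.sub ((hp.pow 2).mul hH)).mem
  · rw [map_sub, derivation_const, sub_zero, field_r]
    refine ((Val.const g.κ).neg.add (hp.mul (hu.mul hH))).congr
      (field_N2 hX hg.field_X hg.field_Y rfl hr0).symm ?_
    simp

/-- The coefficient `-2κ(c - e₁)` vanishes only at the second centre, which is excluded. -/
theorem localForm_F1 [DecidableEq ι] (hg : g.Adapted ω v) (h₁ : D i₁ = g.D1) (hm₁ : m i₁ = 2)
    {c : ℂ} (hc : c ≠ g.e₁) (hD : ∀ k, k ≠ i₁ → ¬ g.F1 c ≤ D k) :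
    LocalForm D m ω v (g.F1 c) := by
  have hX := X_ne hg.gen
  obtain ⟨ev, hev, hu, hw, hY⟩ := place_F1 hg.gen c
  refine localForm_smooth (ε := -1) (gen_uY hg.gen) h₁ hD (by norm_num) ?_
    (field_u_mem hg hu hY) hev hu hY (l := -(2 * g.κ * (c - g.e₁)))
    (neg_ne_zero.2 (mul_ne_zero (mul_ne_zero (by norm_num) hg.κ_ne) (sub_ne_zero.2 hc))) ?_
  · rw [hm₁]
    exact smul_eq_of_wedge (wedge_uY hg)
  · refine (((Val.two.mul (Val.const g.κ)).mul (hY.sub (Val.const g.e₁))).add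
      (hu.mul (((Val.const g.l).mul ((hY.pow 2).sub ((Val.const g.e₁).pow 2))).sub
        ((Val.const g.κ).mul (Val.const g.e₂))))).neg.congr (field_Y hX hg.field_Y).symm ?_
    simp

theorem localForm_F2 [DecidableEq ι] (hg : g.Adapted ω v) (h₂ : D i₂ = g.D2) (hm₂ : m i₂ = 1)
    {c : ℂ} (hc : c ≠ g.e₂) (hD : ∀ k, k ≠ i₂ → ¬ g.F2 c ≤ D k) :
    LocalForm D m ω v (g.F2 c) := by
  have hX := X_ne hg.gen
  obtain ⟨ev, hev, hu, hw, hY, hr⟩ := place_F2 hg.gen c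
  refine localForm_smooth (ε := -1) (gen_ur hg.gen) h₂ hD (by norm_num) ?_
    (field_u_mem hg hu hY) hev hu hr (l := -g.κ * (c - g.e₂))
    (mul_ne_zero (neg_ne_zero.2 hg.κ_ne) (sub_ne_zero.2 hc)) ?_
  · rw [hm₂, pow_one]
    exact smul_eq_of_wedge (wedge_ur hg)
  · rw [field_r]
    refine (((Val.const g.κ).neg.mul (hr.sub (Val.const g.e₂))).add
      (hu.mul (hu.mul (((Val.const g.l).mul (hr.pow 2)).add (hr.mul (val_G hY)))))).congr
      (Ince.field_r hX hg.field_X hg.field_Y rfl).symm ?_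
    simp

/-- In the coordinates `u, q` the 2-form has neither zero nor pole and both components of the field
are regular; so the third exceptional curve belongs to the phase space. -/
theorem localForm_F3 (hg : g.Adapted ω v) {c : ℂ} (hD : ∀ k, ¬ g.F3 c ≤ D k) :
    LocalForm D m ω v (g.F3 c) := by
  obtain ⟨ev, hev, hu, hw, hY, hr, hq⟩ := place_F3 hg.gen c
  refine localForm_off (ε := -1) (gen_uq hg.gen) hD (by norm_num) ?_ (field_u_mem hg hu hY) ?_
  · have := smul_eq_of_wedge (a := 1) (wedge_uq hg)
    rwa [one_smul] at this
  · rw [field_q hg]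
    exact ((((Val.const g.l).mul (hr.pow 2)).add (hr.mul (val_G hY))).add
      (hq.mul (val_T hu hY))).mem

end LocalForm

end Branch

/-! ### The surface -/

theorem const_neg (c : ℂ) : const (-c) = -const c := map_neg _ c

theorem const_ofNat (n : ℕ) [n.AtLeastTwo] : const (OfNat.ofNat n) = OfNat.ofNat n :=
  map_ofNat _ n

/-- The three branches of the Ince-XXX system at infinity. -/
def branch (α β γ : ℂ) : Fin 3 → Branch :=
  ![⟨x, y - x, 1, 2 * α, -(2 * α ^ 2 - 2 * β + γ), 1 / 2, 0, 0, γ⟩,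
    ⟨x, y + x, -1, -(2 * α), 2 * α ^ 2 - 2 * β - γ, 1 / 2, 0, 0, γ⟩,
    ⟨y, -x, -(1 / 2), 0, 2 * γ, 0, 1 / 2, -(2 * α), 2 * β⟩]

theorem x_ne : x ≠ 0 := gen_x_y.ne_zero

theorem y_ne : y ≠ 0 := gen_x_y.swap.ne_zero

theorem Gen.sub_left {u v : K} (h : Gen u v) : Gen u (v - u) := by
  have h₁ : u ∈ IntermediateField.adjoin ℂ {u, v - u} :=
    IntermediateField.subset_adjoin ℂ _ (by simp)
  have h₂ : v - u ∈ IntermediateField.adjoin ℂ {u, v - u} :=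
    IntermediateField.subset_adjoin ℂ _ (by simp)
  exact h.of_mem h₁ (by simpa using add_mem h₂ h₁)

theorem Gen.add_left {u v : K} (h : Gen u v) : Gen u (v + u) := by
  have h₁ : u ∈ IntermediateField.adjoin ℂ {u, v + u} :=
    IntermediateField.subset_adjoin ℂ _ (by simp)
  have h₂ : v + u ∈ IntermediateField.adjoin ℂ {u, v + u} :=
    IntermediateField.subset_adjoin ℂ _ (by simp)
  exact h.of_mem h₁ (by simpa using sub_mem h₂ h₁)

theorem Gen.neg {u v : K} (h : Gen u v) : Gen u (-v) := by
  have h₁ : u ∈ IntermediateField.adjoin ℂ {u, -v} :=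
    IntermediateField.subset_adjoin ℂ _ (by simp)
  have h₂ : -v ∈ IntermediateField.adjoin ℂ {u, -v} :=
    IntermediateField.subset_adjoin ℂ _ (by simp)
  exact h.of_mem h₁ (by simpa using neg_mem h₂)

theorem pointAt_neg_swap {u v : K} (h : Gen u v) (a b : ℂ) :
    pointAt (-v) u (-b) a = pointAt u v a b :=
  pointAt_eq h.neg.swap h (fun _ _ _ h₁ h₂ => ⟨h₂, by simpa using h₁.neg⟩)
    (fun _ _ _ h₁ h₂ => ⟨h₂.neg, h₁⟩)

theorem gen_branch (α β γ : ℂ) (b : Fin 3) : Gen (branch α β γ b).X (branch α β γ b).Y := by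
  fin_cases b
  · exact gen_x_y.sub_left
  · exact gen_x_y.add_left
  · exact gen_x_y.swap.neg

theorem gen_inf : Gen (1 / x) (y / x) :=
  Branch.gen_uw (g := ⟨x, y, 0, 0, 0, 0, 0, 0, 0⟩) gen_x_y

theorem div_y_ne : y / x ≠ 0 := div_ne_zero y_ne x_ne

theorem neg_inv_inv {F : Type} [Field F] (t : F) : (-t⁻¹)⁻¹ = -t := by
  rw [inv_neg, inv_inv]

theorem w_zero (α β γ : ℂ) : (branch α β γ 0).Y / (branch α β γ 0).X = y / x - 1 := by
  change (y - x) / x = _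
  rw [sub_div, div_self x_ne]

theorem w_one (α β γ : ℂ) : (branch α β γ 1).Y / (branch α β γ 1).X = y / x + 1 := by
  change (y + x) / x = _
  rw [add_div, div_self x_ne]

theorem w_two (α β γ : ℂ) : (branch α β γ 2).Y / (branch α β γ 2).X = -(y / x)⁻¹ := by
  change -x / y = _
  rw [inv_div]
  exact neg_div y x

/-! ### Separation of the three directions at infinity -/

section Over

variable {α β γ : ℂ} {R : Pt} {L : Type} [Field L] [Algebra ℂ L] {ev : R →ₐ[ℂ] L}

theorem val_zero_iff : Val ev ((branch α β γ 0).Y / (branch α β γ 0).X) 0 ↔ Val ev (y / x) 1 := by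
  rw [w_zero]
  exact ⟨fun h => (h.add Val.one).congr (by ring) (by simp),
    fun h => (h.sub Val.one).congr rfl (by simp)⟩

theorem val_one_iff :
    Val ev ((branch α β γ 1).Y / (branch α β γ 1).X) 0 ↔ Val ev (y / x) (-1) := by
  rw [w_one]
  exact ⟨fun h => (h.sub Val.one).congr (by ring) (by simp),
    fun h => (h.add Val.one).congr rfl (by simp)⟩

theorem val_two_iff :
    Val ev ((branch α β γ 2).Y / (branch α β γ 2).X) 0 ↔ Val ev (y / x)⁻¹ 0 := by
  rw [w_two]
  exact ⟨fun h => h.neg.congr (by ring) (by simp), fun h => h.neg.congr rfl (by simp)⟩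

end Over

/-- Over the three centres `y / x` takes the values `1`, `-1` and `∞`. So over one centre the
function `Y / X` of another branch has a nonzero, possibly infinite, value. -/
theorem inv_mem_of_over {α β γ : ℂ} {b b' : Fin 3} (hb : b ≠ b') {R : Pt}
    (hR : (branch α β γ b).Over R) :
    ((branch α β γ b').Y / (branch α β γ b').X)⁻¹ ∈ R := by
  obtain ⟨ev, hev, -, hw⟩ := hR
  -- At a pole of `t`, use `t ∓ 1 = t (1 ∓ t⁻¹)`.
  have h0 : ∀ t : K, t ≠ 0 → Val ev t⁻¹ 0 → (t - 1)⁻¹ ∈ R ∧ (t + 1)⁻¹ ∈ R := by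
    intro t ht h
    have h₁ := h.div hev (Val.one.sub h) (by simp)
    have h₂ := h.div hev (Val.one.add h) (by simp)
    have h₃ : 1 - t⁻¹ ≠ 0 := (Val.one.sub h).ne_zero (by simp)
    have h₄ : 1 + t⁻¹ ≠ 0 := (Val.one.add h).ne_zero (by simp)
    have e₁ : t - 1 = t * (1 - t⁻¹) := by field_simp
    have e₂ : t + 1 = t * (1 + t⁻¹) := by field_simp
    rw [e₁, e₂, mul_inv, mul_inv, ← div_eq_mul_inv, ← div_eq_mul_inv]
    exact ⟨h₁.mem, h₂.mem⟩
  have key : ∀ t : K, ∀ c : ℂ, Val ev t c → c ≠ 1 → (t - 1)⁻¹ ∈ R := fun t c h hc =>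
    ((h.sub Val.one).inv hev (sub_ne_zero.2 hc)).mem
  have key' : ∀ t : K, ∀ c : ℂ, Val ev t c → c ≠ -1 → (t + 1)⁻¹ ∈ R := fun t c h hc =>
    ((h.add Val.one).inv hev (fun h => hc (eq_neg_of_add_eq_zero_left h))).mem
  fin_cases b <;> fin_cases b' <;> first | exact absurd rfl hb | skip
  · change ((branch α β γ 1).Y / (branch α β γ 1).X)⁻¹ ∈ R
    rw [w_one]
    exact key' _ _ (val_zero_iff.1 hw) (by norm_num)
  · change ((branch α β γ 2).Y / (branch α β γ 2).X)⁻¹ ∈ R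
    rw [w_two, show (-(y / x)⁻¹)⁻¹ = -(y / x) from neg_inv_inv _]
    exact neg_mem (val_zero_iff.1 hw).mem
  · change ((branch α β γ 0).Y / (branch α β γ 0).X)⁻¹ ∈ R
    rw [w_zero]
    exact key _ _ (val_one_iff.1 hw) (by norm_num)
  · change ((branch α β γ 2).Y / (branch α β γ 2).X)⁻¹ ∈ R
    rw [w_two, show (-(y / x)⁻¹)⁻¹ = -(y / x) from neg_inv_inv _]
    exact neg_mem (val_one_iff.1 hw).mem
  · change ((branch α β γ 0).Y / (branch α β γ 0).X)⁻¹ ∈ R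
    rw [w_zero]
    exact (h0 _ div_y_ne (val_two_iff.1 hw)).1
  · change ((branch α β γ 1).Y / (branch α β γ 1).X)⁻¹ ∈ R
    rw [w_one]
    exact (h0 _ div_y_ne (val_two_iff.1 hw)).2

theorem not_over_of_over {α β γ : ℂ} {b b' : Fin 3} (hb : b ≠ b') {R : Pt}
    (hR : (branch α β γ b).Over R) : ¬ (branch α β γ b').Over R := by
  rintro ⟨ev, hev, -, hw⟩
  have h := gen_branch α β γ b'
  exact hw.inv_notMem (div_ne_zero (Branch.Y_ne h) (Branch.X_ne h)) (inv_mem_of_over hb hR)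

theorem pointAt_sub_const {u v : K} (h : Gen u v) {a b c : ℂ} {w : K} (hw : w = v - const c) :
    pointAt u w a (b - c) = pointAt u v a b := by
  subst hw
  have h₁ : u ∈ IntermediateField.adjoin ℂ {u, v - const c} :=
    IntermediateField.subset_adjoin ℂ _ (by simp)
  have h₂ : v - const c ∈ IntermediateField.adjoin ℂ {u, v - const c} :=
    IntermediateField.subset_adjoin ℂ _ (by simp)
  have h' : Gen u (v - const c) := h.of_mem h₁
    (by simpa [const] using add_mem h₂ (IntermediateField.algebraMap_mem _ c))
  exact pointAt_eq h' h (fun _ _ _ h₁ h₂ => ⟨h₁, (h₂.add (Val.const c)).congr (by ring) (by simp)⟩)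
    (fun _ _ _ h₁ h₂ => ⟨h₁, h₂.sub (Val.const c)⟩)

theorem C0_zero (α β γ : ℂ) : (branch α β γ 0).C0 = pointAt (1 / x) (y / x) 0 1 := by
  have h := pointAt_sub_const (a := 0) (b := 1) (c := 1) gen_inf (w := (branch α β γ 0).Y /
    (branch α β γ 0).X) (by rw [w_zero, const, map_one])
  rw [sub_self] at h
  exact h

theorem C0_one (α β γ : ℂ) : (branch α β γ 1).C0 = pointAt (1 / x) (y / x) 0 (-1) := by
  have h := pointAt_sub_const (a := 0) (b := -1) (c := -1) gen_inf (w := (branch α β γ 1).Y /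
    (branch α β γ 1).X) (by rw [w_one, const, map_neg, map_one, sub_neg_eq_add])
  rw [sub_self] at h
  exact h

theorem C0_two (α β γ : ℂ) : (branch α β γ 2).C0 = pointAt (x / y) (1 / y) 0 0 := by
  have h := pointAt_neg_swap (Branch.gen_uw (gen_branch α β γ 2)) 0 0
  rw [neg_zero, show -((branch α β γ 2).Y / (branch α β γ 2).X) = x / y by
    rw [w_two, neg_neg, inv_div]] at h
  exact h.symm

theorem F1_two (α β γ : ℂ) :
    (branch α β γ 2).F1 (branch α β γ 2).e₁ = pointAt x (1 / y) 0 0 := by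
  have h := pointAt_neg_swap (Branch.gen_uY (gen_branch α β γ 2)) 0 0
  rw [neg_zero] at h
  refine h.symm.trans ?_
  change pointAt (- -x) (1 / y) 0 0 = _
  rw [neg_neg]

theorem F2_one (α β γ : ℂ) : (branch α β γ 1).F2 (branch α β γ 1).e₂ =
    pointAt (1 / x) ((y + x + const (2 * α)) * x) 0 (2 * α ^ 2 - 2 * β - γ) := by
  change pointAt (1 / x) ((y + x - const (-(2 * α))) * x) 0 _ = _
  rw [const_neg, sub_neg_eq_add]
  rfl

theorem F2_two (α β γ : ℂ) : (branch α β γ 2).F2 (branch α β γ 2).e₂ =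
    pointAt (x * y) (1 / y) (-(2 * γ)) 0 := by
  have h := pointAt_neg_swap (Branch.gen_ur (gen_branch α β γ 2)) 0 (2 * γ)
  refine h.symm.trans ?_
  change pointAt (-((-x - const 0) * y)) (1 / y) _ 0 = _
  rw [const, map_zero, sub_zero, neg_mul, neg_neg]

/-- The surface obtained from the projective plane by the nine blow-ups. -/
def surface (α β γ : ℂ) : Set Pt :=
  (branch α β γ 2).blowUp₃ ((branch α β γ 1).blowUp₃ ((branch α β γ 0).blowUp₃ projectivePlane))

theorem inf_mem (c : ℂ) : pointAt (1 / x) (y / x) 0 c ∈ projectivePlane :=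
  Or.inl (Or.inr ⟨_, _, rfl⟩)

theorem iteratedBlowUp_surface (α β γ : ℂ) :
    IteratedBlowUp projectivePlane (centres α β γ) (surface α β γ) := by
  have hc : centres α β γ =
      [(branch α β γ 0).C0, (branch α β γ 0).F1 (branch α β γ 0).e₁,
        (branch α β γ 0).F2 (branch α β γ 0).e₂,
        (branch α β γ 1).C0, (branch α β γ 1).F1 (branch α β γ 1).e₁,
        (branch α β γ 1).F2 (branch α β γ 1).e₂,
        (branch α β γ 2).C0, (branch α β γ 2).F1 (branch α β γ 2).e₁,
        (branch α β γ 2).F2 (branch α β γ 2).e₂] := by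
    rw [C0_zero, C0_one, C0_two, F1_two, F2_one, F2_two]
    rfl
  have h := gen_branch α β γ
  have ho := fun b => Branch.over_C0 (h b)
  rw [hc]
  -- The second and the third centre of a branch lie on the exceptional curve just created. The
  -- first centre survives the earlier blow-ups since it does not lie over the other directions.
  refine .cons ?_ (.cons (Branch.C1_mem (h 0) _) (.cons (Branch.C2_mem (h 0) _)
    (.cons ?_ (.cons (Branch.C1_mem (h 1) _) (.cons (Branch.C2_mem (h 1) _)
    (.cons ?_ (.cons (Branch.C1_mem (h 2) _) (.cons (Branch.C2_mem (h 2) _) (.nil _)))))))))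
  · rw [C0_zero]
    exact inf_mem 1
  · refine Branch.mem_blowUp₃_of_not_over (h 0) ?_ (not_over_of_over (by decide) (ho 1))
    rw [C0_one]
    exact inf_mem (-1)
  · refine Branch.mem_blowUp₃_of_not_over (h 1) (Branch.mem_blowUp₃_of_not_over (h 0) ?_
      (not_over_of_over (by decide) (ho 2))) (not_over_of_over (by decide) (ho 2))
    rw [C0_two]
    exact Or.inr ⟨_, _, rfl⟩

theorem mem_surface_of_mem_points {α β γ : ℂ} {b : Fin 3} {R : Pt}
    (hR : R ∈ (branch α β γ b).points) : R ∈ surface α β γ := by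
  have h := gen_branch α β γ
  have ho := Branch.over_of_mem_points (h b) hR
  fin_cases b
  · exact Branch.mem_blowUp₃_of_not_over (h 2) (Branch.mem_blowUp₃_of_not_over (h 1)
      (Branch.mem_blowUp₃_of_mem_points (h 0) hR) (not_over_of_over (by decide) ho))
      (not_over_of_over (by decide) ho)
  · exact Branch.mem_blowUp₃_of_not_over (h 2) (Branch.mem_blowUp₃_of_mem_points (h 1) hR)
      (not_over_of_over (by decide) ho)
  · exact Branch.mem_blowUp₃_of_mem_points (h 2) hR

theorem place_affine (a b : ℂ) : ∃ ev : pointAt x y a b →ₐ[ℂ] ℂ, IsPlace ev ∧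
    Val ev x a ∧ Val ev y b := exists_place_pointAt gen_x_y a b

theorem X_mem_affine (α β γ a b : ℂ) (i : Fin 3) : (branch α β γ i).X ∈ pointAt x y a b := by
  obtain ⟨ev, hev, hx, hy⟩ := place_affine a b
  fin_cases i
  exacts [hx.mem, hx.mem, hy.mem]

theorem not_over_affine (α β γ a b : ℂ) (i : Fin 3) :
    ¬ (branch α β γ i).Over (pointAt x y a b) := by
  rintro ⟨ev, hev, hu, -⟩
  refine hu.inv_notMem (one_div_ne_zero (Branch.X_ne (gen_branch α β γ i))) ?_
  rw [one_div, inv_inv]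
  exact X_mem_affine α β γ a b i

theorem affine_mem_surface (α β γ a b : ℂ) : pointAt x y a b ∈ surface α β γ := by
  have h := gen_branch α β γ
  have ho := not_over_affine α β γ a b
  exact Branch.mem_blowUp₃_of_not_over (h 2) (Branch.mem_blowUp₃_of_not_over (h 1)
    (Branch.mem_blowUp₃_of_not_over (h 0) (Or.inl (Or.inl ⟨_, _, rfl⟩)) (ho 0)) (ho 1)) (ho 2)

/-! ### Overlaps of the charts of the projective plane, and the list of points of the surface -/

theorem gen_inf' : Gen (x / y) (1 / y) := by
  have := (Branch.gen_uw (g := ⟨y, x, 0, 0, 0, 0, 0, 0, 0⟩) gen_x_y.swap).swap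
  exact this

theorem pointAt_inf_eq {a b : ℂ} (ha : a ≠ 0) :
    pointAt (1 / x) (y / x) a b = pointAt x y (1 / a) (b / a) := by
  have hx := x_ne
  refine pointAt_eq gen_inf gen_x_y (fun _ ev hev h₁ h₂ => ?_) (fun _ ev hev h₁ h₂ => ?_)
  · exact ⟨(Val.one.div hev h₁ ha).congr (by simp) rfl,
      (h₂.div hev h₁ ha).congr (by field_simp) rfl⟩
  · have ha' : 1 / a ≠ 0 := one_div_ne_zero ha
    exact ⟨(Val.one.div hev h₁ ha').congr rfl (by simp),
      (h₂.div hev h₁ ha').congr rfl (by field_simp)⟩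

theorem pointAt_inf'_eq {a b : ℂ} (hb : b ≠ 0) :
    pointAt (x / y) (1 / y) a b = pointAt x y (a / b) (1 / b) := by
  have hy := y_ne
  refine pointAt_eq gen_inf' gen_x_y (fun _ ev hev h₁ h₂ => ?_) (fun _ ev hev h₁ h₂ => ?_)
  · exact ⟨(h₁.div hev h₂ hb).congr (by field_simp) rfl,
      (Val.one.div hev h₂ hb).congr (by simp) rfl⟩
  · have hb' : 1 / b ≠ 0 := one_div_ne_zero hb
    exact ⟨(h₁.div hev h₂ hb').congr rfl (by field_simp),
      (Val.one.div hev h₂ hb').congr rfl (by simp)⟩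

theorem pointAt_inf'_eq_inf {a : ℂ} (ha : a ≠ 0) :
    pointAt (x / y) (1 / y) a 0 = pointAt (1 / x) (y / x) 0 (1 / a) := by
  have hx := x_ne
  have hy := y_ne
  refine pointAt_eq gen_inf' gen_inf (fun _ ev hev h₁ h₂ => ?_) (fun _ ev hev h₁ h₂ => ?_)
  · exact ⟨(h₂.div hev h₁ ha).congr (by field_simp) (by simp),
      (Val.one.div hev h₁ ha).congr (by field_simp) rfl⟩
  · have ha' : 1 / a ≠ 0 := one_div_ne_zero ha
    exact ⟨(Val.one.div hev h₂ ha').congr (by field_simp) (by simp),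
      (h₁.div hev h₂ ha').congr (by field_simp) (by simp)⟩

/-- The points of the surface. -/
theorem of_mem_surface {α β γ : ℂ} {R : Pt} (hR : R ∈ surface α β γ) :
    (∃ a b, R = pointAt x y a b) ∨
      (∃ c, c ≠ 1 ∧ c ≠ -1 ∧ R = pointAt (1 / x) (y / x) 0 c) ∨
        ∃ b, R ∈ (branch α β γ b).points := by
  have h := gen_branch α β γ
  rcases Branch.of_mem_blowUp₃ (h 2) hR with ⟨hR, h₂⟩ | hR
  rcases Branch.of_mem_blowUp₃ (h 1) hR with ⟨hR, h₁⟩ | hR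
  rcases Branch.of_mem_blowUp₃ (h 0) hR with ⟨hR, h₀⟩ | hR
  · rw [C0_zero] at h₀
    rw [C0_one] at h₁
    rw [C0_two] at h₂
    -- A point of the line at infinity left over by all blow-ups is different from the first
    -- centres, so `y / x` is not `1` or `-1` there.
    have hinf : ∀ c, R = pointAt (1 / x) (y / x) 0 c →
        ∃ c, c ≠ 1 ∧ c ≠ -1 ∧ R = pointAt (1 / x) (y / x) 0 c := fun c hc =>
      ⟨c, fun h1 => h₀ (by rw [hc, h1]), fun h1 => h₁ (by rw [hc, h1]), hc⟩
    rcases hR with (⟨a, b, hR⟩ | ⟨a, b, hR⟩) | ⟨a, b, hR⟩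
    · exact Or.inl ⟨a, b, hR⟩
    · by_cases ha : a = 0
      · rw [ha] at hR
        exact Or.inr (Or.inl (hinf _ hR))
      · exact Or.inl ⟨_, _, hR.trans (pointAt_inf_eq ha)⟩
    · by_cases hb : b = 0
      · rw [hb] at hR
        by_cases ha : a = 0
        · rw [ha] at hR
          exact absurd hR h₂
        · exact Or.inr (Or.inl (hinf _ (hR.trans (pointAt_inf'_eq_inf ha))))
      · exact Or.inl ⟨_, _, hR.trans (pointAt_inf'_eq hb)⟩
  · exact Or.inr (Or.inr ⟨0, hR⟩)
  · exact Or.inr (Or.inr ⟨1, hR⟩)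
  · exact Or.inr (Or.inr ⟨2, hR⟩)

/-! ### The vector field -/

theorem const_mul (a b : ℂ) : const (a * b) = const a * const b := map_mul _ a b

theorem const_add (a b : ℂ) : const (a + b) = const a + const b := map_add _ a b

theorem const_sub (a b : ℂ) : const (a - b) = const a - const b := map_sub _ a b

theorem const_pow (a : ℂ) (n : ℕ) : const (a ^ n) = const a ^ n := map_pow _ a n

theorem const_zero : const 0 = 0 := map_zero _

theorem const_one : const 1 = 1 := map_one _

theorem const_two : const 2 = 2 := const_ofNat 2

theorem const_half : const (1 / 2) = 1 / 2 := by
  rw [const, map_div₀, map_one]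
  exact congrArg _ const_two

theorem field_x (α β γ : ℂ) : hamiltonianField (hamiltonian α β γ) x = x * y + const γ := by
  have h := (exists_derivation (MvPolynomial.aeval ![x, y] (MvPolynomial.pderiv 1
    (hamiltonian α β γ))) (-MvPolynomial.aeval ![x, y] (MvPolynomial.pderiv 0
    (hamiltonian α β γ)))).choose_spec.1
  refine h.trans ?_
  have h2 : algebraMap ℂ K 2 = 2 := const_two
  simp [hamiltonian, MvPolynomial.pderiv_X, const, h2]
  ring

theorem field_y (α β γ : ℂ) : hamiltonianField (hamiltonian α β γ) y =
    3 / 2 * x ^ 2 - 1 / 2 * y ^ 2 + 4 * const α * x + 2 * const β := by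
  have h := (exists_derivation (MvPolynomial.aeval ![x, y] (MvPolynomial.pderiv 1
    (hamiltonian α β γ))) (-MvPolynomial.aeval ![x, y] (MvPolynomial.pderiv 0
    (hamiltonian α β γ)))).choose_spec.2
  refine h.trans ?_
  have h2 : algebraMap ℂ K 2 = 2 := const_two
  simp [hamiltonian, MvPolynomial.pderiv_X, const, h2]
  ring

/-- This verifies the parameters of the three branches: they come from expanding `H` in the
coordinates `X, Y`. -/
theorem branch_adapted (α β γ : ℂ) (b : Fin 3) :
    (branch α β γ b).Adapted (dWedge x y) (hamiltonianField (hamiltonian α β γ)) := by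
  have hX := field_x α β γ
  have hY := field_y α β γ
  refine ⟨gen_branch α β γ b, ?_, ?_, ?_, ?_⟩
  · fin_cases b
    · exact one_ne_zero
    · exact neg_ne_zero.2 one_ne_zero
    · exact neg_ne_zero.2 (by norm_num)
  · fin_cases b
    · change dWedge x (y - x) = dWedge x y
      rw [dWedge_eq (p := x) (q := y) (a := 1) (b := 0) (c := -1) (d := 1)]
      · simp
      · simp
      · rw [map_sub, one_smul, neg_one_smul, neg_add_eq_sub]
    · change dWedge x (y + x) = dWedge x y
      rw [dWedge_eq (p := x) (q := y) (a := 1) (b := 0) (c := 1) (d := 1)]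
      · simp
      · simp
      · rw [map_add, one_smul, one_smul, add_comm]
    -- The sign in `Y = -x` compensates for the exchange of `x` and `y`.
    · change dWedge y (-x) = dWedge x y
      rw [dWedge_eq (p := x) (q := y) (a := 0) (b := 1) (c := -1) (d := 0)]
      · simp
      · simp
      · rw [map_neg]; simp
  · fin_cases b
    · change hamiltonianField (hamiltonian α β γ) x = const 1 * x ^ 2 +
        2 * const (1 / 2) * x * (y - x) + 3 * const 0 * (y - x) ^ 2 + 2 * const 0 * (y - x) +
        const γ
      rw [hX, const_half, const_one, const_zero]
      ring
    · change hamiltonianField (hamiltonian α β γ) x = const (-1) * x ^ 2 +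
        2 * const (1 / 2) * x * (y + x) + 3 * const 0 * (y + x) ^ 2 + 2 * const 0 * (y + x) +
        const γ
      rw [hX, const_half, const_neg, const_one, const_zero]
      ring
    · change hamiltonianField (hamiltonian α β γ) y = const (-(1 / 2)) * y ^ 2 +
        2 * const 0 * y * -x + 3 * const (1 / 2) * (-x) ^ 2 + 2 * const (-(2 * α)) * -x +
        const (2 * β)
      rw [hY, const_neg, const_neg, const_half, const_mul, const_mul, const_two, const_zero]
      ring
  · fin_cases b
    · change hamiltonianField (hamiltonian α β γ) (y - x) = -(2 * const 1 * x *
        (y - x - const (2 * α)) + const (1 / 2) * ((y - x) ^ 2 - const (2 * α) ^ 2) -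
        const 1 * const (-(2 * α ^ 2 - 2 * β + γ)))
      rw [map_sub, hX, hY, const_neg, const_add, const_sub, const_mul, const_mul, const_mul,
        const_pow, const_two, const_half, const_one]
      ring
    · change hamiltonianField (hamiltonian α β γ) (y + x) = -(2 * const (-1) * x *
        (y + x - const (-(2 * α))) + const (1 / 2) * ((y + x) ^ 2 - const (-(2 * α)) ^ 2) -
        const (-1) * const (2 * α ^ 2 - 2 * β - γ))
      rw [map_add, hX, hY, const_neg, const_neg, const_sub, const_sub, const_mul, const_mul,
        const_mul, const_pow, const_two, const_half, const_one]
      ring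
    · change hamiltonianField (hamiltonian α β γ) (-x) = -(2 * const (-(1 / 2)) * y *
        (-x - const 0) + const 0 * ((-x) ^ 2 - const 0 ^ 2) -
        const (-(1 / 2)) * const (2 * γ))
      rw [map_neg, hX, const_neg, const_mul, const_two, const_half, const_zero]
      ring

/-! ### The anticanonical divisor -/

/-- The components of the anticanonical divisor. -/
def component (α β γ : ℂ) : Fin 7 → Pt :=
  ![curveAt (1 / x) (y / x), (branch α β γ 0).D1, (branch α β γ 0).D2,
    (branch α β γ 1).D1, (branch α β γ 1).D2, (branch α β γ 2).D1, (branch α β γ 2).D2]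

/-- The inner components of the three branches. -/
def inner : Fin 3 → Fin 7 := ![1, 3, 5]

/-- The outer components of the three branches. -/
def outer : Fin 3 → Fin 7 := ![2, 4, 6]

theorem index_cases : ∀ k : Fin 7, k = 0 ∨ ∃ b, k = inner b ∨ k = outer b := by decide

theorem component_inner (α β γ : ℂ) (b : Fin 3) :
    component α β γ (inner b) = (branch α β γ b).D1 := by
  fin_cases b <;> rfl

theorem component_outer (α β γ : ℂ) (b : Fin 3) :
    component α β γ (outer b) = (branch α β γ b).D2 := by
  fin_cases b <;> rfl

/-- All branches see the same line at infinity: if `Y / X` has residue `t`, then `y / x` has residue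
`t + 1`, `t - 1` or `-1 / t`, which is again transcendental. -/
theorem component_zero (α β γ : ℂ) (b : Fin 3) :
    component α β γ 0 = (branch α β γ b).D0 := by
  change curveAt (1 / x) (y / x) = _
  obtain ⟨ev, hev, hu, hw, -⟩ := Branch.place_D0 (gen_branch α β γ b)
  have h0 : ratVar ≠ 0 := fun h0 => transcendental_ratVar (h0 ▸ isAlgebraic_zero)
  fin_cases b
  · refine curveAt_eq gen_inf hev hu
      ((hw.sub (Val.const (-1))).congr ?_ rfl) (Branch.transcendental_sub _)
    rw [const_neg, const_one]
    exact (congrArg (· - -1) (w_zero α β γ)).trans (by ring)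
  · refine curveAt_eq gen_inf hev hu
      ((hw.sub (Val.const 1)).congr ?_ rfl) (Branch.transcendental_sub _)
    rw [const_one]
    exact (congrArg (· - 1) (w_one α β γ)).trans (by ring)
  · have hx := x_ne
    have hy := y_ne
    have hw' : Val ev (-(y / x)⁻¹) ratVar := hw.congr (w_two α β γ) rfl
    have hu' : Val ev (1 / y) 0 := hu
    have h := hw'.neg.inv hev (neg_ne_zero.2 h0)
    have ht : Transcendental ℂ (-ratVar)⁻¹ := fun h1 =>
      transcendental_ratVar (by simpa using h1.inv.neg)
    refine curveAt_eq gen_inf hev ?_ (h.congr (by field_simp) rfl) ht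
    exact (hu'.mul (h.congr (by field_simp : _ = y / x) rfl)).congr (by field_simp) (zero_mul _)

theorem inner_ne_zero (b : Fin 3) : inner b ≠ 0 := by revert b; decide

theorem outer_ne_zero (b : Fin 3) : outer b ≠ 0 := by revert b; decide

theorem inner_ne_outer (b b' : Fin 3) : inner b ≠ outer b' := by revert b b'; decide

theorem inner_injective : Function.Injective inner := by decide

theorem outer_injective : Function.Injective outer := by decide

/-- Multiplicities of the anticanonical divisor. -/
abbrev multiplicity : Fin 7 → ℕ := ![3, 2, 1, 2, 1, 2, 1]

theorem multiplicity_inner (b : Fin 3) : multiplicity (inner b) = 2 := by revert b; decide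

theorem multiplicity_outer (b : Fin 3) : multiplicity (outer b) = 1 := by revert b; decide

/-! ### Which points lie on which components -/

section Incidence

variable {α β γ : ℂ} {b : Fin 3} {k : Fin 7}

/-- On the curves of another branch its function `Y / X` vanishes, but at `R` this function has an
inverse. -/
theorem eq_of_le_component {R : Pt} (hR : (branch α β γ b).Over R) (hk : R ≤ component α β γ k) :
    k = 0 ∨ k = inner b ∨ k = outer b := by
  rcases index_cases k with h | ⟨b', h⟩
  · exact Or.inl h
  · by_cases hb : b = b'
    · subst hb
      exact Or.inr h
    · exfalso
      have hn := Branch.not_le_of_w (gen_branch α β γ b') (inv_mem_of_over hb hR)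
      rcases h with rfl | rfl
      · rw [component_inner] at hk
        exact hn.1 hk
      · rw [component_outer] at hk
        exact hn.2 hk

theorem not_le_zero {R : Pt} (hR : (branch α β γ b).Y ∈ R) : ¬ R ≤ component α β γ 0 := by
  rw [component_zero α β γ b]
  exact Branch.not_le_D0_of_Y (gen_branch α β γ b) hR

theorem not_le_inner {R : Pt} (hR : (branch α β γ b).r ∈ R) :
    ¬ R ≤ component α β γ (inner b) := by
  rw [component_inner]
  exact Branch.not_le_D1_of_r (gen_branch α β γ b) hR

theorem of_N0_le (hk : (branch α β γ b).N0 ≤ component α β γ k) : k = 0 ∨ k = inner b := by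
  have hg := gen_branch α β γ b
  rcases eq_of_le_component (Branch.over_of_mem_points hg (Or.inl rfl)) hk with rfl | rfl | rfl
  · exact Or.inl rfl
  · exact Or.inr rfl
  · exfalso
    obtain ⟨ev, hev, hu, hw, hp⟩ := Branch.place_N0 hg
    rw [component_outer] at hk
    refine Branch.not_le_D2_of_Y hg ?_ hk
    have hY := Branch.Y_ne hg
    -- This is `(Y - e₁)⁻¹ = (1 / Y) / (1 - e₁ / Y)`, regular where `1 / Y` vanishes.
    have h := hp.div hev (Val.one.sub ((Val.const (branch α β γ b).e₁).mul hp)) (by simp)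
    refine (h.congr ?_ rfl).mem
    field_simp

theorem of_N1_le (hk : (branch α β γ b).N1 ≤ component α β γ k) : k = inner b ∨ k = outer b := by
  have hg := gen_branch α β γ b
  obtain ⟨ev, hev, hu, hw, hY, hp⟩ := Branch.place_N1 hg
  refine (eq_of_le_component ⟨ev, hev, hu, hw⟩ hk).resolve_left ?_
  rintro rfl
  exact not_le_zero hY.mem hk

theorem of_N2_le (hk : (branch α β γ b).N2 ≤ component α β γ k) : k = outer b := by
  have hg := gen_branch α β γ b
  obtain ⟨ev, hev, hu, hw, hY, hr, hp⟩ := Branch.place_N2 hg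
  rcases eq_of_le_component ⟨ev, hev, hu, hw⟩ hk with rfl | rfl | rfl
  · exact absurd hk (not_le_zero hY.mem)
  · exact absurd hk (not_le_inner hr.mem)
  · rfl

theorem of_F1_le {c : ℂ} (hc : c ≠ (branch α β γ b).e₁)
    (hk : (branch α β γ b).F1 c ≤ component α β γ k) : k = inner b := by
  have hg := gen_branch α β γ b
  obtain ⟨ev, hev, hu, hw, hY⟩ := Branch.place_F1 hg c
  rcases eq_of_le_component ⟨ev, hev, hu, hw⟩ hk with rfl | rfl | rfl
  · exact absurd hk (not_le_zero hY.mem)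
  · rfl
  · rw [component_outer] at hk
    exact absurd hk (Branch.not_le_D2_of_Y hg
      ((hY.sub (Val.const (branch α β γ b).e₁)).inv hev (sub_ne_zero.2 hc)).mem)

theorem of_F2_le {c : ℂ} (hk : (branch α β γ b).F2 c ≤ component α β γ k) : k = outer b := by
  have hg := gen_branch α β γ b
  obtain ⟨ev, hev, hu, hw, hY, hr⟩ := Branch.place_F2 hg c
  rcases eq_of_le_component ⟨ev, hev, hu, hw⟩ hk with rfl | rfl | rfl
  · exact absurd hk (not_le_zero hY.mem)
  · exact absurd hk (not_le_inner hr.mem)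
  · rfl

theorem not_F3_le {c : ℂ} : ¬ (branch α β γ b).F3 c ≤ component α β γ k := by
  intro hk
  have hg := gen_branch α β γ b
  obtain ⟨ev, hev, hu, hw, hY, hr, hq⟩ := Branch.place_F3 hg c
  rcases eq_of_le_component ⟨ev, hev, hu, hw⟩ hk with rfl | rfl | rfl
  · exact absurd hk (not_le_zero hY.mem)
  · exact absurd hk (not_le_inner hr.mem)
  · rw [component_outer] at hk
    exact Branch.not_le_D2_of_q hg hq.mem hk

theorem not_affine_le {a b : ℂ} : ¬ pointAt x y a b ≤ component α β γ k := by
  intro hk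
  have h := fun b' => Branch.not_le_of_X (gen_branch α β γ b') (X_mem_affine α β γ a b b')
  rcases index_cases k with rfl | ⟨b', rfl | rfl⟩
  · rw [component_zero α β γ 0] at hk
    exact (h 0).1 hk
  · rw [component_inner] at hk
    exact (h b').2.1 hk
  · rw [component_outer] at hk
    exact (h b').2.2 hk

theorem of_inf_le {c : ℂ} (hc : c ≠ 1) (hc' : c ≠ -1)
    (hk : pointAt (1 / x) (y / x) 0 c ≤ component α β γ k) : k = 0 := by
  obtain ⟨ev, hev, hu, hw⟩ := exists_place_pointAt gen_inf 0 c
  have hmem : ∀ b', ((branch α β γ b').Y / (branch α β γ b').X)⁻¹ ∈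
      pointAt (1 / x) (y / x) 0 c := by
    intro b'
    fin_cases b'
    · exact ((hw.sub Val.one).inv hev (sub_ne_zero.2 hc)).mem |> fun h => by
        rw [← w_zero α β γ] at h; exact h
    · exact ((hw.add Val.one).inv hev fun h => hc' (eq_neg_of_add_eq_zero_left h)).mem |> fun h =>
        by rw [← w_one α β γ] at h; exact h
    · have h := hw.neg.mem
      rw [← neg_inv_inv, ← w_two α β γ] at h
      exact h
  rcases index_cases k with rfl | ⟨b', rfl | rfl⟩
  · rfl
  · rw [component_inner] at hk
    exact absurd hk (Branch.not_le_of_w (gen_branch α β γ b') (hmem b')).1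
  · rw [component_outer] at hk
    exact absurd hk (Branch.not_le_of_w (gen_branch α β γ b') (hmem b')).2

end Incidence

theorem field_inf {F : Type} [Field F] {x y α β γ A B : F} (hx : x ≠ 0) (h2 : (2 : F) ≠ 0)
    (hA : A = x * y + γ)
    (hB : B = 3 / 2 * x ^ 2 - 1 / 2 * y ^ 2 + 4 * α * x + 2 * β) :
    -A / x ^ 2 = -(y / x + γ * (1 / x) ^ 2) ∧
    1 / x * ((x * B - y * A) / x ^ 2) =
      3 / 2 * (1 - (y / x) ^ 2) + 4 * α * (1 / x) + 2 * β * (1 / x) ^ 2 -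
        γ * (1 / x) ^ 2 * (y / x) := by
  subst hA hB
  constructor
  · field_simp
  · field_simp
    ring

/-- The local structure of the surface at each of its points. -/
theorem localForm_surface {α β γ : ℂ} {R : Pt} (hR : R ∈ surface α β γ) :
    LocalForm (component α β γ) multiplicity (dWedge x y)
      (hamiltonianField (hamiltonian α β γ)) R := by
  have had := branch_adapted α β γ
  have h0 := component_zero α β γ
  have h1 := component_inner α β γ
  have h2 := component_outer α β γ
  rcases of_mem_surface hR with ⟨a, b, rfl⟩ | ⟨c, hc, hc', rfl⟩ | ⟨b, hb⟩
  · obtain ⟨ev, hev, hx, hy⟩ := place_affine a b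
    refine localForm_off (ε := 1) gen_x_y (fun i => not_affine_le) one_ne_zero ?_ ?_ ?_
    · rw [const_one, one_smul]
    · rw [field_x]
      exact ((hx.mul hy).add (Val.const γ)).mem
    · rw [field_y]
      have h3 := Val.three.div hev Val.two two_ne_zero (ev := ev)
      have h1 := Val.one.div hev Val.two two_ne_zero (ev := ev)
      exact ((((h3.mul (hx.pow 2)).sub (h1.mul (hy.pow 2))).add
        (((Val.ofNat 4).mul (Val.const α)).mul hx)).add (Val.two.mul (Val.const β))).mem
  · obtain ⟨ev, hev, hu, hw⟩ := exists_place_pointAt gen_inf 0 c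
    have htwo : (2 : K) ≠ 0 := (Val.two (ev := ev)).ne_zero two_ne_zero
    obtain ⟨hA, hB⟩ := field_inf x_ne htwo (field_x α β γ) (field_y α β γ)
    have h3 := Val.three.div hev Val.two two_ne_zero (ev := ev)
    refine localForm_smooth (ε := -1) (i := 0) gen_inf rfl
      (fun k hk hle => hk (of_inf_le hc hc' hle)) (by norm_num) ?_ ?_ hev hu hw
      (l := 3 / 2 * (1 - c ^ 2)) ?_ ?_
    -- The 2-form is taken over from the first branch, whose `Y / X` differs from `y / x` by the
    -- constant `1`.
    · have hwd := Branch.wedge_uw (had 0)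
      refine Branch.smul_eq_of_wedge ?_
      have hsub := dWedge_sub_const (1 / x) (y / x) 0 1
      rw [const_zero, sub_zero, const_one] at hsub
      rw [w_zero] at hwd
      exact hsub.symm.trans hwd
    · rw [derivation_one_div, hA]
      exact (hw.add ((Val.const γ).mul (hu.pow 2))).neg.mem
    -- On the line the coefficient vanishes only at `c = ±1`, the first centres of two branches.
    · refine mul_ne_zero (by norm_num) fun h => ?_
      have : (c - 1) * (c + 1) = 0 := by linear_combination -h
      rcases mul_eq_zero.1 this with h | h
      · exact hc (sub_eq_zero.1 h)
      · exact hc' (eq_neg_of_add_eq_zero_left h)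
    · rw [derivation_div, hB]
      refine ((((h3.mul (Val.one.sub (hw.pow 2))).add
        (((Val.ofNat 4).mul (Val.const α)).mul hu)).add
        ((Val.two.mul (Val.const β)).mul (hu.pow 2))).sub
        (((Val.const γ).mul (hu.pow 2)).mul hw)).congr rfl ?_
      simp
  · rcases hb with rfl | rfl | rfl | ⟨c, hc, rfl⟩ | ⟨c, hc, rfl⟩ | ⟨c, rfl⟩
    · exact Branch.localForm_N0 (had b) (h0 b) (h1 b) (inner_ne_zero b).symm rfl
        (multiplicity_inner b) fun k hk hk' hle => (of_N0_le hle).elim hk hk'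
    · exact Branch.localForm_N1 (had b) (h1 b) (h2 b) (inner_ne_outer b b) (multiplicity_inner b)
        (multiplicity_outer b) fun k hk hk' hle => (of_N1_le hle).elim hk hk'
    · exact Branch.localForm_N2 (had b) (h2 b) (multiplicity_outer b)
        fun k hk hle => hk (of_N2_le hle)
    · exact Branch.localForm_F1 (had b) (h1 b) (multiplicity_inner b) hc
        fun k hk hle => hk (of_F1_le hc hle)
    · exact Branch.localForm_F2 (had b) (h2 b) (multiplicity_outer b) hc
        fun k hk hle => hk (of_F2_le hle)
    · exact Branch.localForm_F3 (had b) fun k => not_F3_le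

/-! ### Intersection numbers -/

section Intersection

open scoped Classical in
-- In all cases at hand the local orders are a constant `s` on a finite set of points and `0`
-- elsewhere.
theorem hasIntersectionNumber_of_finset {X : Set Pt} {W V : Pt} (h : K) (N : Finset Pt) (s : ℤ)
    (hN : ∀ R ∈ N, R ∈ X ∧ R ≤ V)
    (H : ∀ R ∈ X, R ≤ V → ∃ f p a b : R, IsLocalEquation R W f ∧ IsLocalEquation R V p ∧
      UnitIn V a ∧ UnitIn V b ∧ (f : K) * b = h * a ∧
      (if R ∈ N then s else 0) = (localIntersection p a : ℤ) - (localIntersection p b : ℤ)) :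
    HasIntersectionNumber X W V (N.card * s) := by
  refine ⟨h, fun R => if R ∈ N then s else 0, H, N.finite_toSet.subset fun R hR => ?_, ?_⟩
  · by_contra hn
    exact hR.2.2 (if_neg hn)
  · have hsub : ∀ R, (∑ᶠ _ : R ∈ {R | R ∈ X ∧ R ≤ V}, if R ∈ N then s else 0) =
        if R ∈ N then s else 0 := by
      intro R
      by_cases hR : R ∈ N
      · exact finsum_eq_if.trans (if_pos (hN R hR))
      · rw [if_neg hR]
        simp
    rw [finsum_congr hsub, finsum_eq_sum_of_support_subset (s := N)]
    · rw [Finset.sum_congr rfl fun R hR => if_pos hR, Finset.sum_const, nsmul_eq_mul]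
    · intro R hR
      by_contra hn
      exact hR (if_neg hn)

theorem UnitIn.one {V : Pt} : UnitIn V 1 := ⟨one_ne_zero, one_mem V, by simp [one_mem V]⟩

theorem unitIn_const {V : Pt} {c : ℂ} (hc : c ≠ 0) : UnitIn V (const c) :=
  ⟨fun h => hc ((map_eq_zero _).1 h), V.algebraMap_mem c, by
    rw [const, ← map_inv₀]
    exact V.algebraMap_mem _⟩

theorem localIntersection_one {R : Pt} (p : R) : localIntersection p 1 = 0 :=
  localIntersection_of_isUnit isUnit_one

/-- The curve `V` is smooth at `R`, and `u` is the product of its local equation and of a local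
coordinate of `V` at `R`. -/
def Transversal (R V W : Pt) (u : K) : Prop :=
  ∃ p q : R, IsLocalEquation R V p ∧ IsLocalEquation R W q ∧ UnitIn V q ∧
    localIntersection p q = 1 ∧ (p : K) * q = u

theorem pointAt_swap {p q : K} (h : Gen p q) {a b : ℂ} : pointAt p q a b = pointAt q p b a :=
  pointAt_eq h h.swap (fun _ _ _ h₁ h₂ => ⟨h₂, h₁⟩) (fun _ _ _ h₁ h₂ => ⟨h₂, h₁⟩)

theorem isLocalEquation_curveAt_swap {p q : K} (h : Gen p q) {f : pointAt p q 0 0}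
    (hf : (f : K) = q) : IsLocalEquation (pointAt p q 0 0) (curveAt q p) f := by
  have : ∀ (R : Pt) (f : R), R = pointAt q p 0 0 → (f : K) = q →
      IsLocalEquation R (curveAt q p) f := by
    rintro R f rfl hf
    exact isLocalEquation_curveAt h.swap 0 hf
  exact this _ _ (pointAt_swap h) hf

theorem unitIn_curveAt {p q : K} (h : Gen p q) : UnitIn (curveAt p q) q := by
  obtain ⟨ev, hev, hp, hq⟩ := exists_place_curveAt h
  have h0 : ratVar ≠ 0 := fun h0 => transcendental_ratVar (h0 ▸ isAlgebraic_zero)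
  exact hev.unitIn_iff.2 ⟨_, h0, hq⟩

theorem transversal_pointAt {p q : K} (h : Gen p q) :
    Transversal (pointAt p q 0 0) (curveAt p q) (curveAt q p) (p * q) := by
  obtain ⟨ev, hev, hp, hq⟩ := exists_place_pointAt h 0 0
  exact ⟨⟨p, hp.mem⟩, ⟨q, hq.mem⟩, isLocalEquation_curveAt h 0 rfl,
    isLocalEquation_curveAt_swap h rfl, unitIn_curveAt h,
    localIntersection_of_isLocalCoord hev
      (isLocalCoord_pointAt h (by simp [const]) (by simp [const])), rfl⟩

theorem transversal_pointAt_swap {p q : K} (h : Gen p q) :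
    Transversal (pointAt p q 0 0) (curveAt q p) (curveAt p q) (p * q) := by
  rw [pointAt_swap h, mul_comm]
  exact transversal_pointAt h.swap

variable {X : Set Pt} {V W : Pt}

theorem hasIntersectionNumber_zero
    (hV : ∀ R ∈ X, R ≤ V → ∃ f z : R, IsLocalEquation R V f ∧ IsLocalCoord f z)
    (hd : ∀ R ∈ X, R ≤ V → ¬ R ≤ W) : HasIntersectionNumber X W V 0 := by
  refine (hasIntersectionNumber_of_finset 1 ∅ 0 (by simp) fun R hR hle => ?_)
  obtain ⟨p, z, hp, -⟩ := hV R hR hle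
  exact ⟨1, p, 1, 1, isLocalEquation_of_not_le (hd R hR hle) isUnit_one, hp, UnitIn.one,
    UnitIn.one, rfl, by simp⟩

/-- Away from `R₀` the curves do not meet, so `h = 1` is admissible and the only contribution is the
transversal crossing. -/
theorem hasIntersectionNumber_one {R₀ : Pt} (h₀ : R₀ ∈ X) (hle₀ : R₀ ≤ V) {u : K}
    (ht : Transversal R₀ V W u)
    (hV : ∀ R ∈ X, R ≤ V → ∃ f z : R, IsLocalEquation R V f ∧ IsLocalCoord f z)
    (hd : ∀ R ∈ X, R ≤ V → R ≤ W → R = R₀) : HasIntersectionNumber X W V 1 := by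
  classical
  refine (hasIntersectionNumber_of_finset 1 {R₀} 1 (by simp [h₀, hle₀]) fun R hR hle => ?_)
  by_cases hR₀ : R = R₀
  · subst hR₀
    obtain ⟨p, q, hp, hq, hu, hi, -⟩ := ht
    refine ⟨q, p, q, 1, hq, hp, hu, UnitIn.one, mul_comm _ _, ?_⟩
    rw [hi, localIntersection_one]
    simp
  · obtain ⟨p, z, hp, -⟩ := hV R hR hle
    refine ⟨1, p, 1, 1, isLocalEquation_of_not_le (fun h => hR₀ (hd R hR hle h)) isUnit_one, hp,
      UnitIn.one, UnitIn.one, rfl, ?_⟩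
    simp [hR₀]

/-- Take `h = u`. At a point of `N`, `u = p q` with `q` transversal to `V`, so `V - div u` has the
local equation `1 / q` and contributes `-1`. Elsewhere on `V`, `u` is itself a local equation of `V`
up to a constant and contributes nothing. -/
theorem hasIntersectionNumber_self {N : Finset Pt} {u : K} (hN : ∀ R ∈ N, R ∈ X ∧ R ≤ V)
    (ht : ∀ R ∈ N, ∃ W, Transversal R V W u)
    (hV : ∀ R ∈ X, R ≤ V → R ∉ N →
      ∃ (p : R) (c : ℂ), c ≠ 0 ∧ IsLocalEquation R V p ∧ (p : K) = const c * u) :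
    HasIntersectionNumber X V V (-N.card) := by
  classical
  rw [← mul_neg_one]
  refine (hasIntersectionNumber_of_finset u N (-1) hN fun R hR hle => ?_)
  by_cases hR₀ : R ∈ N
  · obtain ⟨W, p, q, hp, hq, hu, hi, hpq⟩ := ht R hR₀
    refine ⟨p, p, 1, q, hp, hp, UnitIn.one, hu, hpq.trans (mul_one u).symm, ?_⟩
    rw [hi, localIntersection_one]
    simp [hR₀]
  · obtain ⟨p, c, hc, hp, hpu⟩ := hV R hR hle hR₀
    have hc' : (const c : K) ∈ R := R.algebraMap_mem c
    have hunit : IsUnit (⟨const c, hc'⟩ : R) :=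
      isUnit_iff.2 ⟨fun h => (unitIn_const hc (V := R)).1 (congrArg Subtype.val h),
        (unitIn_const hc).2.2⟩
    refine ⟨p, p, ⟨const c, hc'⟩, 1, hp, hp, unitIn_const hc, UnitIn.one, ?_, ?_⟩
    · exact (mul_one _).trans (hpu.trans (mul_comm _ _))
    · rw [localIntersection_of_isUnit hunit, localIntersection_one]
      simp [hR₀]

end Intersection

/-! ### The components of the anticanonical divisor -/

namespace Branch

variable {g : Branch}

theorem N0_le_D0 (h : Gen g.X g.Y) : g.N0 ≤ g.D0 := by
  rw [← D0_eq_N0 h]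
  exact pointAt_le_curveAt (gen_N0 h) 0

theorem N0_le_D1 (h : Gen g.X g.Y) : g.N0 ≤ g.D1 := by
  rw [← D1_eq_N0 h, N0, pointAt_swap (gen_N0 h)]
  exact pointAt_le_curveAt (gen_N0 h).swap 0

theorem N1_le_D1 (h : Gen g.X g.Y) : g.N1 ≤ g.D1 := by
  rw [← D1_eq_N1 h]
  exact pointAt_le_curveAt (gen_N1 h) 0

theorem N1_le_D2 (h : Gen g.X g.Y) : g.N1 ≤ g.D2 := by
  rw [← D2_eq_N1 h, N1, pointAt_swap (gen_N1 h)]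
  exact pointAt_le_curveAt (gen_N1 h).swap 0

theorem N2_le_D2 (h : Gen g.X g.Y) : g.N2 ≤ g.D2 := by
  rw [← D2_eq_N2 h]
  exact pointAt_le_curveAt (gen_N2 h) 0

theorem mul_N0 (h : Gen g.X g.Y) : 1 / g.Y * (g.Y / g.X) = 1 / g.X := by
  have := Y_ne h
  field_simp

theorem transversal_N0 (h : Gen g.X g.Y) : Transversal g.N0 g.D0 g.D1 (1 / g.X) := by
  rw [← D0_eq_N0 h, ← D1_eq_N0 h, ← mul_N0 h]
  exact transversal_pointAt (gen_N0 h)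

theorem transversal_N0' (h : Gen g.X g.Y) : Transversal g.N0 g.D1 g.D0 (1 / g.X) := by
  rw [← D0_eq_N0 h, ← D1_eq_N0 h, ← mul_N0 h]
  exact transversal_pointAt_swap (gen_N0 h)

theorem transversal_N1 (h : Gen g.X g.Y) : Transversal g.N1 g.D1 g.D2 (1 / g.X) := by
  have ht := transversal_pointAt (gen_N1 h)
  rw [D1_eq_N1 h, D2_eq_N1 h, div_mul_cancel₀ _ (Y_sub_ne h)] at ht
  exact ht

theorem transversal_N1' (h : Gen g.X g.Y) : Transversal g.N1 g.D2 g.D1 (1 / g.X) := by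
  have ht := transversal_pointAt_swap (gen_N1 h)
  rw [D1_eq_N1 h, D2_eq_N1 h, div_mul_cancel₀ _ (Y_sub_ne h)] at ht
  exact ht

theorem transversal_N2 (h : Gen g.X g.Y) : ∃ W, Transversal g.N2 g.D2 W (1 / g.X) := by
  have ht := transversal_pointAt (gen_N2 h)
  rw [D2_eq_N2 h, div_mul_cancel₀ _ (r_sub_ne h)] at ht
  exact ⟨_, ht⟩

theorem localEquation_F1 (h : Gen g.X g.Y) (c : ℂ) :
    ∃ p : g.F1 c, IsLocalEquation (g.F1 c) g.D1 p ∧ (p : K) = 1 / g.X := by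
  obtain ⟨ev, hev, hu, -⟩ := place_F1 h c
  exact ⟨⟨_, hu.mem⟩, isLocalEquation_curveAt (gen_uY h) c rfl, rfl⟩

theorem localEquation_F2 (h : Gen g.X g.Y) (c : ℂ) :
    ∃ p : g.F2 c, IsLocalEquation (g.F2 c) g.D2 p ∧ (p : K) = 1 / g.X := by
  obtain ⟨ev, hev, hu, -⟩ := place_F2 h c
  exact ⟨⟨_, hu.mem⟩, isLocalEquation_curveAt (gen_ur h) c rfl, rfl⟩

theorem localEquation_N0 (h : Gen g.X g.Y) :
    ∃ p : g.N0, IsLocalEquation g.N0 g.D0 p ∧ (p : K) = 1 / g.Y := by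
  obtain ⟨ev, hev, -, -, hp⟩ := place_N0 h
  refine ⟨⟨_, hp.mem⟩, ?_, rfl⟩
  rw [← D0_eq_N0 h]
  exact isLocalEquation_curveAt (gen_N0 h) 0 rfl

end Branch

section Components

variable {α β γ : ℂ}

theorem component_smooth {R : Pt} (hR : R ∈ surface α β γ) {i : Fin 7}
    (hi : R ≤ component α β γ i) :
    ∃ f z : R, IsLocalEquation R (component α β γ i) f ∧ IsLocalCoord f z :=
  (localForm_surface hR).smooth i hi

theorem N0_mem (b : Fin 3) : (branch α β γ b).N0 ∈ surface α β γ :=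
  mem_surface_of_mem_points (Or.inl rfl)

theorem N1_mem (b : Fin 3) : (branch α β γ b).N1 ∈ surface α β γ :=
  mem_surface_of_mem_points (Or.inr (Or.inl rfl))

theorem N2_mem (b : Fin 3) : (branch α β γ b).N2 ∈ surface α β γ :=
  mem_surface_of_mem_points (Or.inr (Or.inr (Or.inl rfl)))

theorem N0_le_zero (b : Fin 3) : (branch α β γ b).N0 ≤ component α β γ 0 := by
  rw [component_zero α β γ b]
  exact Branch.N0_le_D0 (gen_branch α β γ b)

theorem N0_le_inner (b : Fin 3) : (branch α β γ b).N0 ≤ component α β γ (inner b) := by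
  rw [component_inner]
  exact Branch.N0_le_D1 (gen_branch α β γ b)

theorem N1_le_inner (b : Fin 3) : (branch α β γ b).N1 ≤ component α β γ (inner b) := by
  rw [component_inner]
  exact Branch.N1_le_D1 (gen_branch α β γ b)

theorem N1_le_outer (b : Fin 3) : (branch α β γ b).N1 ≤ component α β γ (outer b) := by
  rw [component_outer]
  exact Branch.N1_le_D2 (gen_branch α β γ b)

theorem N2_le_outer (b : Fin 3) : (branch α β γ b).N2 ≤ component α β γ (outer b) := by
  rw [component_outer]
  exact Branch.N2_le_D2 (gen_branch α β γ b)

theorem N0_injective : Function.Injective fun b => (branch α β γ b).N0 := by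
  intro b b' hbb
  have h : (branch α β γ b).N0 = (branch α β γ b').N0 := hbb
  have h1 := N0_le_inner (α := α) (β := β) (γ := γ) b'
  rw [← h] at h1
  exact (inner_injective ((of_N0_le h1).resolve_left (inner_ne_zero b'))).symm

theorem N0_ne_N1 (b : Fin 3) : (branch α β γ b).N0 ≠ (branch α β γ b).N1 := by
  intro h
  have h1 := N0_le_zero (α := α) (β := β) (γ := γ) b
  rw [h] at h1
  rcases of_N1_le h1 with h2 | h2
  · exact inner_ne_zero b h2.symm
  · exact outer_ne_zero b h2.symm

theorem N1_ne_N2 (b : Fin 3) : (branch α β γ b).N1 ≠ (branch α β γ b).N2 := by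
  intro h
  have h1 := N1_le_inner (α := α) (β := β) (γ := γ) b
  rw [h] at h1
  exact inner_ne_outer b b (of_N2_le h1)

/-- The points of the central component. -/
theorem of_le_zero {R : Pt} (hR : R ∈ surface α β γ) (hle : R ≤ component α β γ 0) :
    (∃ c, c ≠ 1 ∧ c ≠ -1 ∧ R = pointAt (1 / x) (y / x) 0 c) ∨
      ∃ b, R = (branch α β γ b).N0 := by
  rcases of_mem_surface hR with ⟨a, b, rfl⟩ | h | ⟨b, h⟩
  · exact absurd hle not_affine_le
  · exact Or.inl h
  · rcases h with rfl | rfl | rfl | ⟨c, hc, rfl⟩ | ⟨c, hc, rfl⟩ | ⟨c, rfl⟩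
    · exact Or.inr ⟨b, rfl⟩
    · rcases of_N1_le hle with h | h
      · exact absurd h.symm (inner_ne_zero b)
      · exact absurd h.symm (outer_ne_zero b)
    · exact absurd (of_N2_le hle).symm (outer_ne_zero b)
    · exact absurd (of_F1_le hc hle).symm (inner_ne_zero b)
    · exact absurd (of_F2_le hle).symm (outer_ne_zero b)
    · exact absurd hle not_F3_le

theorem of_le_inner {R : Pt} (hR : R ∈ surface α β γ) {b : Fin 3}
    (hle : R ≤ component α β γ (inner b)) :
    R = (branch α β γ b).N0 ∨ R = (branch α β γ b).N1 ∨
      ∃ c, c ≠ (branch α β γ b).e₁ ∧ R = (branch α β γ b).F1 c := by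
  rcases of_mem_surface hR with ⟨a, b, rfl⟩ | ⟨c, hc, hc', rfl⟩ | ⟨b', h⟩
  · exact absurd hle not_affine_le
  · exact absurd (of_inf_le hc hc' hle) (inner_ne_zero b)
  · rcases h with rfl | rfl | rfl | ⟨c, hc, rfl⟩ | ⟨c, hc, rfl⟩ | ⟨c, rfl⟩
    · obtain rfl := inner_injective ((of_N0_le hle).resolve_left (inner_ne_zero b))
      exact Or.inl rfl
    · obtain rfl := inner_injective ((of_N1_le hle).resolve_right (inner_ne_outer b b'))
      exact Or.inr (Or.inl rfl)
    · exact absurd (of_N2_le hle) (inner_ne_outer b b')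
    · obtain rfl := inner_injective (of_F1_le hc hle)
      exact Or.inr (Or.inr ⟨c, hc, rfl⟩)
    · exact absurd (of_F2_le hle) (inner_ne_outer b b')
    · exact absurd hle not_F3_le

theorem of_le_outer {R : Pt} (hR : R ∈ surface α β γ) {b : Fin 3}
    (hle : R ≤ component α β γ (outer b)) :
    R = (branch α β γ b).N1 ∨ R = (branch α β γ b).N2 ∨ ∃ c, R = (branch α β γ b).F2 c := by
  rcases of_mem_surface hR with ⟨a, b, rfl⟩ | ⟨c, hc, hc', rfl⟩ | ⟨b', h⟩
  · exact absurd hle not_affine_le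
  · exact absurd (of_inf_le hc hc' hle) (outer_ne_zero b)
  · rcases h with rfl | rfl | rfl | ⟨c, hc, rfl⟩ | ⟨c, hc, rfl⟩ | ⟨c, rfl⟩
    · rcases of_N0_le hle with h | h
      · exact absurd h (outer_ne_zero b)
      · exact absurd h.symm (inner_ne_outer b' b)
    · obtain rfl := outer_injective
        ((of_N1_le hle).resolve_left fun h => inner_ne_outer b' b h.symm)
      exact Or.inl rfl
    · obtain rfl := outer_injective (of_N2_le hle)
      exact Or.inr (Or.inl rfl)
    · exact absurd (of_F1_le hc hle).symm (inner_ne_outer b' b)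
    · obtain rfl := outer_injective (of_F2_le hle)
      exact Or.inr (Or.inr ⟨c, rfl⟩)
    · exact absurd hle not_F3_le

/-! ### Entries of the intersection matrix -/

theorem intersection_zero_inner (b : Fin 3) : HasIntersectionNumber (surface α β γ)
    (component α β γ 0) (component α β γ (inner b)) 1 := by
  have ht := Branch.transversal_N0' (gen_branch α β γ b)
  rw [← component_zero, ← component_inner] at ht
  refine hasIntersectionNumber_one (N0_mem b) (N0_le_inner b) ht
    (fun R hR => component_smooth hR) fun R hR hle hle' => ?_
  rcases of_le_inner hR hle with h | rfl | ⟨c, hc, rfl⟩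
  · exact h
  · rcases of_N1_le hle' with h | h
    · exact absurd h.symm (inner_ne_zero b)
    · exact absurd h.symm (outer_ne_zero b)
  · exact absurd (of_F1_le hc hle').symm (inner_ne_zero b)

theorem intersection_inner_zero (b : Fin 3) : HasIntersectionNumber (surface α β γ)
    (component α β γ (inner b)) (component α β γ 0) 1 := by
  have ht := Branch.transversal_N0 (gen_branch α β γ b)
  rw [← component_zero, ← component_inner] at ht
  refine hasIntersectionNumber_one (N0_mem b) (N0_le_zero b) ht
    (fun R hR => component_smooth hR) fun R hR hle' hle => ?_
  rcases of_le_inner hR hle with h | rfl | ⟨c, hc, rfl⟩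
  · exact h
  · rcases of_N1_le hle' with h | h
    · exact absurd h.symm (inner_ne_zero b)
    · exact absurd h.symm (outer_ne_zero b)
  · exact absurd (of_F1_le hc hle').symm (inner_ne_zero b)

theorem eq_N1_of_le {R : Pt} {b : Fin 3} (hR : R ∈ surface α β γ)
    (hle : R ≤ component α β γ (inner b)) (hle' : R ≤ component α β γ (outer b)) :
    R = (branch α β γ b).N1 := by
  rcases of_le_outer hR hle' with h | rfl | ⟨c, rfl⟩
  · exact h
  · exact absurd (of_N2_le hle) (inner_ne_outer b b)
  · exact absurd (of_F2_le hle) (inner_ne_outer b b)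

theorem intersection_inner_outer (b : Fin 3) : HasIntersectionNumber (surface α β γ)
    (component α β γ (inner b)) (component α β γ (outer b)) 1 := by
  have ht := Branch.transversal_N1' (gen_branch α β γ b)
  rw [← component_inner, ← component_outer] at ht
  exact hasIntersectionNumber_one (N1_mem b) (N1_le_outer b) ht
    (fun R hR => component_smooth hR) fun R hR hle' hle => eq_N1_of_le hR hle hle'

theorem intersection_outer_inner (b : Fin 3) : HasIntersectionNumber (surface α β γ)
    (component α β γ (outer b)) (component α β γ (inner b)) 1 := by
  have ht := Branch.transversal_N1 (gen_branch α β γ b)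
  rw [← component_inner, ← component_outer] at ht
  exact hasIntersectionNumber_one (N1_mem b) (N1_le_inner b) ht
    (fun R hR => component_smooth hR) fun R hR hle hle' => eq_N1_of_le hR hle hle'

theorem not_le_outer_of_le_zero {R : Pt} {b : Fin 3} (hR : R ∈ surface α β γ)
    (hle : R ≤ component α β γ 0) : ¬ R ≤ component α β γ (outer b) := by
  intro hle'
  rcases of_le_outer hR hle' with rfl | rfl | ⟨c, rfl⟩
  · rcases of_N1_le hle with h | h
    · exact inner_ne_zero b h.symm
    · exact outer_ne_zero b h.symm
  · exact outer_ne_zero b (of_N2_le hle).symm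
  · exact outer_ne_zero b (of_F2_le hle).symm

theorem over_of_le_inner {R : Pt} {b : Fin 3} (hR : R ∈ surface α β γ)
    (hle : R ≤ component α β γ (inner b)) : (branch α β γ b).Over R := by
  have hg := gen_branch α β γ b
  rcases of_le_inner hR hle with rfl | rfl | ⟨c, hc, rfl⟩
  · exact Branch.over_of_mem_points hg (Or.inl rfl)
  · exact Branch.over_of_mem_points hg (Or.inr (Or.inl rfl))
  · exact Branch.over_of_mem_points hg (Or.inr (Or.inr (Or.inr (Or.inl ⟨c, hc, rfl⟩))))

theorem over_of_le_outer {R : Pt} {b : Fin 3} (hR : R ∈ surface α β γ)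
    (hle : R ≤ component α β γ (outer b)) : (branch α β γ b).Over R := by
  have hg := gen_branch α β γ b
  rcases of_le_outer hR hle with rfl | rfl | ⟨c, rfl⟩
  · exact Branch.over_of_mem_points hg (Or.inr (Or.inl rfl))
  · exact Branch.over_of_mem_points hg (Or.inr (Or.inr (Or.inl rfl)))
  · exact Branch.over_F2 hg c

/-- The function `1 / x` vanishes on the line and, where it meets the first two branches, also on
their first exceptional curves. Each of these two crossings contributes `-1`. -/
theorem intersection_zero_zero : HasIntersectionNumber (surface α β γ)
    (component α β γ 0) (component α β γ 0) (-2) := by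
  classical
  have hne : (branch α β γ 0).N0 ≠ (branch α β γ 1).N0 := fun h =>
    absurd (N0_injective h) (by decide)
  rw [show (-2 : ℤ) = -(({(branch α β γ 0).N0, (branch α β γ 1).N0} : Finset Pt).card : ℤ) by
    rw [Finset.card_pair hne]; rfl]
  refine hasIntersectionNumber_self (u := 1 / x) (fun R hR => ?_) (fun R hR => ?_)
    fun R hR hle hn => ?_
  · rcases Finset.mem_insert.1 hR with rfl | hR
    · exact ⟨N0_mem 0, N0_le_zero 0⟩
    · obtain rfl := Finset.mem_singleton.1 hR
      exact ⟨N0_mem 1, N0_le_zero 1⟩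
  · rcases Finset.mem_insert.1 hR with rfl | hR
    · rw [component_zero α β γ 0]
      exact ⟨_, Branch.transversal_N0 (gen_branch α β γ 0)⟩
    · obtain rfl := Finset.mem_singleton.1 hR
      rw [component_zero α β γ 1]
      exact ⟨_, Branch.transversal_N0 (gen_branch α β γ 1)⟩
  · rcases of_le_zero hR hle with ⟨c, hc, hc', rfl⟩ | ⟨b, rfl⟩
    · obtain ⟨ev, hev, hu, -⟩ := exists_place_pointAt gen_inf 0 c
      refine ⟨⟨_, hu.mem⟩, 1, one_ne_zero, isLocalEquation_curveAt gen_inf c rfl, ?_⟩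
      rw [const_one, one_mul]
    · obtain ⟨p, hp, hpu⟩ := Branch.localEquation_N0 (gen_branch α β γ b)
      fin_cases b
      · exact absurd (Finset.mem_insert_self _ _) hn
      · exact absurd (Finset.mem_insert_of_mem (Finset.mem_singleton_self _)) hn
      -- On the third branch the local equation `1 / Y` of the line is `-(1 / x)`, so the crossing
      -- point does not count.
      · refine ⟨p, -1, by norm_num, ?_, ?_⟩
        · rw [component_zero α β γ 2]
          exact hp
        · rw [const_neg, const_one]
          refine hpu.trans ?_
          change 1 / -x = -1 * (1 / x)
          rw [one_div_neg_eq_neg_one_div, neg_one_mul]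

theorem intersection_inner_self (b : Fin 3) : HasIntersectionNumber (surface α β γ)
    (component α β γ (inner b)) (component α β γ (inner b)) (-2) := by
  classical
  have hg := gen_branch α β γ b
  rw [show (-2 : ℤ) = -(({(branch α β γ b).N0, (branch α β γ b).N1} : Finset Pt).card : ℤ) by
    rw [Finset.card_pair (N0_ne_N1 b)]; rfl]
  refine hasIntersectionNumber_self (u := 1 / (branch α β γ b).X) (fun R hR => ?_)
    (fun R hR => ?_) fun R hR hle hn => ?_
  · rcases Finset.mem_insert.1 hR with rfl | hR
    · exact ⟨N0_mem b, N0_le_inner b⟩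
    · obtain rfl := Finset.mem_singleton.1 hR
      exact ⟨N1_mem b, N1_le_inner b⟩
  · rw [component_inner]
    rcases Finset.mem_insert.1 hR with rfl | hR
    · exact ⟨_, Branch.transversal_N0' hg⟩
    · obtain rfl := Finset.mem_singleton.1 hR
      exact ⟨_, Branch.transversal_N1 hg⟩
  · rcases of_le_inner hR hle with rfl | rfl | ⟨c, hc, rfl⟩
    · exact absurd (Finset.mem_insert_self _ _) hn
    · exact absurd (Finset.mem_insert_of_mem (Finset.mem_singleton_self _)) hn
    · obtain ⟨p, hp, hpu⟩ := Branch.localEquation_F1 hg c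
      rw [component_inner]
      exact ⟨p, 1, one_ne_zero, hp, by rw [const_one, one_mul, hpu]⟩

theorem intersection_outer_self (b : Fin 3) : HasIntersectionNumber (surface α β γ)
    (component α β γ (outer b)) (component α β γ (outer b)) (-2) := by
  classical
  have hg := gen_branch α β γ b
  rw [show (-2 : ℤ) = -(({(branch α β γ b).N1, (branch α β γ b).N2} : Finset Pt).card : ℤ) by
    rw [Finset.card_pair (N1_ne_N2 b)]; rfl]
  refine hasIntersectionNumber_self (u := 1 / (branch α β γ b).X) (fun R hR => ?_)
    (fun R hR => ?_) fun R hR hle hn => ?_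
  · rcases Finset.mem_insert.1 hR with rfl | hR
    · exact ⟨N1_mem b, N1_le_outer b⟩
    · obtain rfl := Finset.mem_singleton.1 hR
      exact ⟨N2_mem b, N2_le_outer b⟩
  · rw [component_outer]
    rcases Finset.mem_insert.1 hR with rfl | hR
    · exact ⟨_, Branch.transversal_N1' hg⟩
    · obtain rfl := Finset.mem_singleton.1 hR
      exact Branch.transversal_N2 hg
  · rcases of_le_outer hR hle with rfl | rfl | ⟨c, rfl⟩
    · exact absurd (Finset.mem_insert_self _ _) hn
    · exact absurd (Finset.mem_insert_of_mem (Finset.mem_singleton_self _)) hn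
    · obtain ⟨p, hp, hpu⟩ := Branch.localEquation_F2 hg c
      rw [component_outer]
      exact ⟨p, 1, one_ne_zero, hp, by rw [const_one, one_mul, hpu]⟩

theorem affineE6_inner_inner (b b' : Fin 3) :
    - affineE6 (inner b) (inner b') = if b = b' then -2 else 0 := by
  revert b b'; decide

theorem affineE6_outer_outer (b b' : Fin 3) :
    - affineE6 (outer b) (outer b') = if b = b' then -2 else 0 := by
  revert b b'; decide

theorem affineE6_inner_outer (b b' : Fin 3) :
    - affineE6 (inner b) (outer b') = if b = b' then 1 else 0 := by
  revert b b'; decide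

theorem affineE6_outer_inner (b b' : Fin 3) :
    - affineE6 (outer b) (inner b') = if b = b' then 1 else 0 := by
  revert b b'; decide

theorem affineE6_zero (b : Fin 3) : - affineE6 0 (inner b) = 1 ∧ - affineE6 (inner b) 0 = 1 ∧
    - affineE6 0 (outer b) = 0 ∧ - affineE6 (outer b) 0 = 0 := by
  revert b; decide

theorem intersection_component (i j : Fin 7) : HasIntersectionNumber (surface α β γ)
    (component α β γ i) (component α β γ j) (- affineE6 i j) := by
  have hs := fun (i : Fin 7) (R : Pt) (hR : R ∈ surface α β γ) =>
    component_smooth (i := i) hR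
  rcases index_cases i with rfl | ⟨b, rfl | rfl⟩ <;>
    rcases index_cases j with rfl | ⟨b', rfl | rfl⟩
  · exact intersection_zero_zero
  · rw [(affineE6_zero b').1]
    exact intersection_zero_inner b'
  · rw [(affineE6_zero b').2.2.1]
    exact hasIntersectionNumber_zero (hs _) fun R hR h h' => not_le_outer_of_le_zero hR h' h
  · rw [(affineE6_zero b).2.1]
    exact intersection_inner_zero b
  · rw [affineE6_inner_inner]
    split_ifs with hb
    · subst hb
      exact intersection_inner_self b
    · exact hasIntersectionNumber_zero (hs _) fun R hR h h' =>
        not_over_of_over hb (over_of_le_inner hR h') (over_of_le_inner hR h)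
  · rw [affineE6_inner_outer]
    split_ifs with hb
    · subst hb
      exact intersection_inner_outer b
    · exact hasIntersectionNumber_zero (hs _) fun R hR h h' =>
        not_over_of_over hb (over_of_le_inner hR h') (over_of_le_outer hR h)
  · rw [(affineE6_zero b).2.2.2]
    exact hasIntersectionNumber_zero (hs _) fun R hR h h' => not_le_outer_of_le_zero hR h h'
  · rw [affineE6_outer_inner]
    split_ifs with hb
    · subst hb
      exact intersection_outer_inner b
    · exact hasIntersectionNumber_zero (hs _) fun R hR h h' =>
        not_over_of_over hb (over_of_le_outer hR h') (over_of_le_inner hR h)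
  · rw [affineE6_outer_outer]
    split_ifs with hb
    · subst hb
      exact intersection_outer_self b
    · exact hasIntersectionNumber_zero (hs _) fun R hR h h' =>
        not_over_of_over hb (over_of_le_outer hR h') (over_of_le_outer hR h)

/-- The components are told apart by the crossing points: the line contains all the points `N0`, an
inner component only the one of its branch, an outer component none; outer components differ by
`N1`. -/
theorem component_injective : Function.Injective (component α β γ) := by
  intro i j hij
  have h0 : ∀ b, component α β γ 0 ≠ component α β γ (inner b) := fun b h => by
    obtain ⟨b', hb⟩ := exists_ne b
    have h1 := N0_le_zero (α := α) (β := β) (γ := γ) b'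
    rw [h] at h1
    exact hb (inner_injective ((of_N0_le h1).resolve_left (inner_ne_zero b))).symm
  have h1 : ∀ b, component α β γ 0 ≠ component α β γ (outer b) := fun b h => by
    have h1 := N0_le_zero (α := α) (β := β) (γ := γ) b
    rw [h] at h1
    exact not_le_outer_of_le_zero (N0_mem b) (N0_le_zero b) h1
  have h2 : ∀ b b', component α β γ (inner b) ≠ component α β γ (outer b') := fun b b' h => by
    have h1 := N0_le_inner (α := α) (β := β) (γ := γ) b
    rw [h] at h1
    exact not_le_outer_of_le_zero (N0_mem b) (N0_le_zero b) h1
  rcases index_cases i with rfl | ⟨b, rfl | rfl⟩ <;>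
    rcases index_cases j with rfl | ⟨b', rfl | rfl⟩
  · rfl
  · exact absurd hij (h0 b')
  · exact absurd hij (h1 b')
  · exact absurd hij.symm (h0 b)
  · have h := N0_le_inner (α := α) (β := β) (γ := γ) b
    rw [hij] at h
    exact ((of_N0_le h).resolve_left (inner_ne_zero b')).symm
  · exact absurd hij (h2 b b')
  · exact absurd hij.symm (h1 b)
  · exact absurd hij.symm (h2 b' b)
  · have h := N1_le_outer (α := α) (β := β) (γ := γ) b
    rw [hij] at h
    exact ((of_N1_le h).resolve_left fun h => inner_ne_outer b b' h.symm).symm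

theorem component_isCurve (i : Fin 7) : IsCurve (surface α β γ) (component α β γ i) := by
  rcases index_cases i with rfl | ⟨b, rfl | rfl⟩
  · rw [component_zero α β γ 0, ← Branch.D0_eq_N0 (gen_branch α β γ 0)]
    exact isCurve_curveAt (Branch.gen_N0 (gen_branch α β γ 0)) 0 (N0_mem 0)
  · rw [component_inner, ← Branch.D1_eq_N1 (gen_branch α β γ b)]
    exact isCurve_curveAt (Branch.gen_N1 (gen_branch α β γ b)) 0 (N1_mem b)
  · rw [component_outer, ← Branch.D2_eq_N2 (gen_branch α β γ b)]
    exact isCurve_curveAt (Branch.gen_N2 (gen_branch α β γ b)) 0 (N2_mem b)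

theorem component_isSmoothRational (i : Fin 7) :
    IsSmoothRational (surface α β γ) (component α β γ i) := by
  refine ⟨fun R hR => component_smooth hR, ?_⟩
  rcases index_cases i with rfl | ⟨b, rfl | rfl⟩
  · exact exists_residue_eq gen_inf
  · rw [component_inner]
    exact exists_residue_eq (Branch.gen_uY (gen_branch α β γ b))
  · rw [component_outer]
    exact exists_residue_eq (Branch.gen_ur (gen_branch α β γ b))

/-- The surface is of type `E₆⁽¹⁾`. -/
theorem isOfTypeE6_surface (α β γ : ℂ) :
    IsOfTypeE6 (surface α β γ) (dWedge x y) (component α β γ) where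
  injective := component_injective
  isCurve := component_isCurve
  smoothRational := component_isSmoothRational
  intersection := intersection_component
  anticanonical _ hR := (localForm_surface hR).polar

end Components

/-! ### The charts of the phase space -/

theorem algebraMap_eq_const (c : ℂ) : algebraMap ℂ K c = const c := rfl

theorem coord_one (α β γ : ℂ) :
    coord α β γ 1 = (1 / (branch α β γ 0).X, -(branch α β γ 0).q) := by
  change (1 / x, -(((y - x - 2 * const α) * x + 2 * const α ^ 2 - 2 * const β + const γ) * x)) =
    (1 / x, -(((y - x - const (2 * α)) * x - const (-(2 * α ^ 2 - 2 * β + γ))) * x))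
  rw [const_neg, const_add, const_sub, const_mul, const_mul, const_mul, const_pow, const_two]
  congr 1
  ring

theorem coord_two (α β γ : ℂ) :
    coord α β γ 2 = (1 / (branch α β γ 1).X, -(branch α β γ 1).q) := by
  change (1 / x, -(((y + x + 2 * const α) * x - 2 * const α ^ 2 + 2 * const β + const γ) * x)) =
    (1 / x, -(((y + x - const (-(2 * α))) * x - const (2 * α ^ 2 - 2 * β - γ)) * x))
  rw [const_neg, const_sub, const_sub, const_mul, const_mul, const_mul, const_pow, const_two]
  congr 1
  ring

theorem coord_three (α β γ : ℂ) :
    coord α β γ 3 = ((branch α β γ 2).q, 1 / (branch α β γ 2).X) := by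
  change (-((x * y + 2 * const γ) * y), 1 / y) =
    (((-x - const 0) * y - const (2 * γ)) * y, 1 / y)
  rw [const_mul, const_two, const_zero]
  congr 1
  ring

theorem index_succ : ∀ j : Fin 4, j = 0 ∨ ∃ b : Fin 3, j = b.succ := by decide

theorem gen_coord (α β γ : ℂ) (j : Fin 4) : Gen (coord α β γ j).1 (coord α β γ j).2 := by
  fin_cases j
  · exact gen_x_y
  · change Gen (coord α β γ 1).1 (coord α β γ 1).2
    rw [coord_one]
    exact (Branch.gen_uq (gen_branch α β γ 0)).neg
  · change Gen (coord α β γ 2).1 (coord α β γ 2).2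
    rw [coord_two]
    exact (Branch.gen_uq (gen_branch α β γ 1)).neg
  · change Gen (coord α β γ 3).1 (coord α β γ 3).2
    rw [coord_three]
    exact (Branch.gen_uq (gen_branch α β γ 2)).swap

theorem chart_injective (α β γ : ℂ) (j : Fin 4) : Function.Injective (chart α β γ j) := by
  rintro ⟨a, b, t⟩ ⟨a', b', t'⟩ h
  obtain ⟨ev, hev, h1, h2⟩ := exists_place_pointAt (gen_coord α β γ j) a b
  obtain ⟨ev', hev', h1', h2'⟩ := exists_place_pointAt (gen_coord α β γ j) a' b'
  have hR : pointAt (coord α β γ j).1 (coord α β γ j).2 a b =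
      pointAt (coord α β γ j).1 (coord α β γ j).2 a' b' := congrArg Prod.fst h
  obtain rfl := eq_of_val hev' hR h1 h1'
  obtain rfl := eq_of_val hev' hR h2 h2'
  obtain rfl : t = t' := congrArg Prod.snd h
  rfl

/-! ### Inversion of the transformations -/

section Transform

variable {F : Type} [Field F]

/-- The inversion formulas are stated over any field because they are applied both to functions in
`K` and to their values in `ℂ`. -/
theorem transform_inv_one {x y α β γ y₁ : F} (hx : x ≠ 0)
    (h : y₁ = -(((y - x - 2 * α) * x + 2 * α ^ 2 - 2 * β + γ) * x)) :
    y = x + 2 * α + (-(2 * α ^ 2 - 2 * β + γ) - y₁ * (1 / x)) * (1 / x) := by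
  subst h
  field_simp
  ring

theorem transform_inv_two {x y α β γ y₂ : F} (hx : x ≠ 0)
    (h : y₂ = -(((y + x + 2 * α) * x - 2 * α ^ 2 + 2 * β + γ) * x)) :
    y = -x - 2 * α + (-(2 * β - 2 * α ^ 2 + γ) - y₂ * (1 / x)) * (1 / x) := by
  subst h
  field_simp
  ring

theorem transform_inv_three {x y γ x₃ : F} (hy : y ≠ 0) (h : x₃ = -((x * y + 2 * γ) * y)) :
    x = (-x₃ * (1 / y) - 2 * γ) * (1 / y) := by
  subst h
  field_simp
  ring

/-- The transformations are bijective where the distinguished coordinate does not vanish. -/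
theorem exists_transform (α β γ : ℂ) (b : Fin 3) (p : ℂ × ℂ)
    (hp : (if b = 2 then p.2 else p.1) ≠ 0) :
    ∃ q : ℂ × ℂ, denominator q.1 q.2 b.succ ≠ 0 ∧ p = transform α β γ q.1 q.2 b.succ := by
  obtain ⟨s, t⟩ := p
  fin_cases b
  · have hs : s ≠ 0 := hp
    refine ⟨(1 / s, 1 / s + 2 * α + (-(2 * α ^ 2 - 2 * β + γ) - t * s) * s),
      one_div_ne_zero hs, ?_⟩
    refine Prod.ext (one_div_one_div s).symm ?_
    change t = -(((1 / s + 2 * α + (-(2 * α ^ 2 - 2 * β + γ) - t * s) * s - 1 / s - 2 * α) *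
      (1 / s) + 2 * α ^ 2 - 2 * β + γ) * (1 / s))
    field_simp
    ring
  · have hs : s ≠ 0 := hp
    refine ⟨(1 / s, -(1 / s) - 2 * α + (-(-2 * α ^ 2 + 2 * β + γ) - t * s) * s),
      one_div_ne_zero hs, ?_⟩
    refine Prod.ext (one_div_one_div s).symm ?_
    change t = -(((-(1 / s) - 2 * α + (-(-2 * α ^ 2 + 2 * β + γ) - t * s) * s + 1 / s + 2 * α) *
      (1 / s) - 2 * α ^ 2 + 2 * β + γ) * (1 / s))
    field_simp
    ring
  · have ht : t ≠ 0 := hp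
    refine ⟨((-s * t - 2 * γ) * t, 1 / t), one_div_ne_zero ht, ?_⟩
    refine Prod.ext ?_ (one_div_one_div t).symm
    change s = -(((-s * t - 2 * γ) * t * (1 / t) + 2 * γ) * (1 / t))
    field_simp
    ring

end Transform

/-! ### Values of the chart coordinates at a point of the affine plane -/

section Values

variable {R : Pt} {ev : R →ₐ[ℂ] ℂ} {α β γ a b : ℂ}

theorem val_coord (hev : IsPlace ev) (ha : Val ev x a) (hb : Val ev y b) {j : Fin 4}
    (hd : denominator a b j ≠ 0) : Val ev (coord α β γ j).1 (transform α β γ a b j).1 ∧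
      Val ev (coord α β γ j).2 (transform α β γ a b j).2 := by
  have hα : Val ev (const α) α := Val.const α
  have hβ : Val ev (const β) β := Val.const β
  have hγ : Val ev (const γ) γ := Val.const γ
  fin_cases j
  · exact ⟨ha, hb⟩
  · exact ⟨Val.one.div hev ha hd, ((((((hb.sub ha).sub (Val.two.mul hα)).mul ha).add
      (Val.two.mul (hα.pow 2))).sub (Val.two.mul hβ)).add hγ).mul ha |>.neg⟩
  · exact ⟨Val.one.div hev ha hd, ((((((hb.add ha).add (Val.two.mul hα)).mul ha).sub
      (Val.two.mul (hα.pow 2))).add (Val.two.mul hβ)).add hγ).mul ha |>.neg⟩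
  · exact ⟨(((ha.mul hb).add (Val.two.mul hγ)).mul hb).neg, Val.one.div hev hb hd⟩

theorem val_of_val_coord (hev : IsPlace ev) {j : Fin 4} (hd : denominator a b j ≠ 0)
    (h₁ : Val ev (coord α β γ j).1 (transform α β γ a b j).1)
    (h₂ : Val ev (coord α β γ j).2 (transform α β γ a b j).2) : Val ev x a ∧ Val ev y b := by
  have hα : Val ev (const α) α := Val.const α
  have hβ : Val ev (const β) β := Val.const β
  have hγ : Val ev (const γ) γ := Val.const γ
  fin_cases j
  · exact ⟨h₁, h₂⟩
  · have hu : Val ev (1 / x) (1 / a) := h₁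
    have ha : a ≠ 0 := hd
    have hx : Val ev x a := (hu.inv hev (one_div_ne_zero ha)).congr (by simp) (by simp)
    refine ⟨hx, ?_⟩
    refine ((hx.add (Val.two.mul hα)).add (((((Val.two.mul (hα.pow 2)).sub
      (Val.two.mul hβ)).add hγ).neg.sub (h₂.mul hu)).mul hu)).congr ?_ ?_
    · exact (transform_inv_one x_ne rfl).symm
    · exact (transform_inv_one ha rfl).symm
  · have hu : Val ev (1 / x) (1 / a) := h₁
    have ha : a ≠ 0 := hd
    have hx : Val ev x a := (hu.inv hev (one_div_ne_zero ha)).congr (by simp) (by simp)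
    refine ⟨hx, ?_⟩
    refine ((hx.neg.sub (Val.two.mul hα)).add (((((Val.two.mul hβ).sub
      (Val.two.mul (hα.pow 2))).add hγ).neg.sub (h₂.mul hu)).mul hu)).congr ?_ ?_
    · exact (transform_inv_two x_ne rfl).symm
    · exact (transform_inv_two ha rfl).symm
  · have hu : Val ev (1 / y) (1 / b) := h₂
    have hb : b ≠ 0 := hd
    refine ⟨?_, (hu.inv hev (one_div_ne_zero hb)).congr (by simp) (by simp)⟩
    refine (((h₁.neg.mul hu).sub (Val.two.mul hγ)).mul hu).congr ?_ ?_
    · exact (transform_inv_three y_ne rfl).symm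
    · exact (transform_inv_three hb rfl).symm

end Values

/-- One of the coordinates is `1 / x` or `1 / y`, which is not regular where `x` or `y` vanishes. -/
theorem denominator_ne_zero {α β γ a b : ℂ} {j : Fin 4}
    (h₁ : (coord α β γ j).1 ∈ pointAt x y a b) (h₂ : (coord α β γ j).2 ∈ pointAt x y a b) :
    denominator a b j ≠ 0 := by
  obtain ⟨ev, hev, hx, hy⟩ := place_affine a b
  fin_cases j
  · exact one_ne_zero
  · rintro (rfl : a = 0)
    have h : 1 / x ∈ pointAt x y 0 b := h₁
    exact hx.inv_notMem x_ne (one_div x ▸ h)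
  · rintro (rfl : a = 0)
    have h : 1 / x ∈ pointAt x y 0 b := h₁
    exact hx.inv_notMem x_ne (one_div x ▸ h)
  · rintro (rfl : b = 0)
    have h : 1 / y ∈ pointAt x y a 0 := h₂
    exact hy.inv_notMem y_ne (one_div y ▸ h)

theorem chart_eq_chart_zero_iff (α β γ : ℂ) (j : Fin 4) (p q : ℂ × ℂ × ℂ) :
    chart α β γ j p = chart α β γ 0 q ↔ denominator q.1 q.2.1 j ≠ 0 ∧
      (p.1, p.2.1) = transform α β γ q.1 q.2.1 j ∧ p.2.2 = q.2.2 := by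
  obtain ⟨a, b, t⟩ := q
  obtain ⟨s₁, s₂, t'⟩ := p
  constructor
  · intro h
    have hR : pointAt (coord α β γ j).1 (coord α β γ j).2 s₁ s₂ = pointAt x y a b :=
      congrArg Prod.fst h
    obtain ⟨ev, hev, h1, h2⟩ := exists_place_pointAt (gen_coord α β γ j) s₁ s₂
    obtain ⟨ev', hev', hx, hy⟩ := place_affine a b
    have hd : denominator a b j ≠ 0 :=
      denominator_ne_zero (α := α) (β := β) (γ := γ) (hR ▸ h1.mem) (hR ▸ h2.mem)
    obtain ⟨h1', h2'⟩ := val_coord (α := α) (β := β) (γ := γ) hev' hx hy hd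
    exact ⟨hd, Prod.ext (eq_of_val hev' hR h1 h1') (eq_of_val hev' hR h2 h2'),
      show t' = t from congrArg Prod.snd h⟩
  · rintro ⟨hd, hp, rfl : t' = t⟩
    obtain rfl : s₁ = (transform α β γ a b j).1 := congrArg Prod.fst hp
    obtain rfl : s₂ = (transform α β γ a b j).2 := congrArg Prod.snd hp
    refine Prod.ext (pointAt_eq (gen_coord α β γ j) gen_x_y ?_ ?_) rfl
    · exact fun T ev hev h1 h2 => val_of_val_coord hev hd h1 h2
    · exact fun T ev hev h1 h2 => val_coord hev h1 h2 hd

/-- The second coordinate of the charts `1` and `2` is `-q`, while in chart `3` the first coordinate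
is `q`; this accounts for the sign and the order. -/
theorem chart_F3 (α β γ : ℂ) (b : Fin 3) (p : ℂ × ℂ × ℂ)
    (hp : (if b = 2 then p.2.1 else p.1) = 0) :
    (chart α β γ b.succ p).1 = (branch α β γ b).F3 (if b = 2 then p.1 else -p.2.1) := by
  obtain ⟨s₁, s₂, t⟩ := p
  have hg := gen_branch α β γ b
  fin_cases b
  · obtain rfl : s₁ = 0 := hp
    change pointAt (coord α β γ 1).1 (coord α β γ 1).2 0 s₂ = _
    rw [coord_one]
    exact pointAt_eq (Branch.gen_uq hg).neg (Branch.gen_uq hg)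
      (fun _ _ _ h₁ h₂ => ⟨h₁, h₂.neg.congr (neg_neg _) rfl⟩)
      (fun _ _ _ h₁ h₂ => ⟨h₁, h₂.neg.congr rfl (neg_neg _)⟩)
  · obtain rfl : s₁ = 0 := hp
    change pointAt (coord α β γ 2).1 (coord α β γ 2).2 0 s₂ = _
    rw [coord_two]
    exact pointAt_eq (Branch.gen_uq hg).neg (Branch.gen_uq hg)
      (fun _ _ _ h₁ h₂ => ⟨h₁, h₂.neg.congr (neg_neg _) rfl⟩)
      (fun _ _ _ h₁ h₂ => ⟨h₁, h₂.neg.congr rfl (neg_neg _)⟩)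
  · obtain rfl : s₂ = 0 := hp
    change pointAt (coord α β γ 3).1 (coord α β γ 3).2 s₁ 0 = _
    rw [coord_three]
    exact pointAt_swap (Branch.gen_uq hg).swap

theorem exists_chart_F3 (α β γ : ℂ) (b : Fin 3) (c t : ℂ) :
    ((branch α β γ b).F3 c, t) ∈ Set.range (chart α β γ b.succ) := by
  by_cases hb : b = 2
  · refine ⟨(c, 0, t), Prod.ext ?_ rfl⟩
    rw [chart_F3 α β γ b _ (by rw [if_pos hb]), if_pos hb]
  · refine ⟨(0, -c, t), Prod.ext ?_ rfl⟩
    rw [chart_F3 α β γ b _ (by rw [if_neg hb]), if_neg hb, neg_neg]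

/-- Where the distinguished coordinate is nonzero the transformation can be inverted; where it
vanishes the point is on the third exceptional curve. -/
theorem chart_dichotomy (α β γ : ℂ) (b : Fin 3) (p : ℂ × ℂ × ℂ) :
    chart α β γ b.succ p ∈ Set.range (chart α β γ 0) ∨
      ∃ c, (chart α β γ b.succ p).1 = (branch α β γ b).F3 c := by
  by_cases hp : (if b = 2 then p.2.1 else p.1) = 0
  · exact Or.inr ⟨_, chart_F3 α β γ b p hp⟩
  · obtain ⟨q, hd, hq⟩ := exists_transform α β γ b (p.1, p.2.1) hp
    exact Or.inl ⟨(q.1, q.2, p.2.2),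
      ((chart_eq_chart_zero_iff α β γ b.succ p (q.1, q.2, p.2.2)).2 ⟨hd, hq, rfl⟩).symm⟩

theorem chart_inter (α β γ : ℂ) {j k : Fin 4} {p q : ℂ × ℂ × ℂ} (hjk : j ≠ k)
    (h : chart α β γ j p = chart α β γ k q) :
    chart α β γ j p ∈ Set.range (chart α β γ 0) := by
  rcases index_succ j with rfl | ⟨b, rfl⟩
  · exact ⟨p, rfl⟩
  rcases index_succ k with rfl | ⟨b', rfl⟩
  · exact ⟨q, h.symm⟩
  rcases chart_dichotomy α β γ b p with h1 | ⟨c, h1⟩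
  · exact h1
  rcases chart_dichotomy α β γ b' q with h2 | ⟨c', h2⟩
  · rwa [h]
  -- The common point would lie over two different directions at infinity.
  · exfalso
    rw [h, h2] at h1
    have ho := Branch.over_of_mem_points (gen_branch α β γ b')
      (Or.inr (Or.inr (Or.inr (Or.inr (Or.inr ⟨c', rfl⟩)))))
    rw [h1] at ho
    exact not_over_of_over (fun hb => hjk (congrArg Fin.succ hb.symm)) ho
      (Branch.over_of_mem_points (gen_branch α β γ b)
        (Or.inr (Or.inr (Or.inr (Or.inr (Or.inr ⟨c, rfl⟩))))))

theorem regularLocus_eq (α β γ : ℂ) :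
    regularLocus (surface α β γ) (hamiltonianField (hamiltonian α β γ)) =
      {R | R ∈ surface α β γ ∧ ∀ i, ¬ R ≤ component α β γ i} :=
  Set.ext fun _ => and_congr_right fun hR => (localForm_surface hR).regular_iff

theorem affine_or_F3 {α β γ : ℂ} {R : Pt} (hR : R ∈ surface α β γ)
    (hD : ∀ i, ¬ R ≤ component α β γ i) :
    (∃ a b, R = pointAt x y a b) ∨ ∃ b c, R = (branch α β γ b).F3 c := by
  rcases of_mem_surface hR with h | ⟨c, -, -, rfl⟩ | ⟨b, h⟩
  · exact Or.inl h
  · exact absurd (pointAt_le_curveAt gen_inf c) (hD 0)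
  · have hg := gen_branch α β γ b
    rcases h with rfl | rfl | rfl | ⟨c, -, rfl⟩ | ⟨c, -, rfl⟩ | ⟨c, rfl⟩
    · exact absurd (N0_le_zero b) (hD _)
    · exact absurd (N1_le_inner b) (hD _)
    · exact absurd (N2_le_outer b) (hD _)
    · refine absurd ?_ (hD (inner b))
      rw [component_inner]
      exact pointAt_le_curveAt (Branch.gen_uY hg) c
    · refine absurd ?_ (hD (outer b))
      rw [component_outer]
      exact pointAt_le_curveAt (Branch.gen_ur hg) c
    · exact Or.inr ⟨b, c, rfl⟩

theorem iUnion_range_chart (α β γ : ℂ) :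
    {R | R ∈ surface α β γ ∧ ∀ i, ¬ R ≤ component α β γ i} ×ˢ (Set.univ : Set ℂ) =
      ⋃ j, Set.range (chart α β γ j) := by
  ext ⟨R, t⟩
  rw [Set.mem_iUnion]
  constructor
  · rintro ⟨⟨hR, hD⟩, -⟩
    rcases affine_or_F3 hR hD with ⟨a, b, h⟩ | ⟨b, c, h⟩
    · exact ⟨0, (a, b, t), Prod.ext h.symm rfl⟩
    · exact ⟨b.succ, by
        rw [show R = (branch α β γ b).F3 c from h]
        exact exists_chart_F3 α β γ b c t⟩
  · have h0 : ∀ p, chart α β γ 0 p ∈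
        {R | R ∈ surface α β γ ∧ ∀ i, ¬ R ≤ component α β γ i} ×ˢ (Set.univ : Set ℂ) :=
      fun p => ⟨⟨affine_mem_surface α β γ p.1 p.2.1, fun i => not_affine_le⟩, trivial⟩
    rintro ⟨j, p, hp⟩
    rcases index_succ j with rfl | ⟨b, rfl⟩
    · exact hp ▸ h0 p
    · rcases chart_dichotomy α β γ b p with ⟨q, hq⟩ | ⟨c, hc⟩
      · rw [← hp, ← hq]
        exact h0 q
      · rw [hp] at hc
        obtain rfl : R = (branch α β γ b).F3 c := hc
        exact ⟨⟨mem_surface_of_mem_points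
          (Or.inr (Or.inr (Or.inr (Or.inr (Or.inr ⟨c, rfl⟩))))), fun i => not_F3_le⟩, trivial⟩

/-! ### The Hamiltonians -/

namespace Branch

variable {g : Branch} {ω : ExteriorAlgebra K (Ω[K⁄ℂ])} {v : Derivation ℂ K K}

/-- The Hamiltonian in the coordinates `u = 1 / X` and `q`. -/
def ham (g : Branch) (u q : MvPolynomial (Fin 2) ℂ) : MvPolynomial (Fin 2) ℂ :=
  let r := MvPolynomial.C g.e₂ + u * q
  let Y := MvPolynomial.C g.e₁ + u * r
  MvPolynomial.C g.κ * q + MvPolynomial.C g.l * r * (Y + MvPolynomial.C g.e₁) +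
    MvPolynomial.C g.m * Y ^ 3 + MvPolynomial.C g.c * Y ^ 2 + MvPolynomial.C g.e * Y

theorem r_eq_add (h : Gen g.X g.Y) : g.r = const g.e₂ + 1 / g.X * g.q := by
  have := X_ne h
  rw [q]
  field_simp
  ring

theorem Y_eq_add (h : Gen g.X g.Y) : g.Y = const g.e₁ + 1 / g.X * g.r := by
  have := X_ne h
  rw [r]
  field_simp
  ring

theorem aeval_ham (h : Gen g.X g.Y) {p₁ p₂ : K} {U Q : MvPolynomial (Fin 2) ℂ}
    (hU : MvPolynomial.aeval ![p₁, p₂] U = 1 / g.X) (hQ : MvPolynomial.aeval ![p₁, p₂] Q = g.q) :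
    MvPolynomial.aeval ![p₁, p₂] (g.ham U Q) = const g.κ * g.q +
      const g.l * g.r * (g.Y + const g.e₁) + const g.m * g.Y ^ 3 + const g.c * g.Y ^ 2 +
      const g.e * g.Y := by
  simp only [ham, map_add, map_mul, map_pow, hU, hQ, MvPolynomial.aeval_C]
  simp only [algebraMap_eq_const, ← r_eq_add h, ← Y_eq_add h]

/-- Because `dX ∧ dY = -du ∧ dq`, Hamilton's equations are `q' = ∂H/∂u` and `u' = -∂H/∂q`; this is
the chain rule for them. General `U, Q` serve both the charts `(u, -q)` and the chart `(q, u)`. -/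
theorem aeval_pderiv_ham (hg : g.Adapted ω v) {p₁ p₂ : K} {U Q : MvPolynomial (Fin 2) ℂ}
    (hU : MvPolynomial.aeval ![p₁, p₂] U = 1 / g.X) (hQ : MvPolynomial.aeval ![p₁, p₂] Q = g.q)
    (i : Fin 2) : MvPolynomial.aeval ![p₁, p₂] (MvPolynomial.pderiv i (g.ham U Q)) =
      v g.q * MvPolynomial.aeval ![p₁, p₂] (MvPolynomial.pderiv i U) -
        v (1 / g.X) * MvPolynomial.aeval ![p₁, p₂] (MvPolynomial.pderiv i Q) := by
  have h := hg.gen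
  rw [field_u hg, field_q hg]
  simp only [ham, map_add, Derivation.leibniz, Derivation.leibniz_pow, MvPolynomial.pderiv_C,
    smul_eq_mul, nsmul_eq_mul, map_mul, map_pow, hU, hQ, MvPolynomial.aeval_C, map_natCast,
    mul_zero, zero_add, add_zero]
  simp only [algebraMap_eq_const, ← r_eq_add h, ← Y_eq_add h]
  push_cast
  have hr := r_eq_add h
  have hY := Y_eq_add h
  generalize MvPolynomial.aeval ![p₁, p₂] (MvPolynomial.pderiv i U) = dU
  generalize MvPolynomial.aeval ![p₁, p₂] (MvPolynomial.pderiv i Q) = dQ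
  -- Once `Y` and `r` are expressed through `1 / X` and `q`, only a polynomial identity remains.
  generalize g.Y = Y at *
  generalize g.r = r at *
  subst hY hr
  ring

end Branch

theorem dWedge_neg (f g : K) : dWedge f (-g) = -dWedge f g := by simp [dWedge]

/-- A chart is symplectic, and the system is a polynomial Hamiltonian system in it. -/
def IsHamiltonianChart (α β γ : ℂ) (j : Fin 4) : Prop :=
  dWedge (coord α β γ j).1 (coord α β γ j).2 = dWedge x y ∧
    ∃ G : MvPolynomial (Fin 2) ℂ,
      MvPolynomial.aeval ![(coord α β γ j).1, (coord α β γ j).2] G =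
        MvPolynomial.aeval ![x, y] (hamiltonian α β γ) ∧
      hamiltonianField (hamiltonian α β γ) (coord α β γ j).1 =
        MvPolynomial.aeval ![(coord α β γ j).1, (coord α β γ j).2] (MvPolynomial.pderiv 1 G) ∧
      hamiltonianField (hamiltonian α β γ) (coord α β γ j).2 =
        -MvPolynomial.aeval ![(coord α β γ j).1, (coord α β γ j).2] (MvPolynomial.pderiv 0 G)

theorem aeval_hamiltonian (α β γ : ℂ) : MvPolynomial.aeval ![x, y] (hamiltonian α β γ) =
    1 / 2 * x * y ^ 2 - 1 / 2 * x ^ 3 - 2 * const α * x ^ 2 - 2 * const β * x + const γ * y := by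
  simp only [hamiltonian, map_add, map_sub, map_mul, map_pow, MvPolynomial.aeval_C,
    MvPolynomial.aeval_X, Matrix.cons_val_zero, Matrix.cons_val_one]
  simp only [algebraMap_eq_const, const_half, const_two]

/-- The whole cubic and quadratic growth in `X` is absorbed by `κ q` and `l r (Y + e₁)`; this is
what makes `H` polynomial after the three blow-ups. -/
theorem ham_branch (α β γ : ℂ) (b : Fin 3) :
    const (branch α β γ b).κ * (branch α β γ b).q + const (branch α β γ b).l *
      (branch α β γ b).r * ((branch α β γ b).Y + const (branch α β γ b).e₁) +
      const (branch α β γ b).m * (branch α β γ b).Y ^ 3 +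
      const (branch α β γ b).c * (branch α β γ b).Y ^ 2 +
      const (branch α β γ b).e * (branch α β γ b).Y =
    MvPolynomial.aeval ![x, y] (hamiltonian α β γ) := by
  obtain ⟨ev, -⟩ := place_affine 0 0
  have h2 : (2 : K) ≠ 0 := (Val.two (ev := ev)).ne_zero two_ne_zero
  rw [aeval_hamiltonian, Branch.q, Branch.r]
  fin_cases b
  · change const 1 * (((y - x - const (2 * α)) * x - const (-(2 * α ^ 2 - 2 * β + γ))) * x) +
      const (1 / 2) * ((y - x - const (2 * α)) * x) * (y - x + const (2 * α)) +
      const 0 * (y - x) ^ 3 + const 0 * (y - x) ^ 2 + const γ * (y - x) = _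
    rw [const_neg, const_add, const_sub, const_mul, const_mul, const_mul, const_pow, const_two,
      const_half, const_one, const_zero]
    field_simp
    ring
  · change const (-1) * (((y + x - const (-(2 * α))) * x - const (2 * α ^ 2 - 2 * β - γ)) * x) +
      const (1 / 2) * ((y + x - const (-(2 * α))) * x) * (y + x + const (-(2 * α))) +
      const 0 * (y + x) ^ 3 + const 0 * (y + x) ^ 2 + const γ * (y + x) = _
    rw [const_neg, const_neg, const_sub, const_sub, const_mul, const_mul, const_mul, const_pow,
      const_two, const_half, const_one, const_zero]
    field_simp
    ring
  · change const (-(1 / 2)) * (((-x - const 0) * y - const (2 * γ)) * y) +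
      const 0 * ((-x - const 0) * y) * (-x + const 0) +
      const (1 / 2) * (-x) ^ 3 + const (-(2 * α)) * (-x) ^ 2 + const (2 * β) * -x = _
    rw [const_neg, const_neg, const_mul, const_mul, const_mul, const_two, const_half, const_zero]
    field_simp
    ring

/-- The sign of `-q` makes the chart symplectic; in the next lemma the order `(q, u)` plays the same
role. -/
theorem isHamiltonianChart_of_eq {α β γ : ℂ} {j : Fin 4} (b : Fin 3)
    (h : coord α β γ j = (1 / (branch α β γ b).X, -(branch α β γ b).q)) :
    IsHamiltonianChart α β γ j := by
  have had := branch_adapted α β γ b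
  rw [IsHamiltonianChart, h]
  refine ⟨?_, (branch α β γ b).ham (MvPolynomial.X 0) (-MvPolynomial.X 1), ?_, ?_, ?_⟩
  · rw [dWedge_neg, Branch.wedge_uq had, neg_one_smul, neg_neg]
  · rw [Branch.aeval_ham had.gen (by simp) (by simp), ham_branch]
  · rw [Branch.aeval_pderiv_ham had (by simp) (by simp)]
    simp [MvPolynomial.pderiv_X]
  · rw [Branch.aeval_pderiv_ham had (by simp) (by simp)]
    simp [MvPolynomial.pderiv_X]

theorem isHamiltonianChart_of_eq_swap {α β γ : ℂ} {j : Fin 4} (b : Fin 3)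
    (h : coord α β γ j = ((branch α β γ b).q, 1 / (branch α β γ b).X)) :
    IsHamiltonianChart α β γ j := by
  have had := branch_adapted α β γ b
  rw [IsHamiltonianChart, h]
  refine ⟨?_, (branch α β γ b).ham (MvPolynomial.X 1) (MvPolynomial.X 0), ?_, ?_, ?_⟩
  · rw [dWedge_swap, Branch.wedge_uq had, neg_one_smul, neg_neg]
  · rw [Branch.aeval_ham had.gen (by simp) (by simp), ham_branch]
  · rw [Branch.aeval_pderiv_ham had (by simp) (by simp)]
    simp [MvPolynomial.pderiv_X]
  · rw [Branch.aeval_pderiv_ham had (by simp) (by simp)]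
    simp [MvPolynomial.pderiv_X]

theorem isHamiltonianChart (α β γ : ℂ) (j : Fin 4) : IsHamiltonianChart α β γ j := by
  fin_cases j
  · have h := (exists_derivation (MvPolynomial.aeval ![x, y] (MvPolynomial.pderiv 1
      (hamiltonian α β γ))) (-MvPolynomial.aeval ![x, y] (MvPolynomial.pderiv 0
      (hamiltonian α β γ)))).choose_spec
    exact ⟨rfl, hamiltonian α β γ, rfl, h⟩
  · exact isHamiltonianChart_of_eq 0 (coord_one α β γ)
  · exact isHamiltonianChart_of_eq 1 (coord_two α β γ)
  · exact isHamiltonianChart_of_eq_swap 2 (coord_three α β γ)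

end

end Ince

/-- For all parameters, blowing up `ℙ²` at nine explicit points gives a rational surface `X` of
type `E₆⁽¹⁾`. The Ince-XXX vector field on `X` has no accessible singularity on the anticanonical
curve `D` and is regular precisely off `D`; the phase space so obtained, times the `t`-line, is
glued from four copies of `ℂ² × ℂ` by the birational symplectic transformations
`(x, y) ↦ (x_j, y_j)`, and the system is a polynomial Hamiltonian system on each of them. -/
theorem mainTheorem8 (α β γ : ℂ) :
    ∃ (X : Set Ince.Pt) (D : Fin 7 → Ince.Pt),
      -- `X` is a nine-fold blow-up of the projective plane
      Ince.IteratedBlowUp Ince.projectivePlane (Ince.centres α β γ) X ∧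
      -- `X` is of type `E₆⁽¹⁾`
      Ince.IsOfTypeE6 X (Ince.dWedge Ince.x Ince.y) D ∧
      -- all accessible singularities are resolved
      Ince.HasLogPole X D (Ince.hamiltonianField (Ince.hamiltonian α β γ)) ∧
      (∀ R ∈ X, ¬ Ince.IsAccessible D (Ince.hamiltonianField (Ince.hamiltonian α β γ)) R) ∧
      -- the phase space is the complement of `D`
      Ince.regularLocus X (Ince.hamiltonianField (Ince.hamiltonian α β γ)) =
        {R | R ∈ X ∧ ∀ i, ¬ R ≤ D i} ∧
      -- the phase space, times the `t`-line, is covered by the four charts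
      (∀ j, Function.Injective (Ince.chart α β γ j)) ∧
      Ince.regularLocus X (Ince.hamiltonianField (Ince.hamiltonian α β γ)) ×ˢ
        (Set.univ : Set ℂ) = ⋃ j, Set.range (Ince.chart α β γ j) ∧
      -- the gluing of the charts
      (∀ (j : Fin 4) (p q : ℂ × ℂ × ℂ), Ince.chart α β γ j p = Ince.chart α β γ 0 q ↔
        Ince.denominator q.1 q.2.1 j ≠ 0 ∧
          (p.1, p.2.1) = Ince.transform α β γ q.1 q.2.1 j ∧ p.2.2 = q.2.2) ∧
      (∀ (j k : Fin 4) (p q : ℂ × ℂ × ℂ), j ≠ k → Ince.chart α β γ j p = Ince.chart α β γ k q →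
        Ince.chart α β γ j p ∈ Set.range (Ince.chart α β γ 0)) ∧
      -- the transformations are birational and symplectic, and the system is a polynomial
      -- Hamiltonian system in each chart
      ∀ j, IntermediateField.adjoin ℂ {(Ince.coord α β γ j).1, (Ince.coord α β γ j).2} = ⊤ ∧
        Ince.dWedge (Ince.coord α β γ j).1 (Ince.coord α β γ j).2 = Ince.dWedge Ince.x Ince.y ∧
        ∃ G : MvPolynomial (Fin 2) ℂ,
          MvPolynomial.aeval ![(Ince.coord α β γ j).1, (Ince.coord α β γ j).2] G =
            MvPolynomial.aeval ![Ince.x, Ince.y] (Ince.hamiltonian α β γ) ∧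
          Ince.hamiltonianField (Ince.hamiltonian α β γ) (Ince.coord α β γ j).1 =
            MvPolynomial.aeval ![(Ince.coord α β γ j).1, (Ince.coord α β γ j).2]
              (MvPolynomial.pderiv 1 G) ∧
          Ince.hamiltonianField (Ince.hamiltonian α β γ) (Ince.coord α β γ j).2 =
            -MvPolynomial.aeval ![(Ince.coord α β γ j).1, (Ince.coord α β γ j).2]
              (MvPolynomial.pderiv 0 G) := by
  have hloc := Ince.regularLocus_eq α β γ
  refine ⟨Ince.surface α β γ, Ince.component α β γ, Ince.iteratedBlowUp_surface α β γ,
    Ince.isOfTypeE6_surface α β γ, fun R hR => (Ince.localForm_surface hR).logPole,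
    fun R hR => (Ince.localForm_surface hR).not_accessible, hloc,
    Ince.chart_injective α β γ, ?_, Ince.chart_eq_chart_zero_iff α β γ,
    fun _ _ _ _ => Ince.chart_inter α β γ,
    fun j => ⟨Ince.gen_coord α β γ j, Ince.isHamiltonianChart α β γ j⟩⟩
  rw [hloc]
  exact Ince.iUnion_range_chart α β γ
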